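/- Throughout, $n\ge 1$, $\mathcal E$ is a complex Hilbert space, $\mathcal H$ is an infinite dimensional complex Hilbert space, and tensor products of Hilbert spaces are completed. Let $\mathbb F_n^+$ be the free semigroup with unit on $n$ generators $g_1,\dots,g_n$, and $X_\alpha:=X_{i_1}\cdots X_{i_k}$ for $\alpha=g_{i_1}\cdots g_{i_k}$. Let $F^2(H_n)$ be the full Fock space with orthonormal basis $e_\alpha$ ($\alpha\in\mathbb F_n^+$, $1$ denoting the vacuum vector), let $S_ie_\alpha:=e_{g_i\alpha}$ and $R_ie_\alpha:=e_{\alpha g_i}$ be the left and right creation operators, let $\mathcal A_n$ be the norm closed algebra generated by $S_1,\dots,S_n$ and $I$, and let $\mathcal A_n(\mathcal E):=B(\mathcal E)\otimes_{min}\mathcal A_n\subset B(\mathcal E\otimes F^2(H_n))$, where $\otimes_{min}$ denotes the norm closed span of the elementary tensors $A\otimes B$. Let $[B(\mathcal H)^n]_1:=\{X\in B(\mathcal H)^n:\ \|\sum_iX_iX_i^*\|^{1/2}<1\}$. For $X$ in this ball put $$\Delta_X:=\Big(I-\sum_iX_iX_i^*\Big)^{1/2},\qquad K_Xh:=(I\otimes\Delta_X)\Big(I-\sum_iR_i\otimes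 X_i^*\Big)^{-1}(1\otimes h)\quad(h\in\mathcal H),$$ $$\mathbf P_X[f]:=(I_{\mathcal E}\otimes K_X^*)(f\otimes I_{\mathcal H})(I_{\mathcal E}\otimes K_X),\qquad f\in B(\mathcal E\otimes F^2(H_n)).$$ A free holomorphic function on the ball with coefficients $A_{(\alpha)}\in B(\mathcal E)$ is $F(X)=\sum_{k\ge0}\sum_{|\alpha|=k}A_{(\alpha)}\otimes X_\alpha$ (norm convergence for every $X$ in the ball), where $\limsup_k\|\sum_{|\alpha|=k}A_{(\alpha)}^*A_{(\alpha)}\|^{1/2k}\le 1$. A free pluriharmonic function is $u=\operatorname{Re}F_1+i\operatorname{Re}F_2$ with $F_1,F_2$ free holomorphic. The same coefficients define its representation on the ball $[B(\mathcal K)^n]_1$ of any Hilbert space $\mathcal K$; in particular $u(rS_1,\dots,rS_n)$, $0\le r<1$, is the value at $(rS_1,\dots,rS_n)$ of its representation on $F^2(H_n)$. **Theorem.** Let $u:[B(\mathcal H)^n]_1\to B(\mathcal E)\otimes_{min}B(\mathcal H)$. The following are equivalent: 1. $u$ is a free pluriharmonic function and $\sup_X\|u(X)\|<\infty$ over $X\in[B(\mathcal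 H)^n]_1$; 2. $u$ is a free pluriharmonic function whose representation on every Hilbert space is bounded on the corresponding unit ball; 3. there exists $f\in\overline{\mathcal A_n(\mathcal E)^*+\mathcal A_n(\mathcal E)}^{SOT}$ such that $u(X)=\mathbf P_X[f]$ for all $X\in[B(\mathcal H)^n]_1$. In this case the representation of $u$ on $F^2(H_n)$ is uniquely determined by $u$, and $f=\mathrm{SOT}\text{-}\lim_{r\to1}u(rS_1,\dots,rS_n)$. Moreover, the map $\Phi(u):=f$ is a linear bijection from the space $Har^\infty(B(\mathcal H)^n_1)$ of bounded free pluriharmonic functions $[B(\mathcal H)^n]_1\to B(\mathcal E)\otimes_{min}B(\mathcal H)$ onto $\overline{\mathcal A_n(\mathcal E)^*+\mathcal A_n(\mathcal E)}^{SOT}$, and it is completely isometric: for all $m$ and all $m\times m$ matrices $[u_{ij}]$ over $Har^\infty(B(\mathcal H)^n_1)$, $$\big\|[\Phi(u_{ij})]\big\|=\sup_{X\in[B(\mathcal H)^n]_1}\big\|[u_{ij}(X)]\big\|,$$ where matrices of operators on $\mathcal L$ are normed as operators on the direct sum of $m$ copies of $\mathcal L$. -/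

import Mathlib

open scoped TensorProduct
open Filter Topology

universe u v w

namespace FreeHarmonic

noncomputable section

/-! ### Hilbert space tensor products and tensor products of operators -/

/-- The Hilbert space tensor product `E ⊗ F`: the completion of the algebraic tensor product for
the inner product determined by `⟪a ⊗ b, c ⊗ d⟫ = ⟪a, c⟫ ⟪b, d⟫`. -/
def HilbertTensor (E : Type u) (F : Type v)
    [NormedAddCommGroup E] [InnerProductSpace ℂ E]
    [NormedAddCommGroup F] [InnerProductSpace ℂ F] : Type (max u v) :=
  UniformSpace.Completion (E ⊗[ℂ] F)

section Tensor

variable {E F G H : Type*}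
  [NormedAddCommGroup E] [InnerProductSpace ℂ E]
  [NormedAddCommGroup F] [InnerProductSpace ℂ F]
  [NormedAddCommGroup G] [InnerProductSpace ℂ G]
  [NormedAddCommGroup H] [InnerProductSpace ℂ H]

instance : NormedAddCommGroup (HilbertTensor E F) :=
  inferInstanceAs (NormedAddCommGroup (UniformSpace.Completion (E ⊗[ℂ] F)))

instance : InnerProductSpace ℂ (HilbertTensor E F) :=
  inferInstanceAs (InnerProductSpace ℂ (UniformSpace.Completion (E ⊗[ℂ] F)))

instance : CompleteSpace (HilbertTensor E F) :=
  inferInstanceAs (CompleteSpace (UniformSpace.Completion (E ⊗[ℂ] F)))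

/-- The isometric inclusion of the algebraic tensor product in its completion. -/
def tensorIncl : E ⊗[ℂ] F →ₗᵢ[ℂ] HilbertTensor E F where
  toFun x := ((x : UniformSpace.Completion (E ⊗[ℂ] F)) : HilbertTensor E F)
  map_add' x y := UniformSpace.Completion.coe_add x y
  map_smul' c x := UniformSpace.Completion.coe_smul c x
  norm_map' x := UniformSpace.Completion.norm_coe x

theorem denseRange_tensorIncl : DenseRange (tensorIncl : E ⊗[ℂ] F →ₗᵢ[ℂ] HilbertTensor E F) :=
  UniformSpace.Completion.denseRange_coe (α := E ⊗[ℂ] F)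

/-- The operator `a ⊗ b : E ⊗ G → F ⊗ H`, with `(a ⊗ b) (x ⊗ y) = a x ⊗ b y`. -/
def opTensor (a : E →L[ℂ] F) (b : G →L[ℂ] H) : HilbertTensor E G →L[ℂ] HilbertTensor F H :=
  (tensorIncl.toContinuousLinearMap.comp (TensorProduct.mapL a b)).extend
    (tensorIncl : E ⊗[ℂ] G →ₗᵢ[ℂ] HilbertTensor E G).toContinuousLinearMap

theorem opTensor_incl (a : E →L[ℂ] F) (b : G →L[ℂ] H) (x : E ⊗[ℂ] G) :
    opTensor a b (tensorIncl x) = tensorIncl (TensorProduct.mapL a b x) :=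
  ContinuousLinearMap.extend_eq _ (e := (tensorIncl : E ⊗[ℂ] G →ₗᵢ[ℂ] _).toContinuousLinearMap)
    denseRange_tensorIncl tensorIncl.isometry.isUniformInducing x

theorem clm_ext_incl {S T : HilbertTensor E G →L[ℂ] HilbertTensor F H}
    (h : ∀ x : E ⊗[ℂ] G, S (tensorIncl x) = T (tensorIncl x)) : S = T :=
  DFunLike.coe_injective (denseRange_tensorIncl.equalizer S.continuous T.continuous (funext h))

theorem opTensor_add_left (a a' : E →L[ℂ] F) (b : G →L[ℂ] H) :
    opTensor (a + a') b = opTensor a b + opTensor a' b :=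
  clm_ext_incl fun x => by
    simp only [add_apply, opTensor_incl, TensorProduct.mapL_add_left, map_add]

theorem opTensor_smul_left (c : ℂ) (a : E →L[ℂ] F) (b : G →L[ℂ] H) :
    opTensor (c • a) b = c • opTensor a b :=
  clm_ext_incl fun x => by
    simp only [smul_apply, opTensor_incl, TensorProduct.mapL_smul_left, map_smul]

/-- The bounded operator `h ↦ x ⊗ h`. -/
def tensorLeft (x : E) : H →L[ℂ] HilbertTensor E H :=
  tensorIncl.toContinuousLinearMap.comp (TensorProduct.mkL ℂ E H x)

/-- Inclusion of the algebraic threefold tensor product in `E ⊗ (F ⊗ H)`. -/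
def inclRight : E ⊗[ℂ] (F ⊗[ℂ] H) →ₗᵢ[ℂ] HilbertTensor E (HilbertTensor F H) :=
  tensorIncl.comp ((tensorIncl : F ⊗[ℂ] H →ₗᵢ[ℂ] HilbertTensor F H).lTensor E)

/-- Inclusion of the algebraic threefold tensor product in `(E ⊗ F) ⊗ H`. -/
def inclLeft : (E ⊗[ℂ] F) ⊗[ℂ] H →ₗᵢ[ℂ] HilbertTensor (HilbertTensor E F) H :=
  tensorIncl.comp ((tensorIncl : E ⊗[ℂ] F →ₗᵢ[ℂ] HilbertTensor E F).rTensor H)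

theorem denseRange_lTensor (f : F →ₗᵢ[ℂ] G) (hf : DenseRange f) :
    DenseRange (f.lTensor E) := by
  have key : (LinearMap.range (f.lTensor E).toLinearMap).topologicalClosure = ⊤ := by
    rw [eq_top_iff, ← TensorProduct.span_tmul_eq_top, Submodule.span_le]
    rintro _ ⟨x, y, rfl⟩
    refine hf.induction_on (p := fun y => x ⊗ₜ[ℂ] y ∈ _) y ?_ ?_
    · exact (Submodule.isClosed_topologicalClosure _).preimage
        (TensorProduct.mkL ℂ E G x).continuous
    · intro z
      apply Submodule.le_topologicalClosure
      exact ⟨x ⊗ₜ z, by simp⟩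
  intro x
  have hx : x ∈ (LinearMap.range (f.lTensor E).toLinearMap).topologicalClosure := by
    rw [key]; trivial
  exact hx

theorem denseRange_rTensor (f : F →ₗᵢ[ℂ] G) (hf : DenseRange f) :
    DenseRange (f.rTensor E) := by
  have key : (LinearMap.range (f.rTensor E).toLinearMap).topologicalClosure = ⊤ := by
    rw [eq_top_iff, ← TensorProduct.span_tmul_eq_top, Submodule.span_le]
    rintro _ ⟨x, y, rfl⟩
    refine hf.induction_on (p := fun x => x ⊗ₜ[ℂ] y ∈ _) x ?_ ?_
    · exact (Submodule.isClosed_topologicalClosure _).preimage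
        ((TensorProduct.mkL ℂ G E).flip y).continuous
    · intro z
      apply Submodule.le_topologicalClosure
      exact ⟨z ⊗ₜ y, by simp⟩
  intro x
  have hx : x ∈ (LinearMap.range (f.rTensor E).toLinearMap).topologicalClosure := by
    rw [key]; trivial
  exact hx

theorem denseRange_inclRight : DenseRange (inclRight : E ⊗[ℂ] (F ⊗[ℂ] H) →ₗᵢ[ℂ] _) :=
  denseRange_tensorIncl.comp (denseRange_lTensor _ denseRange_tensorIncl)
    tensorIncl.continuous

theorem denseRange_inclLeft : DenseRange (inclLeft : (E ⊗[ℂ] F) ⊗[ℂ] H →ₗᵢ[ℂ] _) :=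
  denseRange_tensorIncl.comp (denseRange_rTensor _ denseRange_tensorIncl)
    tensorIncl.continuous

variable (E F H) in
/-- The canonical unitary `E ⊗ (F ⊗ H) ≃ (E ⊗ F) ⊗ H`, `x ⊗ (y ⊗ z) ↦ (x ⊗ y) ⊗ z`. -/
def hilbertAssoc :
    HilbertTensor E (HilbertTensor F H) ≃ₗᵢ[ℂ] HilbertTensor (HilbertTensor E F) H :=
  (TensorProduct.assoc ℂ E F H).symm.extendOfIsometry inclRight.toLinearMap inclLeft.toLinearMap
    denseRange_inclRight denseRange_inclLeft (by
      intro x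
      simp only [LinearIsometry.coe_toLinearMap, LinearIsometry.norm_map]
      exact (TensorProduct.assocIsometry ℂ E F H).symm.norm_map x)

/-- The spatial (minimal) tensor product `M ⊗_min N` of linear spaces of operators: the norm closed
linear span of the operators `a ⊗ b`, `a ∈ M`, `b ∈ N`. -/
def minTensor (M : Submodule ℂ (E →L[ℂ] E)) (N : Submodule ℂ (H →L[ℂ] H)) :
    Submodule ℂ (HilbertTensor E H →L[ℂ] HilbertTensor E H) :=
  (Submodule.span ℂ {T | ∃ a ∈ M, ∃ b ∈ N, T = opTensor a b}).topologicalClosure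

end Tensor

/-- `B(E) ⊗_min B(H)`. -/
abbrev MinTensor (E : Type u) (H : Type v)
    [NormedAddCommGroup E] [InnerProductSpace ℂ E]
    [NormedAddCommGroup H] [InnerProductSpace ℂ H] :
    Submodule ℂ (HilbertTensor E H →L[ℂ] HilbertTensor E H) :=
  minTensor (⊤ : Submodule ℂ (E →L[ℂ] E)) (⊤ : Submodule ℂ (H →L[ℂ] H))

section Operators

variable {K : Type*} [NormedAddCommGroup K] [InnerProductSpace ℂ K]

/-- The closure of a linear space of operators in the strong operator topology. -/
def sotClosure (M : Submodule ℂ (K →L[ℂ] K)) : Submodule ℂ (K →L[ℂ] K) :=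
  ((M.map (ContinuousLinearMap.toPointwiseConvergenceCLM ℂ (RingHom.id ℂ) K K :
      (K →L[ℂ] K) →ₗ[ℂ] (K →Lₚₜ[ℂ] K))).topologicalClosure).comap
    (ContinuousLinearMap.toPointwiseConvergenceCLM ℂ (RingHom.id ℂ) K K :
      (K →L[ℂ] K) →ₗ[ℂ] (K →Lₚₜ[ℂ] K))

/-- `M^* = {a^* | a ∈ M}`. -/
def adjointSpace [CompleteSpace K] (M : Submodule ℂ (K →L[ℂ] K)) : Submodule ℂ (K →L[ℂ] K) where
  carrier := {a | star a ∈ M}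
  add_mem' ha hb := by
    have := M.add_mem ha hb
    rw [← star_add] at this
    exact this
  zero_mem' := by simp
  smul_mem' c a ha := by
    have := M.smul_mem (star c) ha
    rw [← star_smul] at this
    exact this

/-- The operator on the Hilbert direct sum `K^{(m)}` with the matrix of entries `T i j`. Its operator
norm is the norm of the matrix `T` in `M_m(B(K))`. -/
def matrixOp {m : ℕ} (T : Fin m → Fin m → (K →L[ℂ] K)) :
    PiLp 2 (fun _ : Fin m => K) →L[ℂ] PiLp 2 (fun _ : Fin m => K) :=
  ((PiLp.continuousLinearEquiv 2 ℂ (fun _ : Fin m => K)).symm :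
      (Fin m → K) →L[ℂ] PiLp 2 (fun _ : Fin m => K)).comp
    (ContinuousLinearMap.pi fun i => ∑ j, (T i j).comp (PiLp.proj 2 (fun _ : Fin m => K) j))

end Operators

/-! ### The full Fock space, the creation operators and the noncommutative disc algebra -/

/-- The full Fock space `F²(H_n)`, written in its orthonormal basis `e_α`, where `α` runs over the
free semigroup with unit on `n` generators. -/
abbrev Fock (n : ℕ) : Type := lp (fun _ : FreeMonoid (Fin n) => ℂ) 2

open scoped Classical in
/-- The basis vector `e_α = e_{i_1} ⊗ ⋯ ⊗ e_{i_k}` for `α = g_{i_1} ⋯ g_{i_k}`; `fockBasis 1` is the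
vacuum vector. -/
def fockBasis {n : ℕ} (α : FreeMonoid (Fin n)) : Fock n := lp.single 2 α (1 : ℂ)

theorem fockBasis_orthonormal (n : ℕ) :
    Orthonormal ℂ (fockBasis : FreeMonoid (Fin n) → Fock n) := by
  classical
  rw [orthonormal_iff_ite]
  intro α β
  simp only [fockBasis, lp.inner_single_left]
  by_cases h : α = β
  · subst h; simp
  · simp [h]

/-- The isometry of the Fock space that maps `e_α` to `e_{σ α}`, for an injective map `σ`. -/
def basisShift {n : ℕ} (σ : FreeMonoid (Fin n) → FreeMonoid (Fin n)) (hσ : Function.Injective σ) :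
    Fock n →ₗᵢ[ℂ] Fock n :=
  ((fockBasis_orthonormal n).comp σ hσ).orthogonalFamily.linearIsometry

theorem basisShift_fockBasis {n : ℕ} (σ : FreeMonoid (Fin n) → FreeMonoid (Fin n))
    (hσ : Function.Injective σ) (α : FreeMonoid (Fin n)) :
    basisShift σ hσ (fockBasis α) = fockBasis (σ α) := by
  classical
  have h := ((fockBasis_orthonormal n).comp σ hσ).orthogonalFamily.linearIsometry_apply_single
    (i := α) (1 : ℂ)
  simp only [LinearIsometry.toSpanSingleton_apply, one_smul, Function.comp_apply] at h
  rw [basisShift, ← h, fockBasis]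

/-- The left creation operator `S_i e_α = e_i ⊗ e_α`. -/
def leftCreation {n : ℕ} (i : Fin n) : Fock n →L[ℂ] Fock n :=
  (basisShift (fun α => FreeMonoid.of i * α) (mul_right_injective _)).toContinuousLinearMap

/-- The right creation operator `R_i e_α = e_α ⊗ e_i`. -/
def rightCreation {n : ℕ} (i : Fin n) : Fock n →L[ℂ] Fock n :=
  (basisShift (fun α => α * FreeMonoid.of i) (mul_left_injective _)).toContinuousLinearMap

/-- The noncommutative disc algebra `A_n`: the norm closed algebra generated by `S_1, …, S_n` and
the identity. -/
def discAlgebra (n : ℕ) : Subalgebra ℂ (Fock n →L[ℂ] Fock n) :=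
  (Algebra.adjoin ℂ (Set.range (leftCreation (n := n)))).topologicalClosure

/-- `A_n(E) = B(E) ⊗_min A_n`. -/
def discAlgebraTensor (n : ℕ) (E : Type u) [NormedAddCommGroup E] [InnerProductSpace ℂ E] :
    Submodule ℂ (HilbertTensor E (Fock n) →L[ℂ] HilbertTensor E (Fock n)) :=
  minTensor (⊤ : Submodule ℂ (E →L[ℂ] E)) (Subalgebra.toSubmodule (discAlgebra n))

/-- The closure of `A_n(E)^* + A_n(E)` in the strong operator topology. -/
def boundarySpace (n : ℕ) (E : Type u) [NormedAddCommGroup E] [InnerProductSpace ℂ E] :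
    Submodule ℂ (HilbertTensor E (Fock n) →L[ℂ] HilbertTensor E (Fock n)) :=
  sotClosure (adjointSpace (discAlgebraTensor n E) ⊔ discAlgebraTensor n E)

/-! ### The noncommutative unit ball and the Poisson transform -/

/-- The open noncommutative unit ball `[B(H)^n]_1`. -/
def ncBall (n : ℕ) (H : Type v) [NormedAddCommGroup H] [InnerProductSpace ℂ H]
    [CompleteSpace H] : Set (Fin n → (H →L[ℂ] H)) :=
  {X | Real.sqrt ‖∑ i, X i * star (X i)‖ < 1}

theorem hasSum_basisShift {n : ℕ} (σ : FreeMonoid (Fin n) → FreeMonoid (Fin n))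
    (hσ : Function.Injective σ) (x : Fock n) :
    HasSum (fun α => x α • (fockBasis (σ α) : Fock n)) (basisShift σ hσ x) :=
  ((fockBasis_orthonormal n).comp σ hσ).orthogonalFamily.hasSum_linearIsometry x

theorem leftCreation_star_mul {n : ℕ} (i j : Fin n) :
    star (leftCreation i) * leftCreation j =
      if i = j then (1 : Fock n →L[ℂ] Fock n) else 0 := by
  classical
  have key : ∀ x y : Fock n, inner ℂ (leftCreation i x) (leftCreation j y) =
      if i = j then inner ℂ x y else 0 := by
    intro x y
    split_ifs with h
    · subst h
      exact LinearIsometry.inner_map_map _ x y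
    · have h1 : ∀ α β : FreeMonoid (Fin n),
          inner ℂ (fockBasis (FreeMonoid.of i * α) : Fock n)
            (fockBasis (FreeMonoid.of j * β)) = 0 := by
        intro α β
        refine (fockBasis_orthonormal n).2 fun he => h ?_
        have := congrArg FreeMonoid.toList he
        simp only [FreeMonoid.toList_of_mul, List.cons.injEq] at this
        exact this.1
      have h2 : ∀ α : FreeMonoid (Fin n),
          inner ℂ (fockBasis (FreeMonoid.of i * α) : Fock n) (leftCreation j y) = 0 := by
        intro α
        have := (hasSum_basisShift _ (mul_right_injective (FreeMonoid.of j)) y).mapL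
          (innerSL ℂ (fockBasis (FreeMonoid.of i * α) : Fock n))
        simp only [map_smul, innerSL_apply_apply, h1, smul_zero] at this
        exact this.unique hasSum_zero
      have h3 := (hasSum_basisShift _ (mul_right_injective (FreeMonoid.of i)) x).mapL
        (innerSL ℂ (leftCreation j y))
      simp only [map_smul, innerSL_apply_apply, inner_eq_zero_symm.1 (h2 _), smul_zero] at h3
      exact inner_eq_zero_symm.1 (h3.unique hasSum_zero)
  refine ContinuousLinearMap.ext fun y => ext_inner_left ℂ fun x => ?_
  change inner ℂ x (ContinuousLinearMap.adjoint (leftCreation i) (leftCreation j y)) = _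
  rw [ContinuousLinearMap.adjoint_inner_right, key]
  split_ifs <;> simp

theorem norm_sum_smul_mul_star_le {A : Type*} [CStarAlgebra A] {n : ℕ} (a : Fin n → A)
    (ha : ∀ i j, star (a i) * a j = if i = j then 1 else 0) (c : ℂ) :
    ‖∑ i, (c • a i) * star (c • a i)‖ ≤ ‖c‖ * ‖c‖ := by
  set P : A := ∑ i : Fin n, a i * star (a i) with hP
  have hPs : star P = P := by simp [hP, star_sum]
  have hPP : P * P = P := by
    rw [hP, Finset.sum_mul_sum]
    refine Finset.sum_congr rfl fun i _ => ?_
    have : ∀ j : Fin n, a i * star (a i) * (a j * star (a j)) =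
        if i = j then a i * star (a i) else 0 := by
      intro j
      rw [mul_assoc, ← mul_assoc (star _), ha]
      split_ifs with h
      · subst h; simp
      · simp
    simp [this]
  have hn : ‖P‖ ≤ 1 := by
    have h : ‖star P * P‖ = ‖P‖ * ‖P‖ := CStarRing.norm_star_mul_self
    rw [hPs, hPP] at h
    nlinarith [norm_nonneg P]
  have hsum : ∑ i : Fin n, (c • a i) * star (c • a i) = (c * star c) • P := by
    rw [hP, Finset.smul_sum]
    refine Finset.sum_congr rfl fun i _ => ?_
    rw [star_smul, smul_mul_smul_comm]
  rw [hsum, norm_smul, norm_mul, norm_star]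
  exact mul_le_of_le_one_right (mul_nonneg (norm_nonneg _) (norm_nonneg _)) hn

theorem smul_leftCreation_mem_ncBall {n : ℕ} {r : ℝ} (hr : r ∈ Set.Ico (0 : ℝ) 1) :
    (fun i : Fin n => (r : ℂ) • leftCreation i) ∈ ncBall n (Fock n) := by
  have h := norm_sum_smul_mul_star_le (A := Fock n →L[ℂ] Fock n) leftCreation
    leftCreation_star_mul (r : ℂ)
  have hr2 : ‖(r : ℂ)‖ = r := by simp [abs_of_nonneg hr.1]
  rw [hr2] at h
  change Real.sqrt _ < 1
  rw [Real.sqrt_lt' one_pos]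
  exact lt_of_le_of_lt h (by nlinarith [hr.1, hr.2])

/-- The point `rS = (r S_1, …, r S_n)` of the noncommutative ball, for `0 ≤ r < 1`. -/
def radialShift (n : ℕ) (r : Set.Ico (0 : ℝ) 1) : ncBall n (Fock n) :=
  ⟨fun i => ((r : ℝ) : ℂ) • leftCreation i, smul_leftCreation_mem_ncBall r.2⟩

section Poisson

variable {n : ℕ} {E H : Type*}
  [NormedAddCommGroup E] [InnerProductSpace ℂ E] [CompleteSpace E]
  [NormedAddCommGroup H] [InnerProductSpace ℂ H] [CompleteSpace H]

/-- `Δ_X = (I - ∑ X_i X_i^*)^{1/2}`. -/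
def ncDefect (X : Fin n → (H →L[ℂ] H)) : H →L[ℂ] H :=
  CFC.sqrt (1 - ∑ i, X i * star (X i))

/-- `B_X = (I ⊗ Δ_X) (I - R_1 ⊗ X_1^* - ⋯ - R_n ⊗ X_n^*)⁻¹`. The inverse exists for `X` in the
noncommutative unit ball. -/
def berezinKernel (X : Fin n → (H →L[ℂ] H)) :
    HilbertTensor (Fock n) H →L[ℂ] HilbertTensor (Fock n) H :=
  opTensor (1 : Fock n →L[ℂ] Fock n) (ncDefect X) *
    Ring.inverse (1 - ∑ i, opTensor (rightCreation i) (star (X i)))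

/-- The noncommutative Poisson kernel `K_X : H → F²(H_n) ⊗ H`, the restriction of `B_X` to
`1 ⊗ H`. -/
def ncPoissonKernel (X : Fin n → (H →L[ℂ] H)) : H →L[ℂ] HilbertTensor (Fock n) H :=
  (berezinKernel X).comp (tensorLeft (fockBasis (1 : FreeMonoid (Fin n))))

/-- `I_E ⊗ K_X`, as an operator from `E ⊗ H` to `E ⊗ F²(H_n) ⊗ H`. -/
def ampliatedKernel (E : Type*) [NormedAddCommGroup E] [InnerProductSpace ℂ E]
    (X : Fin n → (H →L[ℂ] H)) :
    HilbertTensor E H →L[ℂ] HilbertTensor (HilbertTensor E (Fock n)) H :=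
  (hilbertAssoc E (Fock n) H : HilbertTensor E (HilbertTensor (Fock n) H) →L[ℂ]
      HilbertTensor (HilbertTensor E (Fock n)) H).comp
    (opTensor (1 : E →L[ℂ] E) (ncPoissonKernel X))

/-- The operator-valued Poisson transform
`𝐏_X[f] = (I_E ⊗ K_X^*) (f ⊗ I_H) (I_E ⊗ K_X)` of `f ∈ B(E ⊗ F²(H_n))`. -/
def poissonTransform (X : Fin n → (H →L[ℂ] H))
    (f : HilbertTensor E (Fock n) →L[ℂ] HilbertTensor E (Fock n)) :
    HilbertTensor E H →L[ℂ] HilbertTensor E H :=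
  (ContinuousLinearMap.adjoint (ampliatedKernel E X)).comp
    ((opTensor f (1 : H →L[ℂ] H)).comp (ampliatedKernel E X))

end Poisson

/-! ### Free holomorphic and free pluriharmonic functions -/

section Functions

variable {n : ℕ} {E : Type u} {H : Type v}
  [NormedAddCommGroup E] [InnerProductSpace ℂ E] [CompleteSpace E]
  [NormedAddCommGroup H] [InnerProductSpace ℂ H] [CompleteSpace H]

/-- The word `g_{i_1} ⋯ g_{i_k}`. -/
def word {n k : ℕ} (i : Fin k → Fin n) : FreeMonoid (Fin n) := FreeMonoid.ofList (List.ofFn i)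

/-- `‖∑_{|α| = k} A_α^* A_α‖`, as an extended nonnegative real. -/
def coeffNorm (A : FreeMonoid (Fin n) → (E →L[ℂ] E)) (k : ℕ) : ENNReal :=
  ‖∑ i : Fin k → Fin n, star (A (word i)) * A (word i)‖ₑ

/-- The radius of convergence `R` of `∑ A_α ⊗ Z_α`, given by
`1 / R = limsup ‖∑_{|α| = k} A_α^* A_α‖ ^ (1 / 2k)`. -/
def convergenceRadius (A : FreeMonoid (Fin n) → (E →L[ℂ] E)) : ENNReal :=
  (limsup (fun k : ℕ => coeffNorm A k ^ (1 / (2 * (k : ℝ)))) atTop)⁻¹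

/-- The homogeneous part `∑_{|α| = k} A_α ⊗ X_α`. -/
def homPart (A : FreeMonoid (Fin n) → (E →L[ℂ] E)) (X : Fin n → (H →L[ℂ] H)) (k : ℕ) :
    HilbertTensor E H →L[ℂ] HilbertTensor E H :=
  ∑ i : Fin k → Fin n, opTensor (A (word i)) (FreeMonoid.lift X (word i))

/-- `F` is the free holomorphic function on `[B(H)^n]_1` with coefficients `A_α`: the formal power
series `∑ A_α ⊗ Z_α` has radius of convergence at least `1`, and `F(X) = ∑_k ∑_{|α| = k} A_α ⊗ X_α`
in the operator norm. -/
def IsFreeHolomorphicWith (A : FreeMonoid (Fin n) → (E →L[ℂ] E))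
    (F : ncBall n H → (HilbertTensor E H →L[ℂ] HilbertTensor E H)) : Prop :=
  1 ≤ convergenceRadius A ∧ ∀ X : ncBall n H, HasSum (homPart A X.1) (F X)

/-- `Re T = (T + T^*) / 2`. -/
def rePart {K : Type*} [NormedAddCommGroup K] [InnerProductSpace ℂ K] [CompleteSpace K]
    (T : K →L[ℂ] K) : K →L[ℂ] K :=
  (1 / 2 : ℂ) • (T + star T)

/-- `u = Re F₁ + i Re F₂` on `[B(H)^n]_1`, where `F₁` and `F₂` are the free holomorphic functions
with coefficients `A₁` and `A₂`. That is, `u` is the representation on the Hilbert space `H` of the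
free pluriharmonic function given by `A₁` and `A₂`. -/
def IsFreePluriharmonicWith (A₁ A₂ : FreeMonoid (Fin n) → (E →L[ℂ] E))
    (u : ncBall n H → (HilbertTensor E H →L[ℂ] HilbertTensor E H)) : Prop :=
  ∃ F₁ F₂ : ncBall n H → (HilbertTensor E H →L[ℂ] HilbertTensor E H),
    IsFreeHolomorphicWith A₁ F₁ ∧ IsFreeHolomorphicWith A₂ F₂ ∧
      ∀ X, u X = rePart (F₁ X) + Complex.I • rePart (F₂ X)

/-- `u` is a free pluriharmonic function on `[B(H)^n]_1` with coefficients in `B(E)`. -/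
def IsFreePluriharmonic
    (u : ncBall n H → (HilbertTensor E H →L[ℂ] HilbertTensor E H)) : Prop :=
  ∃ A₁ A₂ : FreeMonoid (Fin n) → (E →L[ℂ] E), IsFreePluriharmonicWith A₁ A₂ u

theorem coeffNorm_smul (c : ℂ) (A : FreeMonoid (Fin n) → (E →L[ℂ] E)) (k : ℕ) :
    coeffNorm (c • A) k = ‖c‖ₑ * ‖c‖ₑ * coeffNorm A k := by
  have h : ∑ i : Fin k → Fin n, star ((c • A) (word i)) * (c • A) (word i) =
      (star c * c) • ∑ i : Fin k → Fin n, star (A (word i)) * A (word i) := by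
    rw [Finset.smul_sum]
    refine Finset.sum_congr rfl fun i _ => ?_
    rw [Pi.smul_apply, star_smul, smul_mul_smul_comm]
  rw [coeffNorm, h, enorm_smul, enorm_mul, coeffNorm]
  congr 2
  simp [← ofReal_norm]

theorem coeffNorm_add_le (A B : FreeMonoid (Fin n) → (E →L[ℂ] E)) (k : ℕ) :
    coeffNorm (A + B) k ≤ 2 * (coeffNorm A k + coeffNorm B k) := by
  set P := ∑ i : Fin k → Fin n, star (A (word i)) * A (word i)
  set Q := ∑ i : Fin k → Fin n, star (B (word i)) * B (word i)
  set T := ∑ i : Fin k → Fin n, star ((A + B) (word i)) * (A + B) (word i)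
  have hT : 0 ≤ T := Finset.sum_nonneg fun i _ => star_mul_self_nonneg _
  have hle : T ≤ (2 : ℂ) • (P + Q) := by
    rw [← sub_nonneg]
    have : (2 : ℂ) • (P + Q) - T = ∑ i : Fin k → Fin n,
        star (A (word i) - B (word i)) * (A (word i) - B (word i)) := by
      simp only [P, Q, T, ← Finset.sum_add_distrib, Finset.smul_sum, ← Finset.sum_sub_distrib]
      refine Finset.sum_congr rfl fun i _ => ?_
      rw [two_smul, Pi.add_apply, star_add, star_sub]
      noncomm_ring
    rw [this]
    exact Finset.sum_nonneg fun i _ => star_mul_self_nonneg _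
  have hn : ‖T‖ ≤ ‖(2 : ℂ) • (P + Q)‖ := CStarAlgebra.norm_le_norm_of_nonneg_of_le hT hle
  have he : ‖T‖ₑ ≤ ‖(2 : ℂ) • (P + Q)‖ₑ := by
    rw [← ofReal_norm, ← ofReal_norm]
    exact ENNReal.ofReal_le_ofReal hn
  refine he.trans ?_
  rw [enorm_smul]
  have h2 : ‖(2 : ℂ)‖ₑ = 2 := by simp [← ofReal_norm]
  rw [h2]
  exact mul_le_mul_right (enorm_add_le P Q) 2

theorem one_le_convergenceRadius_iff (A : FreeMonoid (Fin n) → (E →L[ℂ] E)) :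
    1 ≤ convergenceRadius A ↔
      ∀ d : ENNReal, 1 < d → ∀ᶠ k : ℕ in atTop, coeffNorm A k ≤ d ^ (2 * (k : ℝ)) := by
  rw [convergenceRadius, ENNReal.one_le_inv]
  have key : ∀ (k : ℕ) (d : ENNReal), 1 ≤ k →
      (coeffNorm A k ^ (1 / (2 * (k : ℝ))) ≤ d ↔ coeffNorm A k ≤ d ^ (2 * (k : ℝ))) := by
    intro k d hk
    have h0 : (0 : ℝ) < 2 * k := by positivity
    rw [one_div, ENNReal.rpow_inv_le_iff h0]
  constructor
  · intro h d hd
    filter_upwards [eventually_lt_of_limsup_lt (lt_of_le_of_lt h hd), eventually_ge_atTop 1]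
      with k hk h1
    exact (key k d h1).1 hk.le
  · intro h
    refine le_of_forall_gt fun d hd => ?_
    obtain ⟨c, hc, hcd⟩ := exists_between hd
    refine lt_of_le_of_lt (limsup_le_of_le (h := ?_)) hcd
    filter_upwards [h c hc, eventually_ge_atTop 1] with k hk h1
    exact (key k c h1).2 hk

theorem one_le_convergenceRadius_of_le {A B C : FreeMonoid (Fin n) → (E →L[ℂ] E)}
    (hA : 1 ≤ convergenceRadius A) (hB : 1 ≤ convergenceRadius B) {M : ENNReal} (hM : M ≠ ⊤)
    (hC : ∀ k, coeffNorm C k ≤ M * (coeffNorm A k + coeffNorm B k)) :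
    1 ≤ convergenceRadius C := by
  rw [one_le_convergenceRadius_iff] at *
  intro d hd
  obtain ⟨c, hc, hcd⟩ := exists_between hd
  have hctop : c ≠ ⊤ := ne_top_of_lt hcd
  have hc0 : c ≠ 0 := (zero_lt_one.trans hc).ne'
  have hq : 1 < d / c := by
    rw [ENNReal.lt_div_iff_mul_lt (Or.inl hc0) (Or.inl hctop), one_mul]; exact hcd
  have hlim : Tendsto (fun k : ℕ => (d / c) ^ k) atTop (𝓝 ⊤) :=
    ENNReal.tendsto_pow_atTop_nhds_top_iff.2 hq
  have hM2 : M * 2 < ⊤ := ENNReal.mul_lt_top hM.lt_top (by simp)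
  filter_upwards [hA c hc, hB c hc, hlim.eventually (lt_mem_nhds hM2)] with k h1 h2 h3
  have h4 : M * 2 ≤ (d / c) ^ (2 * (k : ℝ)) := by
    refine h3.le.trans ?_
    rw [← ENNReal.rpow_natCast]
    exact ENNReal.rpow_le_rpow_of_exponent_le hq.le
      (by have : (0 : ℝ) ≤ k := Nat.cast_nonneg k
          linarith)
  calc coeffNorm C k ≤ M * (coeffNorm A k + coeffNorm B k) := hC k
    _ ≤ M * (c ^ (2 * (k : ℝ)) + c ^ (2 * (k : ℝ))) := by gcongr
    _ = M * 2 * c ^ (2 * (k : ℝ)) := by ring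
    _ ≤ (d / c) ^ (2 * (k : ℝ)) * c ^ (2 * (k : ℝ)) := by gcongr
    _ = d ^ (2 * (k : ℝ)) := by
      rw [← ENNReal.mul_rpow_of_nonneg _ _ (by positivity),
        ENNReal.div_mul_cancel hc0 hctop]

theorem IsFreeHolomorphicWith.add {A B : FreeMonoid (Fin n) → (E →L[ℂ] E)}
    {F G : ncBall n H → (HilbertTensor E H →L[ℂ] HilbertTensor E H)}
    (hF : IsFreeHolomorphicWith A F) (hG : IsFreeHolomorphicWith B G) :
    IsFreeHolomorphicWith (A + B) (F + G) := by
  refine ⟨one_le_convergenceRadius_of_le hF.1 hG.1 (M := 2) (by simp) (coeffNorm_add_le A B),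
    fun X => ?_⟩
  have : homPart (A + B) X.1 = fun k => homPart A X.1 k + homPart B X.1 k := by
    funext k
    simp only [homPart, Pi.add_apply, opTensor_add_left, Finset.sum_add_distrib]
  rw [this]
  exact (hF.2 X).add (hG.2 X)

theorem IsFreeHolomorphicWith.smul (c : ℂ) {A : FreeMonoid (Fin n) → (E →L[ℂ] E)}
    {F : ncBall n H → (HilbertTensor E H →L[ℂ] HilbertTensor E H)}
    (hF : IsFreeHolomorphicWith A F) : IsFreeHolomorphicWith (c • A) (c • F) := by
  refine ⟨one_le_convergenceRadius_of_le hF.1 hF.1 (M := ‖c‖ₑ * ‖c‖ₑ)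
    (ENNReal.mul_ne_top enorm_ne_top enorm_ne_top) fun k => ?_, fun X => ?_⟩
  · rw [coeffNorm_smul]
    gcongr
    exact le_self_add
  · have : homPart (c • A) X.1 = fun k => c • homPart A X.1 k := by
      funext k
      simp only [homPart, Pi.smul_apply, opTensor_smul_left, Finset.smul_sum]
    rw [this]
    exact (hF.2 X).const_smul c

theorem isFreeHolomorphicWith_zero :
    IsFreeHolomorphicWith (0 : FreeMonoid (Fin n) → (E →L[ℂ] E))
      (0 : ncBall n H → (HilbertTensor E H →L[ℂ] HilbertTensor E H)) := by
  have h0 : ∀ k, coeffNorm (0 : FreeMonoid (Fin n) → (E →L[ℂ] E)) k = 0 := by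
    intro k; simp [coeffNorm]
  refine ⟨?_, fun X => ?_⟩
  · rw [one_le_convergenceRadius_iff]
    intro d _
    exact Eventually.of_forall fun k => by rw [h0]; exact zero_le
  · have hz : ∀ b : H →L[ℂ] H, opTensor (0 : E →L[ℂ] E) b = 0 := by
      intro b
      have := opTensor_smul_left (0 : ℂ) (0 : E →L[ℂ] E) b
      rwa [zero_smul, zero_smul] at this
    have : homPart (0 : FreeMonoid (Fin n) → (E →L[ℂ] E)) X.1 = fun _ => 0 := by
      funext k
      simp only [homPart, Pi.zero_apply, hz, Finset.sum_const_zero]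
    rw [this]
    exact hasSum_zero

theorem rePart_add {K : Type*} [NormedAddCommGroup K] [InnerProductSpace ℂ K] [CompleteSpace K]
    (S T : K →L[ℂ] K) : rePart (S + T) = rePart S + rePart T := by
  simp only [rePart, star_add, smul_add]
  abel

theorem rePart_ofReal_smul {K : Type*} [NormedAddCommGroup K] [InnerProductSpace ℂ K]
    [CompleteSpace K] (a : ℝ) (T : K →L[ℂ] K) :
    rePart ((a : ℂ) • T) = (a : ℂ) • rePart T := by
  rw [rePart, rePart, star_smul, ← starRingEnd_apply, Complex.conj_ofReal, ← smul_add,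
    smul_comm]

theorem IsFreePluriharmonic.zero :
    IsFreePluriharmonic (0 : ncBall n H → (HilbertTensor E H →L[ℂ] HilbertTensor E H)) :=
  ⟨0, 0, 0, 0, isFreeHolomorphicWith_zero, isFreeHolomorphicWith_zero, fun X => by
    simp [rePart]⟩

theorem IsFreePluriharmonic.add
    {u₁ u₂ : ncBall n H → (HilbertTensor E H →L[ℂ] HilbertTensor E H)}
    (h₁ : IsFreePluriharmonic u₁) (h₂ : IsFreePluriharmonic u₂) :
    IsFreePluriharmonic (u₁ + u₂) := by
  obtain ⟨A₁, A₂, F₁, F₂, hF₁, hF₂, hu⟩ := h₁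
  obtain ⟨B₁, B₂, G₁, G₂, hG₁, hG₂, hv⟩ := h₂
  refine ⟨A₁ + B₁, A₂ + B₂, F₁ + G₁, F₂ + G₂, hF₁.add hG₁, hF₂.add hG₂, fun X => ?_⟩
  rw [Pi.add_apply, hu, hv, Pi.add_apply, Pi.add_apply, rePart_add, rePart_add, smul_add]
  abel

theorem IsFreePluriharmonic.smul (c : ℂ)
    {u : ncBall n H → (HilbertTensor E H →L[ℂ] HilbertTensor E H)}
    (h : IsFreePluriharmonic u) : IsFreePluriharmonic (c • u) := by
  obtain ⟨A₁, A₂, F₁, F₂, hF₁, hF₂, hu⟩ := h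
  refine ⟨_, _, _, _, (hF₁.smul (c.re : ℂ)).add (hF₂.smul ((-c.im : ℝ) : ℂ)),
    (hF₁.smul (c.im : ℂ)).add (hF₂.smul (c.re : ℂ)), fun X => ?_⟩
  simp only [Pi.add_apply, Pi.smul_apply, hu, rePart_add, rePart_ofReal_smul]
  generalize rePart (F₁ X) = P
  generalize rePart (F₂ X) = Q
  obtain ⟨a, b⟩ := c
  have hc : (⟨a, b⟩ : ℂ) = (a : ℂ) + Complex.I * (b : ℂ) := by
    rw [mul_comm]; exact Complex.mk_eq_add_mul_I a b
  have hcI : (⟨a, b⟩ : ℂ) * Complex.I = ((-b : ℝ) : ℂ) + Complex.I * (a : ℂ) := by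
    rw [hc, add_mul, mul_right_comm, Complex.I_mul_I]
    push_cast
    ring
  simp only [smul_add, smul_smul, hcI]
  rw [hc]
  simp only [add_smul]
  abel

/-- `v` is the representation on the Hilbert space `K` of the free pluriharmonic function whose
representation on `H` is `u`. -/
def IsRepresentationOf {K : Type w} [NormedAddCommGroup K] [InnerProductSpace ℂ K] [CompleteSpace K]
    (u : ncBall n H → (HilbertTensor E H →L[ℂ] HilbertTensor E H))
    (v : ncBall n K → (HilbertTensor E K →L[ℂ] HilbertTensor E K)) : Prop :=
  ∃ A₁ A₂ : FreeMonoid (Fin n) → (E →L[ℂ] E),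
    IsFreePluriharmonicWith A₁ A₂ u ∧ IsFreePluriharmonicWith A₁ A₂ v

/-- `sup ‖u(X)‖ < ∞` over the noncommutative unit ball. -/
def IsBoundedOnBall (u : ncBall n H → (HilbertTensor E H →L[ℂ] HilbertTensor E H)) : Prop :=
  BddAbove (Set.range fun X => ‖u X‖)

/-- `u` is free pluriharmonic and its representation on every Hilbert space (in the universe `w`)
is bounded. -/
def HasBoundedRepresentations
    (u : ncBall n H → (HilbertTensor E H →L[ℂ] HilbertTensor E H)) : Prop :=
  ∃ A₁ A₂ : FreeMonoid (Fin n) → (E →L[ℂ] E), IsFreePluriharmonicWith A₁ A₂ u ∧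
    ∀ (K : Type w) [NormedAddCommGroup K] [InnerProductSpace ℂ K] [CompleteSpace K],
      ∃ v : ncBall n K → (HilbertTensor E K →L[ℂ] HilbertTensor E K),
        IsFreePluriharmonicWith A₁ A₂ v ∧ IsBoundedOnBall v

set_option linter.unusedSectionVars false

theorem isBoundedOnBall_zero :
    IsBoundedOnBall (0 : ncBall n H → (HilbertTensor E H →L[ℂ] HilbertTensor E H)) := by
  refine ⟨0, ?_⟩
  rintro _ ⟨X, rfl⟩
  exact (norm_zero (E := HilbertTensor E H →L[ℂ] HilbertTensor E H)).le

theorem IsBoundedOnBall.add {u₁ u₂ : ncBall n H → (HilbertTensor E H →L[ℂ] HilbertTensor E H)}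
    (h₁ : IsBoundedOnBall u₁) (h₂ : IsBoundedOnBall u₂) : IsBoundedOnBall (u₁ + u₂) := by
  obtain ⟨C₁, hC₁⟩ := h₁
  obtain ⟨C₂, hC₂⟩ := h₂
  refine ⟨C₁ + C₂, ?_⟩
  rintro _ ⟨X, rfl⟩
  exact (norm_add_le (u₁ X) (u₂ X)).trans (add_le_add (hC₁ ⟨X, rfl⟩) (hC₂ ⟨X, rfl⟩))

theorem IsBoundedOnBall.smul (c : ℂ) {u : ncBall n H → (HilbertTensor E H →L[ℂ] HilbertTensor E H)}
    (h : IsBoundedOnBall u) : IsBoundedOnBall (c • u) := by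
  obtain ⟨C, hC⟩ := h
  refine ⟨‖c‖ * C, ?_⟩
  rintro _ ⟨X, rfl⟩
  exact (ContinuousLinearMap.opNorm_smul_le c (u X)).trans (mul_le_mul_of_nonneg_left (hC ⟨X, rfl⟩) (norm_nonneg c))

variable (n E H) in
/-- `Har^∞(B(H)^n_1)`, the linear space of the bounded free pluriharmonic functions
`[B(H)^n]_1 → B(E) ⊗_min B(H)`. -/
def boundedHarmonic : Submodule ℂ (ncBall n H → MinTensor E H) where
  carrier := {u | IsFreePluriharmonic (fun X => (u X).1) ∧ IsBoundedOnBall (fun X => (u X).1)}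
  zero_mem' := ⟨IsFreePluriharmonic.zero, isBoundedOnBall_zero⟩
  add_mem' h₁ h₂ := ⟨h₁.1.add h₂.1, h₁.2.add h₂.2⟩
  smul_mem' c _ h := ⟨h.1.smul c, h.2.smul c⟩

/-- `f = SOT-lim u(rS_1, …, rS_n)` as `r → 1`, `0 ≤ r < 1`, where `u` is a function on
`[B(F²(H_n))^n]_1`. -/
def IsRadialLimit (u : ncBall n (Fock n) → (HilbertTensor E (Fock n) →L[ℂ] HilbertTensor E (Fock n)))
    (f : HilbertTensor E (Fock n) →L[ℂ] HilbertTensor E (Fock n)) : Prop :=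
  ∀ x, Tendsto (fun r : Set.Ico (0 : ℝ) 1 => u (radialShift n r) x)
    (comap (Subtype.val : Set.Ico (0 : ℝ) 1 → ℝ) (𝓝 1)) (𝓝 (f x))

end Functions

end

end FreeHarmonic

open FreeHarmonic

/-! The Poisson kernel `K_X` is an isometry with `(S_i^* ⊗ I) K_X = K_X X_i^*`. Hence `K_X^* (S_α ⊗
I) K_X = X_α`, and the Poisson transform at `X` is a completely contractive map that preserves
adjoints and sends `a ⊗ S_α` to `a ⊗ X_α`. In particular it sends `u(rS)` to `u(rX)`, so what
remains is to control the limit `r → 1`.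

Operators on `E ⊗ F²` are handled through their matrix entries, indexed by pairs of words and valued
in `B(E)`. The part of `u` of degree `k`, evaluated at `S`, lives in the entries `(γ, β)` whose
lengths differ by `k`. Thus the entries of `u(rS)` are `r ^ gap γ β` times constants
(`entry_pluriRep_radialShift`). If `‖u(rS)‖` is bounded, Fatou's lemma makes every column of
constants square summable, dominated convergence gives convergence on each `x ⊗ e_β`, and the bound
extends this to strong convergence to some `f` (`exists_isRadialLimit`). This `f` lies in the strong
closure because every `u(rS)` lies in `A_n(E)^* + A_n(E)`. The Poisson transform respects strong
limits of bounded families, so its value at `f` is `lim u(rX) = u(X)`.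

Conversely, let `f` be in the strong closure. A net approximating `f` need not be bounded, so only
strongly continuous linear maps are evaluated on it (`boundarySpace_induction`). Matrix entries are
such maps, hence `f` is multi-Toeplitz, and its vacuum column supplies coefficients with radius of
convergence at least `1`. The entries of the Poisson transform at `rS` are also accessible: `(I - ∑
R_i ⊗ r S_i^*)⁻¹` applied to `x ⊗ e_β` is a finite sum, because each `S_i^*` shortens `β`. So the
transform of `f` at `rS` has the entries of `f` multiplied by `r ^ gap γ β`. It therefore equals
`u(rS)` for the coefficients found, is bounded by `‖f‖`, and has radial limit `f`
(`exists_coeff_of_mem_boundarySpace`).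

An infinite dimensional `H` contains an isometric copy `V` of the Fock space. The point `V (rS) V^*`
lies in the ball of `H`, and compressing `u` there by `V` gives `u(rS)` (`compress_pluriRep`). Thus
boundedness on `H` alone bounds `u(rS)`. The same compression shows that `f` is determined by `u`
and, together with lower semicontinuity of the norm under strong limits, gives the nontrivial half
of the complete isometry. -/

namespace FreeHarmonic

noncomputable section

/-! ### Tensor products of vectors and operators -/

section TensorOperators

variable {E F G H K L : Type*}
  [NormedAddCommGroup E] [InnerProductSpace ℂ E]
  [NormedAddCommGroup F] [InnerProductSpace ℂ F]
  [NormedAddCommGroup G] [InnerProductSpace ℂ G]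
  [NormedAddCommGroup H] [InnerProductSpace ℂ H]
  [NormedAddCommGroup K] [InnerProductSpace ℂ K]
  [NormedAddCommGroup L] [InnerProductSpace ℂ L]

/-- The elementary tensor `x ⊗ y` in the Hilbert space tensor product. -/
def hTmul (x : E) (y : F) : HilbertTensor E F := tensorIncl (x ⊗ₜ[ℂ] y)

@[simp] theorem inner_hTmul (x x' : E) (y y' : F) :
    inner ℂ (hTmul x y) (hTmul x' y') = inner ℂ x x' * inner ℂ y y' := by
  rw [hTmul, hTmul, LinearIsometry.inner_map_map, TensorProduct.inner_tmul]

@[simp] theorem norm_hTmul (x : E) (y : F) : ‖hTmul x y‖ = ‖x‖ * ‖y‖ := by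
  rw [hTmul, LinearIsometry.norm_map, TensorProduct.norm_tmul]

@[simp] theorem opTensor_hTmul (a : E →L[ℂ] F) (b : G →L[ℂ] H) (x : E) (y : G) :
    opTensor a b (hTmul x y) = hTmul (a x) (b y) := by
  rw [hTmul, opTensor_incl, TensorProduct.mapL_tmul, hTmul]

@[simp] theorem tensorLeft_apply (x : E) (y : F) : tensorLeft x y = hTmul x y := rfl

theorem hTmul_add_left (x x' : E) (y : F) : hTmul (x + x') y = hTmul x y + hTmul x' y := by
  simp [hTmul, TensorProduct.add_tmul]

theorem hTmul_add_right (x : E) (y y' : F) : hTmul x (y + y') = hTmul x y + hTmul x y' := by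
  simp [hTmul, TensorProduct.tmul_add]

theorem hTmul_smul_left (c : ℂ) (x : E) (y : F) : hTmul (c • x) y = c • hTmul x y := by
  rw [hTmul, hTmul, ← TensorProduct.smul_tmul', map_smul]

theorem hTmul_smul_right (c : ℂ) (x : E) (y : F) : hTmul x (c • y) = c • hTmul x y := by
  simp [hTmul]

@[simp] theorem hTmul_zero_left (y : F) : hTmul (0 : E) y = 0 := by
  simp [hTmul]

@[simp] theorem hTmul_zero_right (x : E) : hTmul x (0 : F) = 0 := by
  simp [hTmul]

theorem dense_span_hTmul :
    (Submodule.span ℂ {z : HilbertTensor E F | ∃ x y, z = hTmul x y}).topologicalClosure = ⊤ := by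
  rw [eq_top_iff]
  intro z _
  refine denseRange_tensorIncl.induction_on (p := fun z => z ∈ _) z
    (Submodule.isClosed_topologicalClosure _) fun t => Submodule.le_topologicalClosure _ ?_
  induction t with
  | zero => simp
  | add s t hs ht => rw [map_add]; exact add_mem hs ht
  | tmul x y => exact Submodule.subset_span ⟨x, y, rfl⟩

theorem clm_ext_hTmul {Z : Type*} [NormedAddCommGroup Z] [NormedSpace ℂ Z]
    {S T : HilbertTensor E F →L[ℂ] Z} (h : ∀ x y, S (hTmul x y) = T (hTmul x y)) : S = T := by
  refine ContinuousLinearMap.ext_on (s := {z | ∃ x y, z = hTmul x y}) ?_ ?_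
  · rw [dense_iff_closure_eq, ← Submodule.topologicalClosure_coe, dense_span_hTmul]; simp
  · rintro _ ⟨x, y, rfl⟩; exact h x y

theorem opTensor_comp (a : E →L[ℂ] F) (b : G →L[ℂ] H) (a' : F →L[ℂ] K) (b' : H →L[ℂ] L) :
    (opTensor a' b').comp (opTensor a b) = opTensor (a'.comp a) (b'.comp b) :=
  clm_ext_hTmul fun x y => by simp

theorem opTensor_mul (a a' : E →L[ℂ] E) (b b' : F →L[ℂ] F) :
    opTensor a b * opTensor a' b' = opTensor (a * a') (b * b') :=
  opTensor_comp _ _ _ _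

@[simp] theorem opTensor_one : opTensor (1 : E →L[ℂ] E) (1 : F →L[ℂ] F) = 1 :=
  clm_ext_hTmul fun x y => by simp

theorem opTensor_add_right (a : E →L[ℂ] F) (b b' : G →L[ℂ] H) :
    opTensor a (b + b') = opTensor a b + opTensor a b' :=
  clm_ext_hTmul fun x y => by simp [hTmul_add_right]

theorem opTensor_smul_right (c : ℂ) (a : E →L[ℂ] F) (b : G →L[ℂ] H) :
    opTensor a (c • b) = c • opTensor a b :=
  clm_ext_hTmul fun x y => by simp [hTmul_smul_right]

@[simp] theorem opTensor_zero_left (b : G →L[ℂ] H) : opTensor (0 : E →L[ℂ] F) b = 0 :=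
  clm_ext_hTmul fun x y => by simp

@[simp] theorem opTensor_zero_right (a : E →L[ℂ] F) : opTensor a (0 : G →L[ℂ] H) = 0 :=
  clm_ext_hTmul fun x y => by simp

theorem norm_opTensor_le (a : E →L[ℂ] F) (b : G →L[ℂ] H) : ‖opTensor a b‖ ≤ ‖a‖ * ‖b‖ := by
  refine ContinuousLinearMap.opNorm_le_bound _ (by positivity) fun z => ?_
  refine denseRange_tensorIncl.induction_on
    (p := fun z => ‖opTensor a b z‖ ≤ ‖a‖ * ‖b‖ * ‖z‖) z ?_ fun t => ?_
  · exact isClosed_le (by fun_prop) (by fun_prop)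
  · rw [opTensor_incl, LinearIsometry.norm_map, LinearIsometry.norm_map]
    exact ContinuousLinearMap.le_of_opNorm_le _ (TensorProduct.norm_mapL_le a b) t

/-- `a ⊗ b` as a bounded bilinear map in `a` and `b`. -/
def opTensorL (E F G H : Type*)
    [NormedAddCommGroup E] [InnerProductSpace ℂ E]
    [NormedAddCommGroup F] [InnerProductSpace ℂ F]
    [NormedAddCommGroup G] [InnerProductSpace ℂ G]
    [NormedAddCommGroup H] [InnerProductSpace ℂ H] :
    (E →L[ℂ] F) →L[ℂ] (G →L[ℂ] H) →L[ℂ] (HilbertTensor E G →L[ℂ] HilbertTensor F H) :=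
  LinearMap.mkContinuous₂
    (LinearMap.mk₂ ℂ opTensor opTensor_add_left opTensor_smul_left opTensor_add_right
      opTensor_smul_right) 1 fun a b => by
    simpa using norm_opTensor_le a b

@[simp] theorem opTensorL_apply (a : E →L[ℂ] F) (b : G →L[ℂ] H) :
    opTensorL E F G H a b = opTensor a b := rfl

theorem opTensor_sum_right {ι : Type*} (s : Finset ι) (a : E →L[ℂ] F) (b : ι → (G →L[ℂ] H)) :
    opTensor a (∑ i ∈ s, b i) = ∑ i ∈ s, opTensor a (b i) := by
  exact map_sum (opTensorL E F G H a) b s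

theorem opTensor_sum_left {ι : Type*} (s : Finset ι) (a : ι → (E →L[ℂ] F)) (b : G →L[ℂ] H) :
    opTensor (∑ i ∈ s, a i) b = ∑ i ∈ s, opTensor (a i) b := by
  exact map_sum ((opTensorL E F G H).flip b) a s

section Adjoint

variable [CompleteSpace E] [CompleteSpace F] [CompleteSpace G] [CompleteSpace H]

theorem adjoint_opTensor (a : E →L[ℂ] F) (b : G →L[ℂ] H) :
    ContinuousLinearMap.adjoint (opTensor a b) =
      opTensor (ContinuousLinearMap.adjoint a) (ContinuousLinearMap.adjoint b) := by
  refine (clm_ext_hTmul fun x y => ext_inner_right ℂ fun z => ?_)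
  rw [ContinuousLinearMap.adjoint_inner_left]
  -- With `x ⊗ y` fixed, both sides are bounded linear functionals of `z`, so `z` may be taken to be
  -- an elementary tensor.
  have : (innerSL ℂ (hTmul x y)).comp (opTensor a b) =
      innerSL ℂ (opTensor (ContinuousLinearMap.adjoint a) (ContinuousLinearMap.adjoint b)
        (hTmul x y)) :=
    clm_ext_hTmul fun x' y' => by simp [ContinuousLinearMap.adjoint_inner_left]
  exact DFunLike.congr_fun this z

theorem star_opTensor (a : E →L[ℂ] E) (b : F →L[ℂ] F) :
    star (opTensor a b) = opTensor (star a) (star b) :=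
  adjoint_opTensor a b

end Adjoint

theorem hilbertAssoc_hTmul (x : E) (y : F) (z : H) :
    hilbertAssoc E F H (hTmul x (hTmul y z)) = hTmul (hTmul x y) z := by
  have h := LinearEquiv.extendOfIsometry_eq (TensorProduct.assoc ℂ E F H).symm
    (e₁ := (inclRight : E ⊗[ℂ] (F ⊗[ℂ] H) →ₗᵢ[ℂ] _).toLinearMap)
    (e₂ := (inclLeft : (E ⊗[ℂ] F) ⊗[ℂ] H →ₗᵢ[ℂ] _).toLinearMap)
    denseRange_inclRight denseRange_inclLeft (by
      intro x
      simp only [LinearIsometry.coe_toLinearMap, LinearIsometry.norm_map]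
      exact (TensorProduct.assocIsometry ℂ E F H).symm.norm_map x) (x ⊗ₜ (y ⊗ₜ z))
  exact h

/-- Density of elementary tensors is used twice, in the inner product `F ⊗ H` and then in the outer
one. This is what makes the Poisson transform of `a ⊗ b` computable. -/
theorem hilbertAssoc_comp_opTensor (a : E →L[ℂ] E) (b : F →L[ℂ] F) (c : H →L[ℂ] H)
    (z : HilbertTensor E (HilbertTensor F H)) :
    hilbertAssoc E F H (opTensor a (opTensor b c) z) =
      opTensor (opTensor a b) c (hilbertAssoc E F H z) := by
  have hc : ∀ x : E, ((hilbertAssoc E F H : _ →L[ℂ] _).comp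
      (opTensor a (opTensor b c))).comp (tensorLeft x) =
      ((opTensor (opTensor a b) c).comp (hilbertAssoc E F H : _ →L[ℂ] _)).comp (tensorLeft x) :=
    fun x => clm_ext_hTmul fun y w => by simp [hilbertAssoc_hTmul]
  have : (hilbertAssoc E F H : _ →L[ℂ] _).comp (opTensor a (opTensor b c)) =
      (opTensor (opTensor a b) c).comp (hilbertAssoc E F H : _ →L[ℂ] _) :=
    clm_ext_hTmul fun x y => DFunLike.congr_fun (hc x) y
  exact DFunLike.congr_fun this z

/-! ### Operator matrices and distributing the tensor product over finite direct sums -/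

section Matrices

variable {m : ℕ}

theorem matrixOp_apply (T : Fin m → Fin m → (K →L[ℂ] K)) (ξ : PiLp 2 (fun _ : Fin m => K))
    (i : Fin m) : matrixOp T ξ i = ∑ j, T i j (ξ j) := by
  simp [matrixOp]

/-- The diagonal operator `W ⊕ ⋯ ⊕ W`. -/
def diagOp (m : ℕ) (W : K →L[ℂ] L) :
    PiLp 2 (fun _ : Fin m => K) →L[ℂ] PiLp 2 (fun _ : Fin m => L) :=
  ((PiLp.continuousLinearEquiv 2 ℂ (fun _ : Fin m => L)).symm :
      (Fin m → L) →L[ℂ] PiLp 2 (fun _ : Fin m => L)).comp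
    (ContinuousLinearMap.pi fun i => W.comp (PiLp.proj 2 (fun _ : Fin m => K) i))

theorem diagOp_apply (W : K →L[ℂ] L) (ξ : PiLp 2 (fun _ : Fin m => K)) (i : Fin m) :
    diagOp m W ξ i = W (ξ i) := by
  simp [diagOp]

theorem norm_diagOp_le (W : K →L[ℂ] L) : ‖diagOp m W‖ ≤ ‖W‖ := by
  refine ContinuousLinearMap.opNorm_le_bound _ (norm_nonneg _) fun ξ => ?_
  rw [← pow_le_pow_iff_left₀ (norm_nonneg _) (by positivity) two_ne_zero, mul_pow,
    PiLp.norm_sq_eq_of_L2, PiLp.norm_sq_eq_of_L2, Finset.mul_sum]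
  refine Finset.sum_le_sum fun i _ => ?_
  rw [diagOp_apply, ← mul_pow]
  gcongr
  exact W.le_opNorm _

/-- The matrix factors as `diag(A) T diag(B)`. It will be applied with one fixed pair `A`, `B` for
all entries, as in a Poisson transform or a compression. -/
theorem norm_matrixOp_comp_le (T : Fin m → Fin m → (L →L[ℂ] L)) (A : L →L[ℂ] K) (B : K →L[ℂ] L) :
    ‖matrixOp fun i j => A.comp ((T i j).comp B)‖ ≤ ‖A‖ * ‖matrixOp T‖ * ‖B‖ := by
  have h : matrixOp (fun i j => A.comp ((T i j).comp B)) =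
      (diagOp m A).comp ((matrixOp T).comp (diagOp m B)) := by
    ext ξ i
    simp [matrixOp_apply, diagOp_apply, map_sum]
  rw [h, mul_assoc]
  refine (ContinuousLinearMap.opNorm_comp_le _ _).trans ?_
  refine mul_le_mul (norm_diagOp_le A) ?_ (norm_nonneg _) (norm_nonneg _)
  refine (ContinuousLinearMap.opNorm_comp_le _ _).trans ?_
  exact mul_le_mul_of_nonneg_left (norm_diagOp_le B) (norm_nonneg _)

variable (K m) in
/-- The inclusion of the `j`-th summand in `K^{(m)}`. -/
def coordIncl (j : Fin m) : K →L[ℂ] PiLp 2 (fun _ : Fin m => K) :=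
  ((PiLp.continuousLinearEquiv 2 ℂ (fun _ : Fin m => K)).symm :
      (Fin m → K) →L[ℂ] PiLp 2 (fun _ : Fin m => K)).comp
    (ContinuousLinearMap.single ℂ (fun _ : Fin m => K) j)

variable (H K m) in
/-- The map `K^{(m)} ⊗ H → (K ⊗ H)^{(m)}` that distributes the tensor product over the sum. -/
def tensorDistrib : HilbertTensor (PiLp 2 (fun _ : Fin m => K)) H →L[ℂ]
    PiLp 2 (fun _ : Fin m => HilbertTensor K H) :=
  ((PiLp.continuousLinearEquiv 2 ℂ (fun _ : Fin m => HilbertTensor K H)).symm :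
      (Fin m → HilbertTensor K H) →L[ℂ] PiLp 2 (fun _ : Fin m => HilbertTensor K H)).comp
    (ContinuousLinearMap.pi fun i => opTensor (PiLp.proj 2 (fun _ : Fin m => K) i) 1)

variable (H K m) in
/-- The inverse `(K ⊗ H)^{(m)} → K^{(m)} ⊗ H` of `tensorDistrib`. -/
def tensorCollect : PiLp 2 (fun _ : Fin m => HilbertTensor K H) →L[ℂ]
    HilbertTensor (PiLp 2 (fun _ : Fin m => K)) H :=
  ∑ j, (opTensor (coordIncl K m j) 1).comp (PiLp.proj 2 (fun _ : Fin m => HilbertTensor K H) j)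

theorem proj_comp_coordIncl (i j : Fin m) :
    (PiLp.proj 2 (fun _ : Fin m => K) i : _ →L[ℂ] K).comp (coordIncl K m j) =
      if i = j then 1 else 0 := by
  ext x
  by_cases h : i = j
  · subst h; simp [coordIncl]
  · simp [coordIncl, h]

theorem tensorDistrib_apply (z : HilbertTensor (PiLp 2 (fun _ : Fin m => K)) H) (i : Fin m) :
    tensorDistrib H K m z i = opTensor (PiLp.proj 2 (fun _ : Fin m => K) i) 1 z := by
  simp [tensorDistrib]

theorem tensorCollect_comp_tensorDistrib :
    (tensorCollect H K m).comp (tensorDistrib H K m) = 1 := by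
  have h : ∑ j, (coordIncl K m j).comp (PiLp.proj 2 (fun _ : Fin m => K) j : _ →L[ℂ] K) = 1 := by
    ext ξ i
    simp [coordIncl, Pi.single_apply]
  refine ContinuousLinearMap.ext fun z => ?_
  have h2 := congrArg (fun T => opTensor T (1 : H →L[ℂ] H) z) h
  simp only [opTensor_sum_left] at h2
  rw [opTensor_one] at h2
  simp only [tensorCollect, ContinuousLinearMap.comp_apply, sum_apply] at h2 ⊢
  rw [← h2]
  refine Finset.sum_congr rfl fun j _ => ?_
  rw [PiLp.proj_apply, tensorDistrib_apply, ← ContinuousLinearMap.comp_apply, opTensor_comp]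
  rfl

variable [CompleteSpace K] [CompleteSpace H]

theorem adjoint_coordIncl (j : Fin m) : ContinuousLinearMap.adjoint (coordIncl K m j) =
    (PiLp.proj 2 (fun _ : Fin m => K) j : _ →L[ℂ] K) := by
  refine ContinuousLinearMap.ext fun ξ => ext_inner_right ℂ fun x => ?_
  rw [ContinuousLinearMap.adjoint_inner_left, PiLp.inner_apply,
    Finset.sum_eq_single j]
  · simp [coordIncl]
  · intro i _ h; simp [coordIncl, h]
  · simp

/-- The amplified coordinate inclusions are isometries with pairwise orthogonal ranges, which makes
`tensorCollect` isometric. -/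
theorem inner_opTensor_coordIncl (i j : Fin m) (x y : HilbertTensor K H) :
    inner ℂ (opTensor (coordIncl K m i) (1 : H →L[ℂ] H) x)
      (opTensor (coordIncl K m j) (1 : H →L[ℂ] H) y) =
      if i = j then inner ℂ x y else 0 := by
  rw [← ContinuousLinearMap.adjoint_inner_right, adjoint_opTensor, adjoint_coordIncl,
    ← ContinuousLinearMap.comp_apply, opTensor_comp, proj_comp_coordIncl]
  have h1 : ContinuousLinearMap.adjoint (1 : H →L[ℂ] H) ∘L (1 : H →L[ℂ] H) = 1 := by
    rw [← ContinuousLinearMap.star_eq_adjoint, star_one]; rfl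
  rw [h1]
  split_ifs <;> simp

theorem norm_tensorCollect (ξ : PiLp 2 (fun _ : Fin m => HilbertTensor K H)) :
    ‖tensorCollect H K m ξ‖ = ‖ξ‖ := by
  rw [← pow_left_inj₀ (norm_nonneg _) (norm_nonneg _) two_ne_zero]
  have h : inner ℂ (tensorCollect H K m ξ) (tensorCollect H K m ξ) = inner ℂ ξ ξ := by
    simp only [tensorCollect, sum_apply, ContinuousLinearMap.comp_apply, PiLp.proj_apply,
      sum_inner, inner_sum, inner_opTensor_coordIncl, PiLp.inner_apply]
    simp
  rw [inner_self_eq_norm_sq_to_K, inner_self_eq_norm_sq_to_K] at h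
  exact_mod_cast h

/-- It has the isometry `tensorCollect` as a left inverse. -/
theorem norm_tensorDistrib (z : HilbertTensor (PiLp 2 (fun _ : Fin m => K)) H) :
    ‖tensorDistrib H K m z‖ = ‖z‖ := by
  rw [← norm_tensorCollect, ← ContinuousLinearMap.comp_apply, tensorCollect_comp_tensorDistrib,
    one_apply_eq_self]

/-- Up to the isometries that exchange `K^{(m)} ⊗ H` and `(K ⊗ H)^{(m)}`, the matrix of the `T i j ⊗
1` is the single operator `matrixOp T ⊗ 1`. This gives complete contractivity of amplification. -/
theorem norm_matrixOp_opTensor_one_le (T : Fin m → Fin m → (K →L[ℂ] K)) :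
    ‖matrixOp fun i j => opTensor (T i j) (1 : H →L[ℂ] H)‖ ≤ ‖matrixOp T‖ := by
  have h : matrixOp (fun i j => opTensor (T i j) (1 : H →L[ℂ] H)) =
      (tensorDistrib H K m).comp ((opTensor (matrixOp T) 1).comp (tensorCollect H K m)) := by
    have hT : ∀ i j, (PiLp.proj 2 (fun _ : Fin m => K) i : _ →L[ℂ] K).comp
        ((matrixOp T).comp (coordIncl K m j)) = T i j := by
      intro i j
      ext x
      simp only [ContinuousLinearMap.comp_apply, PiLp.proj_apply, matrixOp_apply]
      rw [Finset.sum_eq_single j]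
      · simp [coordIncl]
      · intro k _ hk; simp [coordIncl, hk]
      · simp
    refine ContinuousLinearMap.ext fun ξ => PiLp.ext fun i => ?_
    rw [matrixOp_apply, ContinuousLinearMap.comp_apply, tensorDistrib_apply]
    simp only [ContinuousLinearMap.comp_apply, tensorCollect, sum_apply, map_sum]
    refine Finset.sum_congr rfl fun j _ => ?_
    rw [← hT i j]
    simp only [PiLp.proj_apply]
    rw [← ContinuousLinearMap.comp_apply (opTensor _ _) (opTensor _ _), opTensor_comp,
      ← ContinuousLinearMap.comp_apply (opTensor _ _) (opTensor _ _), opTensor_comp]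
    rfl
  rw [h]
  refine ContinuousLinearMap.opNorm_le_bound _ (norm_nonneg _) fun ξ => ?_
  rw [ContinuousLinearMap.comp_apply, norm_tensorDistrib, ContinuousLinearMap.comp_apply,
    ← norm_tensorCollect ξ]
  refine ContinuousLinearMap.le_of_opNorm_le _ ((norm_opTensor_le _ _).trans ?_) _
  exact mul_le_of_le_one_right (norm_nonneg _) ContinuousLinearMap.norm_id_le

end Matrices

end TensorOperators

/-! ### The Fock space -/

section FockSpace

variable {n : ℕ}

@[simp] theorem leftCreation_fockBasis (i : Fin n) (α : FreeMonoid (Fin n)) :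
    leftCreation i (fockBasis α) = fockBasis (FreeMonoid.of i * α) :=
  basisShift_fockBasis _ (mul_right_injective _) α

@[simp] theorem rightCreation_fockBasis (i : Fin n) (α : FreeMonoid (Fin n)) :
    rightCreation i (fockBasis α) = fockBasis (α * FreeMonoid.of i) :=
  basisShift_fockBasis _ (mul_left_injective _) α

theorem inner_fockBasis_left (α : FreeMonoid (Fin n)) (x : Fock n) :
    inner ℂ (fockBasis α) x = x α := by
  classical
  simp [fockBasis, lp.inner_single_left]

open scoped Classical in
theorem inner_fockBasis (α β : FreeMonoid (Fin n)) :
    inner ℂ (fockBasis α : Fock n) (fockBasis β) = if α = β then 1 else 0 :=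
  orthonormal_iff_ite.1 (fockBasis_orthonormal n) α β

theorem hasSum_fockBasis (x : Fock n) : HasSum (fun α => x α • (fockBasis α : Fock n)) x := by
  classical
  have h := lp.hasSum_single (p := 2) (by simp) x
  convert h using 2 with α
  rw [fockBasis, ← lp.single_smul, smul_eq_mul, mul_one]

theorem dense_span_fockBasis :
    Dense (Submodule.span ℂ (Set.range (fockBasis : FreeMonoid (Fin n) → Fock n)) : Set (Fock n)) := by
  intro x
  rw [← Submodule.topologicalClosure_coe]
  refine (Submodule.isClosed_topologicalClosure _).mem_of_tendsto (hasSum_fockBasis x)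
    (Eventually.of_forall fun s => Submodule.sum_mem _ fun α _ => Submodule.smul_mem _ _
      (Submodule.le_topologicalClosure _ (Submodule.subset_span ⟨α, rfl⟩)))

theorem fock_clm_ext {Z : Type*} [NormedAddCommGroup Z] [NormedSpace ℂ Z]
    {S T : Fock n →L[ℂ] Z} (h : ∀ α, S (fockBasis α) = T (fockBasis α)) : S = T := by
  refine ContinuousLinearMap.ext_on dense_span_fockBasis ?_
  rintro _ ⟨α, rfl⟩
  exact h α

theorem fock_ext_inner {x y : Fock n}
    (h : ∀ α, inner ℂ (fockBasis α) x = inner ℂ (fockBasis α) y) : x = y := by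
  ext α
  simpa [inner_fockBasis_left] using h α

theorem of_mul_ne_one {A : Type*} (i : A) (α : FreeMonoid A) : FreeMonoid.of i * α ≠ 1 := by
  intro h
  have := congrArg FreeMonoid.length h
  simp at this

theorem mul_of_ne_one {A : Type*} (i : A) (α : FreeMonoid A) : α * FreeMonoid.of i ≠ 1 := by
  intro h
  have := congrArg FreeMonoid.length h
  simp at this

@[simp] theorem star_leftCreation_vacuum (i : Fin n) :
    star (leftCreation i) (fockBasis (1 : FreeMonoid (Fin n))) = 0 := by
  classical
  refine fock_ext_inner fun α => ?_
  rw [ContinuousLinearMap.star_eq_adjoint, ContinuousLinearMap.adjoint_inner_right,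
    leftCreation_fockBasis, inner_fockBasis, if_neg (of_mul_ne_one i α), inner_zero_right]

@[simp] theorem star_rightCreation_vacuum (i : Fin n) :
    star (rightCreation i) (fockBasis (1 : FreeMonoid (Fin n))) = 0 := by
  classical
  refine fock_ext_inner fun α => ?_
  rw [ContinuousLinearMap.star_eq_adjoint, ContinuousLinearMap.adjoint_inner_right,
    rightCreation_fockBasis, inner_fockBasis, if_neg (mul_of_ne_one i α), inner_zero_right]

theorem star_leftCreation_of_mul (i j : Fin n) (α : FreeMonoid (Fin n)) :
    star (leftCreation i) (fockBasis (FreeMonoid.of j * α)) =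
      if i = j then fockBasis α else 0 := by
  rw [← leftCreation_fockBasis, ← mul_apply_eq_comp, leftCreation_star_mul]
  split_ifs <;> simp

/-- Words with different last letters are different, and the last letter can be cancelled; so the
`R_i` are isometries with orthogonal ranges. -/
theorem star_rightCreation_mul (i j : Fin n) :
    star (rightCreation i) * rightCreation j = if i = j then (1 : Fock n →L[ℂ] Fock n) else 0 := by
  classical
  refine fock_clm_ext fun β => fock_ext_inner fun α => ?_
  rw [mul_apply_eq_comp, ContinuousLinearMap.star_eq_adjoint,
    ContinuousLinearMap.adjoint_inner_right, rightCreation_fockBasis, rightCreation_fockBasis,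
    inner_fockBasis]
  have h : α * FreeMonoid.of i = β * FreeMonoid.of j ↔ i = j ∧ α = β := by
    constructor
    · intro h
      have h1 : α.toList ++ [i] = β.toList ++ [j] := congrArg FreeMonoid.toList h
      rw [← List.concat_eq_append, ← List.concat_eq_append, List.concat_inj] at h1
      exact ⟨h1.2, FreeMonoid.toList.injective h1.1⟩
    · rintro ⟨rfl, rfl⟩; rfl
  by_cases hij : i = j <;> simp [h, hij, inner_fockBasis]

theorem inner_fockBasis_self (α : FreeMonoid (Fin n)) :
    inner ℂ (fockBasis α : Fock n) (fockBasis α) = 1 := by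
  rw [inner_fockBasis, if_pos rfl]

/-- The orthogonal projection of the Fock space onto the vacuum. -/
def vacuumProj (n : ℕ) : Fock n →L[ℂ] Fock n :=
  (innerSL ℂ (fockBasis (1 : FreeMonoid (Fin n)))).smulRight (fockBasis 1)

theorem vacuumProj_apply (x : Fock n) :
    vacuumProj n x = inner ℂ (fockBasis (1 : FreeMonoid (Fin n))) x • fockBasis 1 := rfl

/-- Removing the first letter commutes with appending a last one, except on the empty word, where
the appended letter is itself the first. The vacuum projection records this defect, and it is the
source of the intertwining relation of the Poisson kernel. -/
theorem star_leftCreation_mul_rightCreation (i j : Fin n) :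
    star (leftCreation i) * rightCreation j =
      rightCreation j * star (leftCreation i) + if i = j then vacuumProj n else 0 := by
  classical
  refine fock_clm_ext fun β => ?_
  cases β using FreeMonoid.casesOn with
  | one =>
    have h := star_leftCreation_of_mul i j 1
    rw [mul_one] at h
    simp only [mul_apply_eq_comp, rightCreation_fockBasis, one_mul, h, add_apply,
      star_leftCreation_vacuum, map_zero, zero_add]
    split_ifs <;> simp only [vacuumProj_apply, inner_fockBasis_self, one_smul, zero_apply]
  | of_mul k β =>
    simp only [mul_apply_eq_comp, rightCreation_fockBasis, mul_assoc, add_apply,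
      star_leftCreation_of_mul]
    have hv : vacuumProj n (fockBasis (FreeMonoid.of k * β)) = 0 := by
      simp [vacuumProj_apply, inner_fockBasis, (of_mul_ne_one k β).symm]
    split_ifs <;> simp [hv]

end FockSpace

/-! ### The Poisson kernel -/

section PoissonKernel

variable {n : ℕ} {E H : Type*}
  [NormedAddCommGroup E] [InnerProductSpace ℂ E] [CompleteSpace E]
  [NormedAddCommGroup H] [InnerProductSpace ℂ H] [CompleteSpace H]

theorem norm_sum_lt_one {X : Fin n → (H →L[ℂ] H)} (hX : X ∈ ncBall n H) :
    ‖∑ i, X i * star (X i)‖ < 1 := by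
  have h : Real.sqrt _ < 1 := hX
  rwa [Real.sqrt_lt' one_pos, one_pow] at h

/-- The operator `∑ R_i ⊗ X_i^*`. -/
def reconstruction (X : Fin n → (H →L[ℂ] H)) :
    HilbertTensor (Fock n) H →L[ℂ] HilbertTensor (Fock n) H :=
  ∑ i, opTensor (rightCreation i) (star (X i))

/-- Orthogonality of the ranges of the `R_i` removes the cross terms. The identity serves twice: it
makes `I - ∑ R_i ⊗ X_i^*` invertible, and it cancels against `Δ_X²`. -/
theorem star_reconstruction_mul_self (X : Fin n → (H →L[ℂ] H)) :
    star (reconstruction X) * reconstruction X =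
      opTensor (1 : Fock n →L[ℂ] Fock n) (∑ i, X i * star (X i)) := by
  simp only [reconstruction, star_sum, Finset.sum_mul_sum, star_opTensor, star_star, opTensor_mul,
    star_rightCreation_mul, opTensor_sum_right]
  refine Finset.sum_congr rfl fun i _ => ?_
  rw [Finset.sum_eq_single i]
  · simp
  · intro j _ h; simp [h.symm]
  · simp

theorem norm_reconstruction_lt_one {X : Fin n → (H →L[ℂ] H)} (hX : X ∈ ncBall n H) :
    ‖reconstruction X‖ < 1 := by
  have h : ‖star (reconstruction X) * reconstruction X‖ = _ := CStarRing.norm_star_mul_self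
  rw [star_reconstruction_mul_self] at h
  have h1 : ‖opTensor (1 : Fock n →L[ℂ] Fock n) (∑ i, X i * star (X i))‖ < 1 := by
    refine lt_of_le_of_lt ((norm_opTensor_le _ _).trans ?_) (norm_sum_lt_one hX)
    exact mul_le_of_le_one_left (norm_nonneg _) ContinuousLinearMap.norm_id_le
  nlinarith [norm_nonneg (reconstruction X)]

/-- The inverse of `I - ∑ R_i ⊗ X_i^*`. -/
def resolvent (X : Fin n → (H →L[ℂ] H)) :
    HilbertTensor (Fock n) H →L[ℂ] HilbertTensor (Fock n) H :=
  Ring.inverse (1 - reconstruction X)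

theorem isUnit_one_sub_reconstruction {X : Fin n → (H →L[ℂ] H)} (hX : X ∈ ncBall n H) :
    IsUnit (1 - reconstruction X) :=
  isUnit_one_sub_of_norm_lt_one (norm_reconstruction_lt_one hX)

theorem resolvent_apply_eq {X : Fin n → (H →L[ℂ] H)} (hX : X ∈ ncBall n H)
    (z : HilbertTensor (Fock n) H) :
    resolvent X z = z + reconstruction X (resolvent X z) := by
  have h := DFunLike.congr_fun
    (Ring.mul_inverse_cancel _ (isUnit_one_sub_reconstruction hX)) z
  simp only [mul_apply_eq_comp, sub_apply, one_apply_eq_self] at h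
  exact sub_eq_iff_eq_add.1 h

/-- The resolvent is used only through its fixed point equation, so that no Neumann series has to be
manipulated. -/
theorem eq_resolvent_apply {X : Fin n → (H →L[ℂ] H)} (hX : X ∈ ncBall n H)
    {y z : HilbertTensor (Fock n) H} (h : y = z + reconstruction X y) :
    y = resolvent X z := by
  have h2 := DFunLike.congr_fun
    (Ring.inverse_mul_cancel _ (isUnit_one_sub_reconstruction hX)) y
  simp only [mul_apply_eq_comp, sub_apply, one_apply_eq_self] at h2
  rw [← h2, sub_eq_iff_eq_add.2 h]
  rfl

theorem resolvent_apply_eq_add_resolvent {X : Fin n → (H →L[ℂ] H)} (hX : X ∈ ncBall n H)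
    (z : HilbertTensor (Fock n) H) :
    resolvent X z = z + resolvent X (reconstruction X z) := by
  refine (eq_resolvent_apply hX ?_).symm
  rw [map_add, ← resolvent_apply_eq hX]

theorem ncPoissonKernel_apply (X : Fin n → (H →L[ℂ] H)) (h : H) :
    ncPoissonKernel X h =
      opTensor 1 (ncDefect X) (resolvent X (hTmul (fockBasis 1) h)) := rfl

theorem adjoint_tensorLeft_apply_hTmul (x x' : Fock n) (h : H) :
    ContinuousLinearMap.adjoint (tensorLeft x : H →L[ℂ] HilbertTensor (Fock n) H) (hTmul x' h) =
      inner ℂ x x' • h := by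
  refine ext_inner_left ℂ fun z => ?_
  rw [ContinuousLinearMap.adjoint_inner_right, tensorLeft_apply, inner_hTmul, inner_smul_right]

/-- Every basis vector in the range of `R_i` has positive length, so this range is orthogonal to the
vacuum. -/
theorem adjoint_tensorLeft_vacuum_reconstruction (X : Fin n → (H →L[ℂ] H))
    (z : HilbertTensor (Fock n) H) :
    ContinuousLinearMap.adjoint
      (tensorLeft (fockBasis 1) : H →L[ℂ] HilbertTensor (Fock n) H) (reconstruction X z) = 0 := by
  have : (ContinuousLinearMap.adjoint
      (tensorLeft (fockBasis 1) : H →L[ℂ] HilbertTensor (Fock n) H)).comp (reconstruction X) = 0 := by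
    refine clm_ext_hTmul fun x y => ?_
    simp only [reconstruction, ContinuousLinearMap.comp_apply, sum_apply, map_sum, opTensor_hTmul,
      adjoint_tensorLeft_apply_hTmul, zero_apply]
    refine Finset.sum_eq_zero fun i _ => ?_
    rw [← ContinuousLinearMap.adjoint_inner_left, ← ContinuousLinearMap.star_eq_adjoint,
      star_rightCreation_vacuum, inner_zero_left, zero_smul]
  exact DFunLike.congr_fun this z

theorem ncDefect_mul_self {X : Fin n → (H →L[ℂ] H)} (hX : X ∈ ncBall n H) :
    star (ncDefect X) * ncDefect X = 1 - ∑ i, X i * star (X i) := by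
  have h0 : 0 ≤ 1 - ∑ i, X i * star (X i) := by
    rw [sub_nonneg]
    have hp : 0 ≤ ∑ i, X i * star (X i) := Finset.sum_nonneg fun i _ => mul_star_self_nonneg _
    exact (CStarAlgebra.norm_le_one_iff_of_nonneg _ hp).1 (norm_sum_lt_one hX).le
  have hs : star (ncDefect X) = ncDefect X :=
    (IsSelfAdjoint.of_nonneg (CFC.sqrt_nonneg _)).star_eq
  rw [hs]
  exact CFC.sqrt_mul_sqrt_self _ h0

/-- Let `y` be the resolvent at `1 ⊗ h` and `R = ∑ R_i ⊗ X_i^*`. Then `y = 1 ⊗ h + R y` is an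
orthogonal decomposition, so `‖y‖² = ‖h‖² + ‖R y‖²`, while `Δ_X² = I - ∑ X_i X_i^*` gives `‖K_X h‖²
= ‖y‖² - ‖R y‖²`. -/
theorem norm_ncPoissonKernel_apply {X : Fin n → (H →L[ℂ] H)} (hX : X ∈ ncBall n H) (h : H) :
    ‖ncPoissonKernel X h‖ = ‖h‖ := by
  set y := resolvent X (hTmul (fockBasis 1) h) with hy
  have hy1 : y = hTmul (fockBasis 1) h + reconstruction X y := resolvent_apply_eq hX _
  have h0 : inner ℂ (hTmul (fockBasis 1) h) (reconstruction X y) = 0 := by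
    rw [← tensorLeft_apply, ← ContinuousLinearMap.adjoint_inner_right,
      adjoint_tensorLeft_vacuum_reconstruction, inner_zero_right]
  have h0' : inner ℂ (reconstruction X y) (hTmul (fockBasis 1) h) = 0 :=
    inner_eq_zero_symm.1 h0
  have hK : inner ℂ (ncPoissonKernel X h) (ncPoissonKernel X h) =
      inner ℂ y y - inner ℂ (reconstruction X y) (reconstruction X y) := by
    rw [ncPoissonKernel_apply, ← hy]
    clear_value y
    rw [← ContinuousLinearMap.adjoint_inner_right,
      ← ContinuousLinearMap.star_eq_adjoint, ← mul_apply_eq_comp, star_opTensor,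
      opTensor_mul, ncDefect_mul_self hX, star_one, mul_one,
      ← ContinuousLinearMap.adjoint_inner_right (reconstruction X),
      ← ContinuousLinearMap.star_eq_adjoint, ← mul_apply_eq_comp, star_reconstruction_mul_self,
      ← inner_sub_right]
    congr 1
    rw [sub_eq_add_neg, opTensor_add_right, opTensor_one, ← neg_one_smul ℂ (∑ i, _),
      opTensor_smul_right]
    simp [sub_eq_add_neg]
  have hyy : inner ℂ y y = inner ℂ h h + inner ℂ (reconstruction X y) (reconstruction X y) := by
    conv_lhs => rw [hy1]
    simp only [inner_add_left, inner_add_right, h0, h0', inner_hTmul, inner_fockBasis_self]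
    ring
  rw [hyy, add_sub_cancel_right, inner_self_eq_norm_sq_to_K, inner_self_eq_norm_sq_to_K] at hK
  rw [← pow_left_inj₀ (norm_nonneg _) (norm_nonneg _) two_ne_zero]
  exact_mod_cast hK

theorem adjoint_ncPoissonKernel_comp_self {X : Fin n → (H →L[ℂ] H)} (hX : X ∈ ncBall n H) :
    (ContinuousLinearMap.adjoint (ncPoissonKernel X)).comp (ncPoissonKernel X) = 1 :=
  (ContinuousLinearMap.norm_map_iff_adjoint_comp_self _).1 (norm_ncPoissonKernel_apply hX)

theorem opTensor_vacuumProj (b : H →L[ℂ] H) (z : HilbertTensor (Fock n) H) :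
    opTensor (vacuumProj n) b z = hTmul (fockBasis 1)
      (b (ContinuousLinearMap.adjoint (tensorLeft (fockBasis 1)) z)) := by
  have : opTensor (vacuumProj n) b = (tensorLeft (fockBasis 1)).comp
      (b.comp (ContinuousLinearMap.adjoint (tensorLeft (fockBasis (1 : FreeMonoid (Fin n)))))) :=
    clm_ext_hTmul fun x y => by
      simp [adjoint_tensorLeft_apply_hTmul, vacuumProj_apply, hTmul_smul_left]
  exact DFunLike.congr_fun this z

theorem star_leftCreation_reconstruction (X : Fin n → (H →L[ℂ] H)) (i : Fin n) :
    opTensor (star (leftCreation i)) 1 * reconstruction X =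
      reconstruction X * opTensor (star (leftCreation i)) 1 +
        opTensor (vacuumProj n) (star (X i)) := by
  simp only [reconstruction, Finset.mul_sum, Finset.sum_mul, opTensor_mul,
    star_leftCreation_mul_rightCreation, opTensor_add_left, Finset.sum_add_distrib, one_mul,
    mul_one]
  congr 1
  rw [Finset.sum_eq_single i]
  · simp
  · intro j _ h; simp [h.symm]
  · simp

/-- Applying `S_i^* ⊗ I` to `y = 1 ⊗ h + R y` kills `1 ⊗ h`, and the commutation defect contributes
`1 ⊗ X_i^* h`. The result is the fixed point equation of the resolvent at `1 ⊗ X_i^* h`. -/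
theorem star_leftCreation_ncPoissonKernel {X : Fin n → (H →L[ℂ] H)} (hX : X ∈ ncBall n H)
    (i : Fin n) :
    (opTensor (star (leftCreation i)) 1).comp (ncPoissonKernel X) =
      (ncPoissonKernel X).comp (star (X i)) := by
  refine ContinuousLinearMap.ext fun h => ?_
  set y := resolvent X (hTmul (fockBasis 1) h) with hy
  have hy1 : y = hTmul (fockBasis 1) h + reconstruction X y := resolvent_apply_eq hX _
  -- The vacuum component of `y` is `h`; this is the vector on which the defect term acts.
  have hT : ContinuousLinearMap.adjoint
      (tensorLeft (fockBasis 1) : H →L[ℂ] HilbertTensor (Fock n) H) y = h := by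
    rw [hy1, map_add, adjoint_tensorLeft_vacuum_reconstruction, adjoint_tensorLeft_apply_hTmul,
      inner_fockBasis_self, one_smul, add_zero]
  have h1 : opTensor (star (leftCreation i)) 1 y =
      resolvent X (hTmul (fockBasis 1) (star (X i) h)) := by
    refine eq_resolvent_apply hX ?_
    conv_lhs => rw [hy1, map_add, opTensor_hTmul, star_leftCreation_vacuum, hTmul_zero_left,
      zero_add, ← mul_apply_eq_comp, star_leftCreation_reconstruction]
    rw [add_apply, opTensor_vacuumProj, hT, mul_apply_eq_comp, add_comm]
  rw [ContinuousLinearMap.comp_apply, ContinuousLinearMap.comp_apply, ncPoissonKernel_apply,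
    ncPoissonKernel_apply, ← h1, ← hy]
  clear_value y
  rw [← ContinuousLinearMap.comp_apply, opTensor_comp,
    ← ContinuousLinearMap.comp_apply, opTensor_comp]
  rfl

theorem adjoint_ncPoissonKernel_leftCreation {X : Fin n → (H →L[ℂ] H)} (hX : X ∈ ncBall n H)
    (i : Fin n) :
    (ContinuousLinearMap.adjoint (ncPoissonKernel X)).comp (opTensor (leftCreation i) 1) =
      (X i).comp (ContinuousLinearMap.adjoint (ncPoissonKernel X)) := by
  have h := congrArg ContinuousLinearMap.adjoint (star_leftCreation_ncPoissonKernel hX i)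
  rw [ContinuousLinearMap.adjoint_comp, ContinuousLinearMap.adjoint_comp,
    ← ContinuousLinearMap.star_eq_adjoint (opTensor _ _), star_opTensor, star_star, star_one,
    ← ContinuousLinearMap.star_eq_adjoint (star (X i)), star_star] at h
  exact h

/-- Each letter passes through `K_X^*` by the intertwining relation, and `K_X^* K_X = I` settles the
empty word. -/
theorem adjoint_ncPoissonKernel_lift_leftCreation {X : Fin n → (H →L[ℂ] H)}
    (hX : X ∈ ncBall n H) (α : FreeMonoid (Fin n)) :
    (ContinuousLinearMap.adjoint (ncPoissonKernel X)).comp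
      ((opTensor (FreeMonoid.lift leftCreation α) 1).comp (ncPoissonKernel X)) =
      FreeMonoid.lift X α := by
  induction α using FreeMonoid.inductionOn' with
  | one =>
    rw [map_one, map_one, opTensor_one]
    exact adjoint_ncPoissonKernel_comp_self hX
  | of_mul i α ih =>
    have h1 : opTensor (leftCreation i * FreeMonoid.lift leftCreation α) (1 : H →L[ℂ] H) =
        (opTensor (leftCreation i) (1 : H →L[ℂ] H)).comp
          (opTensor (FreeMonoid.lift leftCreation α) (1 : H →L[ℂ] H)) := by
      rw [opTensor_comp]; rfl
    rw [map_mul, map_mul, FreeMonoid.lift_eval_of, FreeMonoid.lift_eval_of, h1,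
      ContinuousLinearMap.comp_assoc, ← ContinuousLinearMap.comp_assoc,
      adjoint_ncPoissonKernel_leftCreation hX, ContinuousLinearMap.comp_assoc, ih]
    rfl

theorem norm_ampliatedKernel_le {X : Fin n → (H →L[ℂ] H)} (hX : X ∈ ncBall n H) :
    ‖ampliatedKernel E X‖ ≤ 1 := by
  refine ContinuousLinearMap.opNorm_le_bound _ zero_le_one fun z => ?_
  change ‖hilbertAssoc E (Fock n) H (opTensor (1 : E →L[ℂ] E) (ncPoissonKernel X) z)‖ ≤ _
  rw [LinearIsometryEquiv.norm_map]
  refine ContinuousLinearMap.le_of_opNorm_le _ ((norm_opTensor_le _ _).trans ?_) _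
  refine mul_le_one₀ ContinuousLinearMap.norm_id_le (norm_nonneg _) ?_
  exact ContinuousLinearMap.opNorm_le_bound _ zero_le_one fun h => by
    rw [norm_ncPoissonKernel_apply hX, one_mul]

theorem adjoint_ampliatedKernel (X : Fin n → (H →L[ℂ] H)) :
    ContinuousLinearMap.adjoint (ampliatedKernel E X) =
      (opTensor (1 : E →L[ℂ] E) (ContinuousLinearMap.adjoint (ncPoissonKernel X))).comp
        ((hilbertAssoc E (Fock n) H).symm : _ →L[ℂ] _) := by
  rw [ampliatedKernel, ContinuousLinearMap.adjoint_comp, adjoint_opTensor,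
    LinearIsometryEquiv.adjoint_eq_symm, ← ContinuousLinearMap.star_eq_adjoint (1 : E →L[ℂ] E),
    star_one]

theorem poissonTransform_opTensor (X : Fin n → (H →L[ℂ] H)) (a : E →L[ℂ] E)
    (b : Fock n →L[ℂ] Fock n) :
    poissonTransform X (opTensor a b) = opTensor a
      ((ContinuousLinearMap.adjoint (ncPoissonKernel X)).comp
        ((opTensor b 1).comp (ncPoissonKernel X))) := by
  refine clm_ext_hTmul fun x y => ?_
  rw [poissonTransform, adjoint_ampliatedKernel]
  have h := hilbertAssoc_comp_opTensor a b (1 : H →L[ℂ] H) (hTmul x (ncPoissonKernel X y))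
  simp only [ContinuousLinearMap.comp_apply, ampliatedKernel, opTensor_hTmul,
    ContinuousLinearEquiv.coe_coe, LinearIsometryEquiv.coe_coe, one_apply_eq_self] at h ⊢
  rw [← h]
  simp

theorem poissonTransform_opTensor_lift {X : Fin n → (H →L[ℂ] H)} (hX : X ∈ ncBall n H)
    (a : E →L[ℂ] E) (α : FreeMonoid (Fin n)) :
    poissonTransform X (opTensor a (FreeMonoid.lift leftCreation α)) =
      opTensor a (FreeMonoid.lift X α) := by
  rw [poissonTransform_opTensor, adjoint_ncPoissonKernel_lift_leftCreation hX]

theorem poissonTransform_add (X : Fin n → (H →L[ℂ] H))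
    (f g : HilbertTensor E (Fock n) →L[ℂ] HilbertTensor E (Fock n)) :
    poissonTransform X (f + g) = poissonTransform X f + poissonTransform X g := by
  simp [poissonTransform, opTensor_add_left]

theorem poissonTransform_smul (X : Fin n → (H →L[ℂ] H)) (c : ℂ)
    (f : HilbertTensor E (Fock n) →L[ℂ] HilbertTensor E (Fock n)) :
    poissonTransform X (c • f) = c • poissonTransform X f := by
  simp [poissonTransform, opTensor_smul_left]

theorem poissonTransform_star (X : Fin n → (H →L[ℂ] H))
    (f : HilbertTensor E (Fock n) →L[ℂ] HilbertTensor E (Fock n)) :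
    poissonTransform X (star f) = star (poissonTransform X f) := by
  rw [poissonTransform, poissonTransform, ContinuousLinearMap.star_eq_adjoint (_ ∘L _),
    ContinuousLinearMap.adjoint_comp, ContinuousLinearMap.adjoint_comp,
    ContinuousLinearMap.adjoint_adjoint, ← ContinuousLinearMap.star_eq_adjoint (opTensor _ _),
    star_opTensor, star_one, ContinuousLinearMap.comp_assoc]

theorem norm_poissonTransform_le {X : Fin n → (H →L[ℂ] H)} (hX : X ∈ ncBall n H)
    (f : HilbertTensor E (Fock n) →L[ℂ] HilbertTensor E (Fock n)) :
    ‖poissonTransform X f‖ ≤ ‖f‖ := by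
  have hW := norm_ampliatedKernel_le (E := E) hX
  have hf : ‖opTensor f (1 : H →L[ℂ] H)‖ ≤ ‖f‖ := (norm_opTensor_le _ _).trans
    (mul_le_of_le_one_right (norm_nonneg _) ContinuousLinearMap.norm_id_le)
  calc ‖poissonTransform X f‖
      ≤ ‖ContinuousLinearMap.adjoint (ampliatedKernel E X)‖ *
          (‖opTensor f (1 : H →L[ℂ] H)‖ * ‖ampliatedKernel E X‖) :=
        (ContinuousLinearMap.opNorm_comp_le _ _).trans
          (mul_le_mul_of_nonneg_left (ContinuousLinearMap.opNorm_comp_le _ _) (norm_nonneg _))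
    _ ≤ 1 * (‖f‖ * 1) := by
        gcongr
        rwa [LinearIsometryEquiv.norm_map]
    _ = ‖f‖ := by ring

/-- The Poisson transform at `X`, as a bounded linear map. -/
def poissonTransformL (E : Type*) [NormedAddCommGroup E] [InnerProductSpace ℂ E] [CompleteSpace E]
    (X : ncBall n H) :
    (HilbertTensor E (Fock n) →L[ℂ] HilbertTensor E (Fock n)) →L[ℂ]
      (HilbertTensor E H →L[ℂ] HilbertTensor E H) :=
  LinearMap.mkContinuous
    { toFun := poissonTransform X.1
      map_add' := poissonTransform_add X.1
      map_smul' := poissonTransform_smul X.1 } 1 fun f => by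
    simpa using norm_poissonTransform_le X.2 f

@[simp] theorem poissonTransformL_apply (X : ncBall n H)
    (f : HilbertTensor E (Fock n) →L[ℂ] HilbertTensor E (Fock n)) :
    poissonTransformL E X f = poissonTransform X.1 f := rfl

theorem norm_matrixOp_poissonTransform_le {m : ℕ} {X : Fin n → (H →L[ℂ] H)}
    (hX : X ∈ ncBall n H)
    (f : Fin m → Fin m → (HilbertTensor E (Fock n) →L[ℂ] HilbertTensor E (Fock n))) :
    ‖matrixOp fun i j => poissonTransform X (f i j)‖ ≤ ‖matrixOp f‖ := by
  have hW := norm_ampliatedKernel_le (E := E) hX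
  refine (norm_matrixOp_comp_le (fun i j => opTensor (f i j) (1 : H →L[ℂ] H))
    (ContinuousLinearMap.adjoint (ampliatedKernel E X)) (ampliatedKernel E X)).trans ?_
  calc _ ≤ 1 * ‖matrixOp f‖ * 1 := by
        gcongr
        · rwa [LinearIsometryEquiv.norm_map]
        · exact norm_matrixOp_opTensor_one_le f
    _ = _ := by ring

end PoissonKernel

/-! ### Convergence of free power series on the ball -/

section Convergence

/-! ### Cauchy–Schwarz inequalities for rows and columns of operators -/

section OperatorSums

variable {K ι : Type*} [NormedAddCommGroup K] [InnerProductSpace ℂ K] [CompleteSpace K]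

theorem sum_norm_sq_apply_le (s : Finset ι) (a : ι → (K →L[ℂ] K)) (x : K) :
    ∑ i ∈ s, ‖a i x‖ ^ 2 ≤ ‖∑ i ∈ s, star (a i) * a i‖ * ‖x‖ ^ 2 := by
  have h : ((∑ i ∈ s, ‖a i x‖ ^ 2 : ℝ) : ℂ) = inner ℂ x ((∑ i ∈ s, star (a i) * a i) x) := by
    rw [sum_apply, inner_sum]
    push_cast
    refine Finset.sum_congr rfl fun i _ => ?_
    change _ = inner ℂ x (star (a i) (a i x))
    rw [ContinuousLinearMap.star_eq_adjoint,
      ContinuousLinearMap.adjoint_inner_right, inner_self_eq_norm_sq_to_K]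
    rfl
  have h2 : ∑ i ∈ s, ‖a i x‖ ^ 2 = ‖inner ℂ x ((∑ i ∈ s, star (a i) * a i) x)‖ := by
    rw [← h, Complex.norm_real, Real.norm_of_nonneg (Finset.sum_nonneg fun i _ => sq_nonneg _)]
  rw [h2]
  calc _ ≤ ‖x‖ * ‖(∑ i ∈ s, star (a i) * a i) x‖ := norm_inner_le_norm _ _
    _ ≤ ‖x‖ * (‖∑ i ∈ s, star (a i) * a i‖ * ‖x‖) := by
      gcongr; exact ContinuousLinearMap.le_opNorm _ _
    _ = _ := by ring

/-- With `y = (∑ b_i a_i) x` one has `‖y‖² = ∑ ⟪b_i^* y, a_i x⟫`, to which Cauchy–Schwarz applies.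
The bounds are taken pointwise, so that the lemma can also turn pointwise bounds into norm bounds.
-/
theorem norm_sum_mul_sq_le_of_forall (s : Finset ι) (a b : ι → (K →L[ℂ] K)) {A B : ℝ}
    (hA : ∀ x, ∑ i ∈ s, ‖a i x‖ ^ 2 ≤ A * ‖x‖ ^ 2)
    (hB : ∀ y, ∑ i ∈ s, ‖star (b i) y‖ ^ 2 ≤ B * ‖y‖ ^ 2) (hA0 : 0 ≤ A) (hB0 : 0 ≤ B) :
    ‖∑ i ∈ s, b i * a i‖ ^ 2 ≤ B * A := by
  have key : ‖∑ i ∈ s, b i * a i‖ ≤ Real.sqrt (B * A) := by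
    refine ContinuousLinearMap.opNorm_le_bound _ (Real.sqrt_nonneg _) fun x => ?_
    set y := (∑ i ∈ s, b i * a i) x with hy
    have h1 : ‖y‖ ^ 2 ≤ ∑ i ∈ s, ‖star (b i) y‖ * ‖a i x‖ := by
      have h2 : inner ℂ y y = ∑ i ∈ s, inner ℂ (star (b i) y) (a i x) := by
        have h3 : inner ℂ y y = inner ℂ y (∑ i ∈ s, (b i * a i) x) := by rw [← sum_apply]
        rw [h3, inner_sum]
        refine Finset.sum_congr rfl fun i _ => ?_
        rw [ContinuousLinearMap.star_eq_adjoint, ContinuousLinearMap.adjoint_inner_left]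
        rfl
      rw [inner_self_eq_norm_sq_to_K] at h2
      have h3 := congrArg norm h2
      rw [norm_pow, RCLike.norm_ofReal, abs_norm] at h3
      rw [h3]
      exact (norm_sum_le _ _).trans (Finset.sum_le_sum fun i _ => norm_inner_le_norm _ _)
    have h2 : (‖y‖ ^ 2) ^ 2 ≤ (B * ‖y‖ ^ 2) * (A * ‖x‖ ^ 2) := by
      calc (‖y‖ ^ 2) ^ 2 ≤ (∑ i ∈ s, ‖star (b i) y‖ * ‖a i x‖) ^ 2 := by gcongr
        _ ≤ (∑ i ∈ s, ‖star (b i) y‖ ^ 2) * ∑ i ∈ s, ‖a i x‖ ^ 2 :=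
          Finset.sum_mul_sq_le_sq_mul_sq _ _ _
        _ ≤ _ := mul_le_mul (hB y) (hA x) (Finset.sum_nonneg fun i _ => sq_nonneg _)
          (by positivity)
    rw [← pow_le_pow_iff_left₀ (norm_nonneg _) (by positivity) two_ne_zero, mul_pow,
      Real.sq_sqrt (by positivity)]
    rcases (sq_nonneg ‖y‖).eq_or_lt with h0 | h0
    · rw [← h0]; positivity
    · refine le_of_mul_le_mul_right ?_ h0
      linarith
  rw [← Real.sqrt_le_sqrt_iff (by positivity), Real.sqrt_sq (norm_nonneg _)]
  exact key

theorem norm_sum_mul_sq_le (s : Finset ι) (a b : ι → (K →L[ℂ] K)) :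
    ‖∑ i ∈ s, b i * a i‖ ^ 2 ≤ ‖∑ i ∈ s, b i * star (b i)‖ * ‖∑ i ∈ s, star (a i) * a i‖ :=
  norm_sum_mul_sq_le_of_forall s a b (sum_norm_sq_apply_le s a)
    (fun y => by simpa only [star_star] using sum_norm_sq_apply_le s (fun i => star (b i)) y)
    (norm_nonneg _) (norm_nonneg _)

/-- This is the preceding inequality for the row `b_i = a_i^*`. -/
theorem norm_sum_star_mul_self_le (s : Finset ι) (a : ι → (K →L[ℂ] K)) {M : ℝ}
    (h : ∀ x, ∑ i ∈ s, ‖a i x‖ ^ 2 ≤ M * ‖x‖ ^ 2) (hM : 0 ≤ M) :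
    ‖∑ i ∈ s, star (a i) * a i‖ ≤ M := by
  have := norm_sum_mul_sq_le_of_forall s a (fun i => star (a i)) h
    (by simpa only [star_star] using h) hM hM
  rw [← sq] at this
  exact (pow_le_pow_iff_left₀ (norm_nonneg _) hM two_ne_zero).1 this

end OperatorSums

/-! ### Geometric bounds for the homogeneous parts -/

section

variable {n : ℕ} {E H : Type*}
  [NormedAddCommGroup E] [InnerProductSpace ℂ E] [CompleteSpace E]
  [NormedAddCommGroup H] [InnerProductSpace ℂ H] [CompleteSpace H]

theorem word_cons {k : ℕ} (j : Fin n) (i : Fin k → Fin n) :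
    word (Fin.cons j i : Fin (k + 1) → Fin n) = FreeMonoid.of j * word i := by
  simp [word, List.ofFn_succ, FreeMonoid.ofList_cons]

/-- Splitting off the first letter, the sum for length `k + 1` is `∑ X_j D X_j^*` with `D` the sum
for length `k`. Positivity of `D` gives `D ≤ ‖D‖ I`, so each step costs at most the factor `‖∑ X_j
X_j^*‖`. -/
theorem norm_sum_word_le (X : Fin n → (H →L[ℂ] H)) (k : ℕ) :
    ‖∑ i : Fin k → Fin n, FreeMonoid.lift X (word i) * star (FreeMonoid.lift X (word i))‖ ≤
      ‖∑ j, X j * star (X j)‖ ^ k := by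
  induction k with
  | zero =>
    simp only [word, Finset.univ_unique, Finset.sum_singleton, List.ofFn_zero,
      FreeMonoid.ofList_nil, map_one, star_one, mul_one, pow_zero]
    exact ContinuousLinearMap.norm_id_le
  | succ k ih =>
    set D := ∑ i : Fin k → Fin n, FreeMonoid.lift X (word i) * star (FreeMonoid.lift X (word i))
      with hD
    have h1 : ∑ i : Fin (k + 1) → Fin n,
        FreeMonoid.lift X (word i) * star (FreeMonoid.lift X (word i)) =
        ∑ j, X j * D * star (X j) := by
      rw [← Equiv.sum_comp (Fin.consEquiv fun _ => Fin n), Fintype.sum_prod_type]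
      refine Finset.sum_congr rfl fun j _ => ?_
      rw [hD, Finset.mul_sum, Finset.sum_mul]
      refine Finset.sum_congr rfl fun i _ => ?_
      change FreeMonoid.lift X (word (Fin.cons j i : Fin (k + 1) → Fin n)) *
        star (FreeMonoid.lift X (word (Fin.cons j i : Fin (k + 1) → Fin n))) = _
      rw [word_cons, map_mul, FreeMonoid.lift_eval_of, star_mul]
      simp only [mul_assoc]
    have hD0 : 0 ≤ D := Finset.sum_nonneg fun i _ => mul_star_self_nonneg _
    have h2 : ∑ j, X j * D * star (X j) ≤ ‖D‖ • ∑ j, X j * star (X j) := by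
      rw [Finset.smul_sum]
      exact Finset.sum_le_sum fun j _ => CStarAlgebra.star_right_conjugate_le_norm_smul
    have h3 : 0 ≤ ∑ j, X j * D * star (X j) := Finset.sum_nonneg fun j _ =>
      star_right_conjugate_nonneg hD0 _
    rw [h1]
    refine (CStarAlgebra.norm_le_norm_of_nonneg_of_le h3 h2).trans ?_
    rw [norm_smul, norm_norm, pow_succ]
    gcongr

/-- The homogeneous part is the row of the `I ⊗ X_α` times the column of the `A_α ⊗ I`. -/
theorem norm_homPart_sq_le (A : FreeMonoid (Fin n) → (E →L[ℂ] E)) (X : Fin n → (H →L[ℂ] H))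
    (k : ℕ) : ‖homPart A X k‖ ^ 2 ≤ ‖∑ j, X j * star (X j)‖ ^ k *
      ‖∑ i : Fin k → Fin n, star (A (word i)) * A (word i)‖ := by
  have h : homPart A X k = ∑ i : Fin k → Fin n,
      opTensor (1 : E →L[ℂ] E) (FreeMonoid.lift X (word i)) * opTensor (A (word i)) 1 := by
    simp only [homPart, opTensor_mul, one_mul, mul_one]
  rw [h]
  refine (norm_sum_mul_sq_le _ _ _).trans ?_
  simp only [star_opTensor, opTensor_mul, star_one, one_mul, ← opTensor_sum_right,
    ← opTensor_sum_left]
  refine mul_le_mul ?_ ?_ (norm_nonneg _) (by positivity)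
  · refine (norm_opTensor_le _ _).trans ?_
    refine (mul_le_of_le_one_left (norm_nonneg _) ContinuousLinearMap.norm_id_le).trans ?_
    exact norm_sum_word_le X k
  · refine (norm_opTensor_le _ _).trans ?_
    exact mul_le_of_le_one_right (norm_nonneg _) ContinuousLinearMap.norm_id_le

theorem summable_norm_homPart {A : FreeMonoid (Fin n) → (E →L[ℂ] E)}
    (hA : 1 ≤ convergenceRadius A) (X : ncBall n H) : Summable fun k => ‖homPart A X.1 k‖ := by
  set ρ := ‖∑ j, X.1 j * star (X.1 j)‖ with hρ
  have hρ1 : ρ < 1 := norm_sum_lt_one X.2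
  have hρ0 : 0 ≤ ρ := norm_nonneg _
  -- The number `s` leaves room on both sides: `1 / √s > 1` bounds the square norms of the
  -- coefficient columns eventually by `s⁻¹ ^ k`, and the terms are then dominated by a geometric
  -- series of ratio `√(ρ / s) < 1`.
  obtain ⟨s, hs, hs1⟩ := exists_between hρ1
  have hs0 : 0 < s := hρ0.trans_lt hs
  rw [one_le_convergenceRadius_iff] at hA
  have hd : (1 : ENNReal) < ENNReal.ofReal (1 / Real.sqrt s) := by
    rw [← ENNReal.ofReal_one, ENNReal.ofReal_lt_ofReal_iff (by positivity), lt_div_iff₀ (by positivity),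
      one_mul, Real.sqrt_lt' one_pos]
    simpa using hs1
  refine Summable.of_norm_bounded_eventually_nat (g := fun k => Real.sqrt (ρ / s) ^ k)
    (summable_geometric_of_lt_one (Real.sqrt_nonneg _) ?_) ?_
  · rw [Real.sqrt_lt' one_pos, div_lt_iff₀ hs0]; simpa using hs
  · filter_upwards [hA _ hd] with k hk
    have h1 : ‖∑ i : Fin k → Fin n, star (A (word i)) * A (word i)‖ ≤ (1 / s) ^ k := by
      rw [coeffNorm, ← ofReal_norm, ENNReal.ofReal_rpow_of_pos (by positivity),
        ENNReal.ofReal_le_ofReal_iff (by positivity), Real.rpow_mul (by positivity),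
        Real.rpow_natCast] at hk
      refine hk.trans_eq ?_
      congr 1
      rw [Real.rpow_ofNat, div_pow, one_pow, Real.sq_sqrt hs0.le]
    rw [norm_norm, ← pow_le_pow_iff_left₀ (norm_nonneg _) (by positivity) two_ne_zero]
    refine (norm_homPart_sq_le A X.1 k).trans ?_
    rw [← pow_mul, mul_comm k 2, pow_mul, Real.sq_sqrt (by positivity), div_eq_mul_one_div, mul_pow]
    gcongr

end

end Convergence

/-! ### The representations of a free pluriharmonic function -/

section Pluriharmonic

section RealPart

variable {K L : Type*} [NormedAddCommGroup K] [InnerProductSpace ℂ K] [CompleteSpace K]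

theorem hasSum_rePart {ι : Type*} {f : ι → (K →L[ℂ] K)} {a : K →L[ℂ] K} (h : HasSum f a) :
    HasSum (fun i => rePart (f i)) (rePart a) :=
  (h.add h.star).const_smul _

theorem norm_rePart_le (T : K →L[ℂ] K) : ‖rePart T‖ ≤ ‖T‖ := by
  rw [rePart, norm_smul]
  have h := norm_add_le T (star T)
  rw [norm_star] at h
  have h2 : ‖(1 / 2 : ℂ)‖ = 1 / 2 := by norm_num
  rw [h2]
  linarith

end RealPart

variable {n : ℕ} {E : Type u} {H : Type v}
  [NormedAddCommGroup E] [InnerProductSpace ℂ E] [CompleteSpace E]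
  [NormedAddCommGroup H] [InnerProductSpace ℂ H] [CompleteSpace H]

/-- The homogeneous part of degree `k` of the free pluriharmonic function with coefficients
`A` and `B`. -/
def pluriTerm (A B : FreeMonoid (Fin n) → (E →L[ℂ] E)) (X : Fin n → (H →L[ℂ] H)) (k : ℕ) :
    HilbertTensor E H →L[ℂ] HilbertTensor E H :=
  rePart (homPart A X k) + Complex.I • rePart (homPart B X k)

/-- The representation on the ball of `B(H)^n` of the free pluriharmonic function with coefficients
`A` and `B`. -/
def pluriRep (A B : FreeMonoid (Fin n) → (E →L[ℂ] E)) (X : Fin n → (H →L[ℂ] H)) :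
    HilbertTensor E H →L[ℂ] HilbertTensor E H :=
  ∑' k, pluriTerm A B X k

theorem summable_norm_pluriTerm {A B : FreeMonoid (Fin n) → (E →L[ℂ] E)}
    (hA : 1 ≤ convergenceRadius A) (hB : 1 ≤ convergenceRadius B) (X : ncBall n H) :
    Summable fun k => ‖pluriTerm A B X.1 k‖ := by
  refine Summable.of_nonneg_of_le (fun k => norm_nonneg _) (fun k => ?_)
    ((summable_norm_homPart hA X).add (summable_norm_homPart hB X))
  refine (norm_add_le _ _).trans (add_le_add (norm_rePart_le _) ?_)
  rw [norm_smul, Complex.norm_I, one_mul]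
  exact norm_rePart_le _

theorem hasSum_pluriTerm {A B : FreeMonoid (Fin n) → (E →L[ℂ] E)}
    (hA : 1 ≤ convergenceRadius A) (hB : 1 ≤ convergenceRadius B) (X : ncBall n H) :
    HasSum (pluriTerm A B X.1) (pluriRep A B X.1) :=
  (summable_norm_pluriTerm hA hB X).of_norm.hasSum

/-- Absolute convergence on the whole ball makes `F₁` and `F₂` redundant: a representation is a
function of the coefficients alone. -/
theorem isFreePluriharmonicWith_iff {A B : FreeMonoid (Fin n) → (E →L[ℂ] E)}
    {u : ncBall n H → (HilbertTensor E H →L[ℂ] HilbertTensor E H)} :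
    IsFreePluriharmonicWith A B u ↔ 1 ≤ convergenceRadius A ∧ 1 ≤ convergenceRadius B ∧
      ∀ X, u X = pluriRep A B X.1 := by
  constructor
  · rintro ⟨F, G, hF, hG, hu⟩
    refine ⟨hF.1, hG.1, fun X => ?_⟩
    rw [hu]
    exact ((hasSum_rePart (hF.2 X)).add ((hasSum_rePart (hG.2 X)).const_smul Complex.I)).unique
      (hasSum_pluriTerm hF.1 hG.1 X)
  · rintro ⟨hA, hB, hu⟩
    have hA' := fun X : ncBall n H => (summable_norm_homPart hA X).of_norm.hasSum
    have hB' := fun X : ncBall n H => (summable_norm_homPart hB X).of_norm.hasSum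
    refine ⟨_, _, ⟨hA, hA'⟩, ⟨hB, hB'⟩, fun X => ?_⟩
    rw [hu]
    exact (hasSum_pluriTerm hA hB X).unique
      ((hasSum_rePart (hA' X)).add ((hasSum_rePart (hB' X)).const_smul Complex.I))

theorem length_word {k : ℕ} (i : Fin k → Fin n) : (word i).length = k := by
  simp [word, FreeMonoid.length]

theorem lift_smul (c : ℂ) (X : Fin n → (H →L[ℂ] H)) (α : FreeMonoid (Fin n)) :
    FreeMonoid.lift (fun i => c • X i) α = c ^ α.length • FreeMonoid.lift X α := by
  induction α using FreeMonoid.inductionOn' with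
  | one => simp
  | of_mul i α ih =>
    rw [map_mul, map_mul, ih, FreeMonoid.lift_eval_of, FreeMonoid.lift_eval_of,
      smul_mul_smul_comm, FreeMonoid.length_mul, FreeMonoid.length_of, pow_add, pow_one]

theorem pluriTerm_smul (A B : FreeMonoid (Fin n) → (E →L[ℂ] E)) (r : ℝ)
    (X : Fin n → (H →L[ℂ] H)) (k : ℕ) :
    pluriTerm A B (fun i => (r : ℂ) • X i) k = ((r ^ k : ℝ) : ℂ) • pluriTerm A B X k := by
  have h : ∀ C : FreeMonoid (Fin n) → (E →L[ℂ] E),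
      homPart C (fun i => (r : ℂ) • X i) k = ((r ^ k : ℝ) : ℂ) • homPart C X k := by
    intro C
    simp only [homPart, lift_smul, length_word, opTensor_smul_right, Finset.smul_sum,
      Complex.ofReal_pow]
  rw [pluriTerm, pluriTerm, h, h, rePart_ofReal_smul, rePart_ofReal_smul, smul_add, smul_comm]

theorem poissonTransform_homPart (A : FreeMonoid (Fin n) → (E →L[ℂ] E)) (X : ncBall n H) (k : ℕ) :
    poissonTransform X.1 (homPart A leftCreation k) = homPart A X.1 k := by
  rw [← poissonTransformL_apply, homPart, map_sum, homPart]
  exact Finset.sum_congr rfl fun i _ => poissonTransform_opTensor_lift X.2 _ _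

theorem poissonTransform_rePart (X : ncBall n H)
    (f : HilbertTensor E (Fock n) →L[ℂ] HilbertTensor E (Fock n)) :
    poissonTransform X.1 (rePart f) = rePart (poissonTransform X.1 f) := by
  rw [rePart, poissonTransform_smul, poissonTransform_add, poissonTransform_star, rePart]

theorem poissonTransform_pluriTerm (A B : FreeMonoid (Fin n) → (E →L[ℂ] E)) (X : ncBall n H)
    (k : ℕ) : poissonTransform X.1 (pluriTerm A B leftCreation k) = pluriTerm A B X.1 k := by
  rw [pluriTerm, poissonTransform_add, poissonTransform_smul, poissonTransform_rePart,
    poissonTransform_rePart, poissonTransform_homPart, poissonTransform_homPart, pluriTerm]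

/-- The Poisson transform of `u(rS)` at `X` is `u(rX)`. -/
theorem hasSum_poissonTransform_radialShift {A B : FreeMonoid (Fin n) → (E →L[ℂ] E)}
    (hA : 1 ≤ convergenceRadius A) (hB : 1 ≤ convergenceRadius B) (X : ncBall n H)
    (r : Set.Ico (0 : ℝ) 1) :
    HasSum (fun k => (((r : ℝ) ^ k : ℝ) : ℂ) • pluriTerm A B X.1 k)
      (poissonTransform X.1 (pluriRep A B (radialShift n r).1)) := by
  have h := (hasSum_pluriTerm hA hB (radialShift n r)).mapL (poissonTransformL E X)
  simp only [poissonTransformL_apply, radialShift, pluriTerm_smul, poissonTransform_smul,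
    poissonTransform_pluriTerm] at h
  exact h

/-- The filter of the radial limits `r → 1`, `0 ≤ r < 1`. -/
def radialFilter : Filter (Set.Ico (0 : ℝ) 1) := comap (Subtype.val : Set.Ico (0 : ℝ) 1 → ℝ) (𝓝 1)

instance : radialFilter.NeBot := by
  rw [radialFilter]
  refine mem_closure_iff_comap_neBot.1 ?_
  rw [closure_Ico zero_ne_one]
  exact ⟨zero_le_one, le_rfl⟩

/-- Through this the Banach–Steinhaus theorem applies: pointwise limits of operators as `r → 1` are
bounded operators. -/
instance : radialFilter.IsCountablyGenerated := by
  rw [radialFilter]; infer_instance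

theorem tendsto_val_radialFilter :
    Tendsto (fun r : Set.Ico (0 : ℝ) 1 => (r : ℝ)) radialFilter (𝓝 1) := tendsto_comap

theorem tendsto_pow_radialFilter (k : ℕ) :
    Tendsto (fun r : Set.Ico (0 : ℝ) 1 => (((r : ℝ) ^ k : ℝ) : ℂ)) radialFilter (𝓝 1) := by
  have h := (tendsto_val_radialFilter.pow k).ofReal
  simpa using h

/-- Since `0 ≤ r ^ k ≤ 1`, the series of `u(rX)` is dominated by the absolutely convergent series of
`u(X)`. -/
theorem tendsto_poissonTransform_radialShift {A B : FreeMonoid (Fin n) → (E →L[ℂ] E)}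
    (hA : 1 ≤ convergenceRadius A) (hB : 1 ≤ convergenceRadius B) (X : ncBall n H) :
    Tendsto (fun r => poissonTransform X.1 (pluriRep A B (radialShift n r).1)) radialFilter
      (𝓝 (pluriRep A B X.1)) := by
  have h1 : ∀ r, poissonTransform X.1 (pluriRep A B (radialShift n r).1) =
      ∑' k, (((r : ℝ) ^ k : ℝ) : ℂ) • pluriTerm A B X.1 k := fun r =>
    (hasSum_poissonTransform_radialShift hA hB X r).tsum_eq.symm
  simp only [h1]
  refine tendsto_tsum_of_dominated_convergence (summable_norm_pluriTerm hA hB X) (fun k => ?_)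
    (Eventually.of_forall fun r k => ?_)
  · simpa using (tendsto_pow_radialFilter k).smul_const (pluriTerm A B X.1 k)
  · rw [norm_smul, Complex.norm_real, Real.norm_of_nonneg (pow_nonneg r.2.1 k)]
    exact mul_le_of_le_one_left (norm_nonneg _) (pow_le_one₀ r.2.1 r.2.2.le)

end Pluriharmonic

/-! ### Matrix entries of operators on `E ⊗ F²(H_n)` -/

section Entries

variable {n : ℕ} {E : Type u} [NormedAddCommGroup E] [InnerProductSpace ℂ E]

/-- The isometry `x ↦ x ⊗ e_β`. -/
def basisIncl (E : Type u) [NormedAddCommGroup E] [InnerProductSpace ℂ E]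
    (β : FreeMonoid (Fin n)) : E →ₗᵢ[ℂ] HilbertTensor E (Fock n) where
  toFun x := hTmul x (fockBasis β)
  map_add' x y := hTmul_add_left x y _
  map_smul' c x := hTmul_smul_left c x _
  norm_map' x := by
    change ‖hTmul x (fockBasis β)‖ = ‖x‖
    rw [norm_hTmul, (fockBasis_orthonormal n).1, mul_one]

@[simp] theorem basisIncl_apply (β : FreeMonoid (Fin n)) (x : E) :
    basisIncl E β x = hTmul x (fockBasis β) := rfl

theorem clm_ext_basisIncl {Z : Type*} [NormedAddCommGroup Z] [NormedSpace ℂ Z]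
    {S T : HilbertTensor E (Fock n) →L[ℂ] Z}
    (h : ∀ β x, S (hTmul x (fockBasis β)) = T (hTmul x (fockBasis β))) : S = T := by
  refine clm_ext_hTmul fun x y => ?_
  have : S.comp (tensorLeft x) = T.comp (tensorLeft x) := fock_clm_ext fun β => h β x
  exact DFunLike.congr_fun this y

theorem dense_span_basisIncl :
    Dense (Submodule.span ℂ {z : HilbertTensor E (Fock n) | ∃ β x, z = hTmul x (fockBasis β)} :
      Set (HilbertTensor E (Fock n))) := by
  rw [dense_iff_closure_eq, ← Submodule.topologicalClosure_coe]
  set N := (Submodule.span ℂ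
    {z : HilbertTensor E (Fock n) | ∃ β x, z = hTmul x (fockBasis β)}).topologicalClosure
  have hN : N = ⊤ := by
    rw [eq_top_iff, ← dense_span_hTmul]
    refine Submodule.topologicalClosure_minimal _ (Submodule.span_le.2 ?_)
      (Submodule.isClosed_topologicalClosure _)
    rintro _ ⟨x, y, rfl⟩
    have h : (Submodule.span ℂ (Set.range (fockBasis : FreeMonoid (Fin n) → Fock n))) ≤
        N.comap (tensorLeft x : Fock n →L[ℂ] HilbertTensor E (Fock n)).toLinearMap := by
      refine Submodule.span_le.2 ?_
      rintro _ ⟨β, rfl⟩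
      exact Submodule.le_topologicalClosure _ (Submodule.subset_span ⟨β, x, rfl⟩)
    have hc : IsClosed ((N.comap
        (tensorLeft x : Fock n →L[ℂ] HilbertTensor E (Fock n)).toLinearMap : Submodule ℂ (Fock n)) :
        Set (Fock n)) :=
      (Submodule.isClosed_topologicalClosure _).preimage (tensorLeft x).continuous
    have := dense_span_fockBasis (n := n) y
    exact closure_minimal h hc this
  rw [hN, Submodule.top_coe]

theorem fock_orthogonalFamily :
    OrthogonalFamily ℂ (fun _ : FreeMonoid (Fin n) => E) (basisIncl E) := by
  classical
  intro β γ h x y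
  simp [inner_fockBasis, h]

variable [CompleteSpace E]

theorem fock_isHilbertSum :
    IsHilbertSum ℂ (fun _ : FreeMonoid (Fin n) => E) (basisIncl E) := by
  refine IsHilbertSum.mk fock_orthogonalFamily ?_
  have h := (Submodule.dense_iff_topologicalClosure_eq_top).1 (dense_span_basisIncl (n := n) (E := E))
  rw [← h]
  refine Submodule.topologicalClosure_mono (Submodule.span_le.2 ?_)
  rintro _ ⟨β, x, rfl⟩
  exact Submodule.mem_iSup_of_mem β ⟨x, rfl⟩

/-- The `γ`-th coordinate of a vector of `E ⊗ F²(H_n)`. -/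
def coord (E : Type u) [NormedAddCommGroup E] [InnerProductSpace ℂ E] [CompleteSpace E]
    (γ : FreeMonoid (Fin n)) : HilbertTensor E (Fock n) →L[ℂ] E :=
  ContinuousLinearMap.adjoint (basisIncl E γ).toContinuousLinearMap

theorem inner_coord (γ : FreeMonoid (Fin n)) (x : E) (z : HilbertTensor E (Fock n)) :
    inner ℂ x (coord E γ z) = inner ℂ (hTmul x (fockBasis γ)) z :=
  ContinuousLinearMap.adjoint_inner_right _ _ _

@[simp] theorem coord_hTmul (γ : FreeMonoid (Fin n)) (x : E) (y : Fock n) :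
    coord E γ (hTmul x y) = (y γ) • x := by
  refine ext_inner_left ℂ fun z => ?_
  rw [inner_coord, inner_hTmul, inner_fockBasis_left, inner_smul_right, mul_comm]

theorem fockBasis_apply [DecidableEq (FreeMonoid (Fin n))] (α β : FreeMonoid (Fin n)) :
    (fockBasis α : Fock n) β = if β = α then 1 else 0 := by
  rw [← inner_fockBasis_left, inner_fockBasis]
  congr

variable (n E) in
/-- The identification of `E ⊗ F²(H_n)` with the square summable families in `E`. -/
def coords : HilbertTensor E (Fock n) ≃ₗᵢ[ℂ] lp (fun _ : FreeMonoid (Fin n) => E) 2 :=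
  fock_isHilbertSum.linearIsometryEquiv

theorem coords_apply (z : HilbertTensor E (Fock n)) (γ : FreeMonoid (Fin n)) :
    coords n E z γ = coord E γ z := by
  classical
  have h := (fock_isHilbertSum (n := n) (E := E)).hasSum_linearIsometryEquiv_symm (coords n E z)
  rw [coords, LinearIsometryEquiv.symm_apply_apply] at h
  have h2 := h.mapL (coord E γ)
  refine HasSum.unique (f := fun α => coord E γ (basisIncl E α (coords n E z α))) ?_ h2
  have : (fun α => coord E γ (basisIncl E α (coords n E z α))) =
      fun α => if α = γ then coords n E z γ else 0 := by
    funext α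
    rw [basisIncl_apply, coord_hTmul, fockBasis_apply]
    split_ifs with h1 h2 h2
    · subst h1; simp
    · exact absurd h1.symm h2
    · exact absurd h2.symm h1
    · simp
  rw [this]
  exact hasSum_ite_eq γ _

theorem ext_coord {y z : HilbertTensor E (Fock n)} (h : ∀ γ, coord E γ y = coord E γ z) : y = z := by
  refine (coords n E).injective (lp.ext (funext fun γ => ?_))
  rw [coords_apply, coords_apply, h]

theorem hasSum_norm_coord_sq (z : HilbertTensor E (Fock n)) :
    HasSum (fun γ => ‖coord E γ z‖ ^ 2) (‖z‖ ^ 2) := by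
  have h := lp.hasSum_norm (p := 2) (by simp) (coords n E z)
  simpa [coords_apply] using h

/-- The matrix entry of `f` at `(γ, β)`, an operator on `E`. -/
def entry (γ β : FreeMonoid (Fin n)) :
    (HilbertTensor E (Fock n) →L[ℂ] HilbertTensor E (Fock n)) →L[ℂ] (E →L[ℂ] E) :=
  (ContinuousLinearMap.compL ℂ E (HilbertTensor E (Fock n)) E (coord E γ)).comp
    ((ContinuousLinearMap.compL ℂ E (HilbertTensor E (Fock n)) (HilbertTensor E (Fock n))).flip
      (basisIncl E β).toContinuousLinearMap)

theorem entry_apply (γ β : FreeMonoid (Fin n))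
    (f : HilbertTensor E (Fock n) →L[ℂ] HilbertTensor E (Fock n)) (x : E) :
    entry γ β f x = coord E γ (f (hTmul x (fockBasis β))) := rfl

theorem ext_entry {f g : HilbertTensor E (Fock n) →L[ℂ] HilbertTensor E (Fock n)}
    (h : ∀ γ β, entry γ β f = entry γ β g) : f = g :=
  clm_ext_basisIncl fun β x => ext_coord fun γ => by
    rw [← entry_apply, h, entry_apply]

theorem entry_star (γ β : FreeMonoid (Fin n))
    (f : HilbertTensor E (Fock n) →L[ℂ] HilbertTensor E (Fock n)) :
    entry γ β (star f) = star (entry β γ f) := by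
  refine ContinuousLinearMap.ext fun x => ext_inner_left ℂ fun y => ?_
  rw [entry_apply, inner_coord, ContinuousLinearMap.star_eq_adjoint,
    ContinuousLinearMap.star_eq_adjoint, ContinuousLinearMap.adjoint_inner_right,
    ContinuousLinearMap.adjoint_inner_right, ← inner_conj_symm, entry_apply, ← inner_coord,
    inner_conj_symm]

theorem lift_leftCreation_fockBasis (α β : FreeMonoid (Fin n)) :
    FreeMonoid.lift leftCreation α (fockBasis β) = fockBasis (α * β) := by
  induction α using FreeMonoid.inductionOn' with
  | one => simp
  | of_mul i α ih =>
    rw [map_mul, FreeMonoid.lift_eval_of, mul_apply_eq_comp]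
    rw [ih, leftCreation_fockBasis, mul_assoc]

theorem entry_opTensor_lift [DecidableEq (FreeMonoid (Fin n))] (γ β α : FreeMonoid (Fin n))
    (a : E →L[ℂ] E) :
    entry γ β (opTensor a (FreeMonoid.lift leftCreation α)) = if γ = α * β then a else 0 := by
  ext x
  rw [entry_apply, opTensor_hTmul, lift_leftCreation_fockBasis, coord_hTmul, fockBasis_apply]
  split_ifs <;> simp

theorem word_injective {k : ℕ} : Function.Injective (word : (Fin k → Fin n) → _) := by
  intro i j h
  exact List.ofFn_injective (FreeMonoid.ofList.injective h)

theorem exists_word_eq (α : FreeMonoid (Fin n)) : ∃ i : Fin α.length → Fin n, word i = α :=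
  ⟨fun i => α.toList.get i, by
    change FreeMonoid.ofList (List.ofFn α.toList.get) = α
    rw [List.ofFn_get, FreeMonoid.ofList_toList]⟩

/-- Right cancellation leaves one word that sends `e_β` to `e_{αβ}`, so a coefficient can be read
off in any column. -/
theorem entry_homPart_mul (A : FreeMonoid (Fin n) → (E →L[ℂ] E)) (α β : FreeMonoid (Fin n)) :
    entry (α * β) β (homPart A leftCreation α.length) = A α := by
  classical
  obtain ⟨i, hi⟩ := exists_word_eq α
  rw [homPart, map_sum, Finset.sum_eq_single i]
  · rw [entry_opTensor_lift, hi, if_pos rfl]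
  · intro j _ hj
    rw [entry_opTensor_lift, if_neg]
    intro h
    exact hj (word_injective ((mul_right_cancel h).symm.trans hi.symm))
  · simp

theorem entry_homPart_eq_zero (A : FreeMonoid (Fin n) → (E →L[ℂ] E)) {γ β : FreeMonoid (Fin n)}
    {k : ℕ} (h : ∀ α : FreeMonoid (Fin n), α.length = k → γ ≠ α * β) :
    entry γ β (homPart A leftCreation k) = 0 := by
  classical
  rw [homPart, map_sum]
  refine Finset.sum_eq_zero fun i _ => ?_
  rw [entry_opTensor_lift, if_neg (h _ (length_word i))]

/-- The difference of the lengths of two words. -/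
def gap (γ β : FreeMonoid (Fin n)) : ℕ := (γ.length - β.length) + (β.length - γ.length)

theorem gap_comm (γ β : FreeMonoid (Fin n)) : gap γ β = gap β γ := add_comm _ _

theorem gap_mul_left (α β : FreeMonoid (Fin n)) : gap (α * β) β = α.length := by
  simp only [gap, FreeMonoid.length_mul]; omega

theorem entry_rePart (γ β : FreeMonoid (Fin n))
    (f : HilbertTensor E (Fock n) →L[ℂ] HilbertTensor E (Fock n)) :
    entry γ β (rePart f) = (1 / 2 : ℂ) • (entry γ β f + star (entry β γ f)) := by
  rw [rePart, map_smul, map_add, entry_star]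

/-- A monomial of degree `k` raises the length by `k`, and its adjoint lowers it by `k` where it
does not vanish. -/
theorem entry_pluriTerm_eq_zero (A B : FreeMonoid (Fin n) → (E →L[ℂ] E))
    {γ β : FreeMonoid (Fin n)} {k : ℕ} (h : k ≠ gap γ β) :
    entry γ β (pluriTerm A B leftCreation k) = 0 := by
  have h1 : ∀ C : FreeMonoid (Fin n) → (E →L[ℂ] E), ∀ γ β : FreeMonoid (Fin n), k ≠ gap γ β →
      entry γ β (homPart C leftCreation k) = 0 := by
    intro C γ β h
    refine entry_homPart_eq_zero C fun α hα he => h ?_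
    rw [he, gap_mul_left, hα]
  have h' : k ≠ gap β γ := by rwa [gap_comm]
  simp [pluriTerm, entry_rePart, h1, h, h']

/-- Each entry sees a single degree, so the dependence on `r` is one explicit power. -/
theorem entry_pluriRep_radialShift {A B : FreeMonoid (Fin n) → (E →L[ℂ] E)}
    (hA : 1 ≤ convergenceRadius A) (hB : 1 ≤ convergenceRadius B) (r : Set.Ico (0 : ℝ) 1)
    (γ β : FreeMonoid (Fin n)) :
    entry γ β (pluriRep A B (radialShift n r).1) =
      (((r : ℝ) ^ gap γ β : ℝ) : ℂ) • entry γ β (pluriTerm A B leftCreation (gap γ β)) := by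
  have h := (hasSum_pluriTerm hA hB (radialShift n r)).mapL (entry γ β)
  simp only [radialShift, pluriTerm_smul, map_smul] at h
  refine h.unique (hasSum_single _ fun k hk => ?_)
  rw [entry_pluriTerm_eq_zero A B hk, smul_zero]

end Entries

/-! ### Radial limits -/

section RadialLimits

variable {n : ℕ} {E : Type u} [NormedAddCommGroup E] [InnerProductSpace ℂ E] [CompleteSpace E]

/-- A bounded family of vectors with coordinates `r ^ d γ • z γ` converges as `r → 1`. -/
theorem exists_tendsto_of_coord {d : FreeMonoid (Fin n) → ℕ} {z : FreeMonoid (Fin n) → E}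
    {y : Set.Ico (0 : ℝ) 1 → HilbertTensor E (Fock n)} {M : ℝ} (hM : ∀ r, ‖y r‖ ≤ M)
    (hy : ∀ r γ, coord E γ (y r) = (((r : ℝ) ^ d γ : ℝ) : ℂ) • z γ) :
    ∃ x, Tendsto y radialFilter (𝓝 x) := by
  have hz : Memℓp z 2 := by
    -- Fatou's lemma on finite partial sums: the bound by `M ^ 2` holds for every `r` and survives
    -- `r → 1`.
    refine memℓp_gen' (C := M ^ 2) fun s => ?_
    have ht : Tendsto (fun r : Set.Ico (0 : ℝ) 1 => ∑ γ ∈ s, ‖(((r : ℝ) ^ d γ : ℝ) : ℂ) • z γ‖ ^ 2)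
        radialFilter (𝓝 (∑ γ ∈ s, ‖z γ‖ ^ 2)) := by
      refine tendsto_finsetSum s fun γ _ => ?_
      simpa using (((tendsto_pow_radialFilter (d γ)).smul_const (z γ)).norm.pow 2)
    have hle := le_of_tendsto ht (b := M ^ 2) (Eventually.of_forall fun r => by
      have h1 := sum_le_hasSum s (fun γ _ => sq_nonneg ‖coord E γ (y r)‖) (hasSum_norm_coord_sq (y r))
      simp only [hy] at h1
      exact h1.trans (pow_le_pow_left₀ (norm_nonneg _) (hM r) 2))
    simpa using hle
  set x := (coords n E).symm ⟨z, hz⟩ with hx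
  have hxc : ∀ γ, coord E γ x = z γ := by
    intro γ
    rw [← coords_apply, hx, LinearIsometryEquiv.apply_symm_apply]
  have hs : Summable fun γ => ‖z γ‖ ^ 2 := by
    have := (hasSum_norm_coord_sq x).summable
    simpa only [hxc] using this
  refine ⟨x, ?_⟩
  rw [tendsto_iff_norm_sub_tendsto_zero]
  have hsq : Tendsto (fun r => ‖y r - x‖ ^ 2) radialFilter (𝓝 0) := by
    have h1 : ∀ r, ‖y r - x‖ ^ 2 = ∑' γ, ‖(((r : ℝ) ^ d γ : ℝ) : ℂ) • z γ - z γ‖ ^ 2 := by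
      intro r
      rw [← (hasSum_norm_coord_sq (y r - x)).tsum_eq]
      simp only [map_sub, hy, hxc]
    simp only [h1]
    have h0 : (0 : ℝ) = ∑' _ : FreeMonoid (Fin n), (0 : ℝ) := tsum_zero.symm
    refine Eq.subst (motive := fun c => Tendsto _ radialFilter (𝓝 c)) h0.symm ?_
    -- The majorant is `‖z γ‖ ^ 2`, because `|r ^ d γ - 1| ≤ 1`.
    refine tendsto_tsum_of_dominated_convergence hs (fun γ => ?_) (Eventually.of_forall fun r γ => ?_)
    · have := (((tendsto_pow_radialFilter (d γ)).smul_const (z γ)).sub_const (z γ)).norm.pow 2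
      simpa using this
    · have h2 : ((((r : ℝ) ^ d γ : ℝ) : ℂ) • z γ - z γ) = (((r : ℝ) ^ d γ - 1 : ℝ) : ℂ) • z γ := by
        push_cast
        rw [sub_smul, one_smul]
      have h0 := pow_nonneg r.2.1 (d γ)
      have h3 := pow_le_one₀ (n := d γ) r.2.1 r.2.2.le
      rw [Real.norm_of_nonneg (sq_nonneg _), h2, norm_smul, Complex.norm_real, mul_pow]
      refine mul_le_of_le_one_left (sq_nonneg _) (pow_le_one₀ (norm_nonneg _) ?_)
      rw [Real.norm_eq_abs, abs_le]
      constructor <;> linarith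
  have := hsq.sqrt
  simpa using this

/-- A bounded family of operators that converges pointwise on a set with dense span converges
strongly. -/
theorem exists_tendsto_of_dense {ι K L : Type*} [NormedAddCommGroup K] [NormedSpace ℂ K]
    [NormedAddCommGroup L] [NormedSpace ℂ L] [CompleteSpace L] {l : Filter ι} [l.NeBot]
    {g : ι → K →L[ℂ] L} {M : ℝ} (hM : ∀ r, ‖g r‖ ≤ M) {s : Set K}
    (hs : Dense (Submodule.span ℂ s : Set K))
    (h : ∀ x ∈ s, ∃ y, Tendsto (fun r => g r x) l (𝓝 y)) (x : K) :
    ∃ y, Tendsto (fun r => g r x) l (𝓝 y) := by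
  have hspan : ∀ x ∈ Submodule.span ℂ s, ∃ y, Tendsto (fun r => g r x) l (𝓝 y) := by
    intro x hx
    induction hx using Submodule.span_induction with
    | mem x hx => exact h x hx
    | zero => exact ⟨0, by simp⟩
    | add x y _ _ hx hy =>
      obtain ⟨a, ha⟩ := hx
      obtain ⟨b, hb⟩ := hy
      exact ⟨a + b, by simpa using ha.add hb⟩
    | smul c x _ hx =>
      obtain ⟨a, ha⟩ := hx
      exact ⟨c • a, by simpa using ha.const_smul c⟩
  have hM0 : 0 ≤ M := by
    obtain ⟨r⟩ := l.nonempty_of_neBot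
    exact (norm_nonneg _).trans (hM r)
  rw [← cauchy_map_iff_exists_tendsto, Metric.cauchy_iff]
  refine ⟨inferInstance, fun ε hε => ?_⟩
  -- The denominator uses `M + 1` because `M` may be zero.
  obtain ⟨x', hx', hd⟩ := Metric.mem_closure_iff.1 (hs x) (ε / (3 * (M + 1))) (by positivity)
  have hc := cauchy_map_iff_exists_tendsto.2 (hspan x' hx')
  obtain ⟨t, ht, hte⟩ := (Metric.cauchy_iff.1 hc).2 (ε / 3) (by positivity)
  refine ⟨(fun r => g r x) '' ((fun r => g r x') ⁻¹' t), image_mem_map ht, ?_⟩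
  rintro _ ⟨r, hr, rfl⟩ _ ⟨q, hq, rfl⟩
  have hb : ∀ r, dist (g r x) (g r x') ≤ ε / 3 := by
    intro r
    rw [dist_eq_norm, ← map_sub]
    refine ((g r).le_of_opNorm_le (hM r) _).trans ?_
    rw [dist_eq_norm] at hd
    calc M * ‖x - x'‖ ≤ (M + 1) * (ε / (3 * (M + 1))) := by gcongr; linarith
      _ = ε / 3 := by field_simp
  have h1 := hte _ hr _ hq
  have h2 := dist_triangle4 (g r x) (g r x') (g q x') (g q x)
  have h3 := hb r
  have h4 := hb q
  rw [dist_comm] at h4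
  dsimp only at h1 ⊢
  linarith

/-- If `‖u(rS)‖` is bounded then `u(rS)` has a strong limit as `r → 1`. -/
theorem exists_isRadialLimit {A B : FreeMonoid (Fin n) → (E →L[ℂ] E)}
    (hA : 1 ≤ convergenceRadius A) (hB : 1 ≤ convergenceRadius B) {M : ℝ}
    (hM : ∀ r, ‖pluriRep A B (radialShift n r).1‖ ≤ M) :
    ∃ f, IsRadialLimit (fun X : ncBall n (Fock n) => pluriRep A B X.1) f := by
  have h : ∀ x : HilbertTensor E (Fock n), ∃ y,
      Tendsto (fun r => pluriRep A B (radialShift n r).1 x) radialFilter (𝓝 y) := by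
    refine exists_tendsto_of_dense hM dense_span_basisIncl ?_
    rintro _ ⟨β, x, rfl⟩
    refine exists_tendsto_of_coord (d := fun γ => gap γ β)
      (z := fun γ => entry γ β (pluriTerm A B leftCreation (gap γ β)) x) (M := M * ‖x‖)
      (fun r => ?_) (fun r γ => ?_)
    · refine (ContinuousLinearMap.le_of_opNorm_le _ (hM r) _).trans_eq ?_
      rw [norm_hTmul, (fockBasis_orthonormal n).1, mul_one]
    · rw [← entry_apply, entry_pluriRep_radialShift hA hB]
      rfl
  choose f hf using h
  exact ⟨continuousLinearMapOfTendsto _ (tendsto_pi_nhds.2 hf), hf⟩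

theorem entry_of_isRadialLimit {A B : FreeMonoid (Fin n) → (E →L[ℂ] E)}
    (hA : 1 ≤ convergenceRadius A) (hB : 1 ≤ convergenceRadius B)
    {f : HilbertTensor E (Fock n) →L[ℂ] HilbertTensor E (Fock n)}
    (hf : IsRadialLimit (fun X : ncBall n (Fock n) => pluriRep A B X.1) f)
    (γ β : FreeMonoid (Fin n)) :
    entry γ β f = entry γ β (pluriTerm A B leftCreation (gap γ β)) := by
  ext x
  have h1 := ((coord E γ).continuous.tendsto _).comp (hf (hTmul x (fockBasis β)))
  have h2 : Tendsto (fun r : Set.Ico (0 : ℝ) 1 => (((r : ℝ) ^ gap γ β : ℝ) : ℂ) •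
      entry γ β (pluriTerm A B leftCreation (gap γ β)) x) radialFilter
      (𝓝 (entry γ β (pluriTerm A B leftCreation (gap γ β)) x)) := by
    simpa using (tendsto_pow_radialFilter (gap γ β)).smul_const
      (entry γ β (pluriTerm A B leftCreation (gap γ β)) x)
  refine tendsto_nhds_unique (l := radialFilter) (f := fun r => coord E γ
    (pluriRep A B (radialShift n r).1 (hTmul x (fockBasis β)))) h1 (h2.congr fun r => ?_)
  rw [← entry_apply, entry_pluriRep_radialShift hA hB]
  rfl

end RadialLimits

/-! ### The strong operator closure of `A_n(E)^* + A_n(E)` -/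

section Boundary

variable {n : ℕ} {E : Type u} [NormedAddCommGroup E] [InnerProductSpace ℂ E]

/-- The identity map from the norm topology to the strong operator topology. -/
abbrev toSOT (K : Type*) [NormedAddCommGroup K] [InnerProductSpace ℂ K] :
    (K →L[ℂ] K) →L[ℂ] (K →Lₚₜ[ℂ] K) :=
  ContinuousLinearMap.toPointwiseConvergenceCLM ℂ (RingHom.id ℂ) K K

theorem eq_zero_of_mem_sotClosure {K Z : Type*} [NormedAddCommGroup K] [InnerProductSpace ℂ K]
    [NormedAddCommGroup Z] [NormedSpace ℂ Z] {M : Submodule ℂ (K →L[ℂ] K)}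
    (ψ : (K →Lₚₜ[ℂ] K) →L[ℂ] Z) (h : ∀ T ∈ M, ψ (toSOT K T) = 0) {f : K →L[ℂ] K}
    (hf : f ∈ sotClosure M) : ψ (toSOT K f) = 0 := by
  have h4 : (Submodule.map (toSOT K : (K →L[ℂ] K) →ₗ[ℂ] (K →Lₚₜ[ℂ] K)) M).topologicalClosure ≤
      LinearMap.ker ψ.toLinearMap := by
    refine Submodule.topologicalClosure_minimal _ ?_ ψ.isClosed_ker
    rintro _ ⟨T, hT, rfl⟩
    exact h T hT
  exact h4 hf

/-- The kernel of a strongly continuous linear map, as a space of operators. -/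
def sotKer {K Z : Type*} [NormedAddCommGroup K] [InnerProductSpace ℂ K]
    [NormedAddCommGroup Z] [NormedSpace ℂ Z] (ψ : (K →Lₚₜ[ℂ] K) →L[ℂ] Z) :
    Submodule ℂ (K →L[ℂ] K) := LinearMap.ker (ψ.comp (toSOT K)).toLinearMap

section Kernel

variable {K Z : Type*} [NormedAddCommGroup K] [InnerProductSpace ℂ K]
    [NormedAddCommGroup Z] [NormedSpace ℂ Z] {ψ : (K →Lₚₜ[ℂ] K) →L[ℂ] Z}

theorem mem_sotKer {T : K →L[ℂ] K} : T ∈ sotKer ψ ↔ ψ (toSOT K T) = 0 := Iff.rfl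

theorem isClosed_sotKer (ψ : (K →Lₚₜ[ℂ] K) →L[ℂ] Z) :
    IsClosed (sotKer ψ : Set (K →L[ℂ] K)) := (ψ.comp (toSOT K)).isClosed_ker

variable [CompleteSpace K]

theorem mem_adjointSpace {N : Submodule ℂ (K →L[ℂ] K)} {T : K →L[ℂ] K} :
    T ∈ adjointSpace N ↔ star T ∈ N := Iff.rfl

theorem isClosed_adjointSpace {N : Submodule ℂ (K →L[ℂ] K)} (hN : IsClosed (N : Set (K →L[ℂ] K))) :
    IsClosed (adjointSpace N : Set (K →L[ℂ] K)) := hN.preimage continuous_star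

/-- Taking adjoints is conjugate linear and in general not strongly continuous, so `ψ` is tested on
`A` and on `A^*` separately. -/
theorem eq_zero_of_mem_sotClosure_adjointSpace_sup {A : Submodule ℂ (K →L[ℂ] K)}
    (ψ : (K →Lₚₜ[ℂ] K) →L[ℂ] Z) (h : A ≤ sotKer ψ) (hstar : A ≤ adjointSpace (sotKer ψ))
    {f : K →L[ℂ] K} (hf : f ∈ sotClosure (adjointSpace A ⊔ A)) : ψ (toSOT K f) = 0 := by
  refine eq_zero_of_mem_sotClosure ψ (M := adjointSpace A ⊔ A) (fun T hT => ?_) hf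
  have h3 : adjointSpace A ⊔ A ≤ sotKer ψ := by
    refine sup_le (fun T hT => ?_) h
    have : star (star T) ∈ sotKer ψ := hstar hT
    rwa [star_star] at this
  exact mem_sotKer.1 (h3 hT)

end Kernel

/-- The monomials `S_α` span the generated algebra, and for fixed `a` the map `b ↦ a ⊗ b` is norm
continuous, so both closures are absorbed by a closed `N`. -/
theorem discAlgebraTensor_le {N : Submodule ℂ (HilbertTensor E (Fock n) →L[ℂ] HilbertTensor E (Fock n))}
    (hN : IsClosed (N : Set (HilbertTensor E (Fock n) →L[ℂ] HilbertTensor E (Fock n))))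
    (h : ∀ (a : E →L[ℂ] E) (α : FreeMonoid (Fin n)),
      opTensor a (FreeMonoid.lift leftCreation α) ∈ N) :
    discAlgebraTensor n E ≤ N := by
  refine Submodule.topologicalClosure_minimal _ (Submodule.span_le.2 ?_) hN
  rintro _ ⟨a, -, b, hb, rfl⟩
  set N' : Submodule ℂ (Fock n →L[ℂ] Fock n) :=
    N.comap (opTensorL E E (Fock n) (Fock n) a).toLinearMap with hN'
  have hc : IsClosed (N' : Set (Fock n →L[ℂ] Fock n)) :=
    hN.preimage (opTensorL E E (Fock n) (Fock n) a).continuous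
  have hle : Subalgebra.toSubmodule (Algebra.adjoin ℂ (Set.range (leftCreation (n := n)))) ≤ N' := by
    rw [Algebra.adjoin_eq_span, Submodule.span_le]
    intro c hc
    have hr : (Submonoid.closure (Set.range (leftCreation (n := n)))) =
        MonoidHom.mrange (FreeMonoid.lift leftCreation) := (FreeMonoid.mrange_lift _).symm
    rw [hr] at hc
    obtain ⟨α, rfl⟩ := hc
    exact h a α
  have hb' : b ∈ closure ((Algebra.adjoin ℂ (Set.range (leftCreation (n := n))) :
      Set (Fock n →L[ℂ] Fock n))) := hb
  exact closure_minimal hle hc hb'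

variable [CompleteSpace E]

/-- Kernels of strongly continuous maps are strongly closed. This replaces approximation by bounded
nets: any identity that is linear and strongly continuous in `f` need only be checked on monomials
and their adjoints. -/
theorem boundarySpace_induction {Z : Type*} [NormedAddCommGroup Z] [NormedSpace ℂ Z]
    (ψ : (HilbertTensor E (Fock n) →Lₚₜ[ℂ] HilbertTensor E (Fock n)) →L[ℂ] Z)
    (h : ∀ (a : E →L[ℂ] E) (α : FreeMonoid (Fin n)),
      ψ (toSOT _ (opTensor a (FreeMonoid.lift leftCreation α))) = 0)
    (hstar : ∀ (a : E →L[ℂ] E) (α : FreeMonoid (Fin n)),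
      ψ (toSOT _ (star (opTensor a (FreeMonoid.lift leftCreation α)))) = 0)
    {f : HilbertTensor E (Fock n) →L[ℂ] HilbertTensor E (Fock n)} (hf : f ∈ boundarySpace n E) :
    ψ (toSOT _ f) = 0 := by
  refine eq_zero_of_mem_sotClosure_adjointSpace_sup ψ (discAlgebraTensor_le
    (isClosed_sotKer ψ) fun a α => mem_sotKer.2 (h a α)) (discAlgebraTensor_le
    (isClosed_adjointSpace (isClosed_sotKer ψ)) fun a α => mem_adjointSpace.2 ?_) hf
  exact mem_sotKer.2 (hstar a α)

/-- `f ↦ f_{γβ} x` as a strongly continuous map. -/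
def entrySOT (γ β : FreeMonoid (Fin n)) (x : E) :
    (HilbertTensor E (Fock n) →Lₚₜ[ℂ] HilbertTensor E (Fock n)) →L[ℂ] E :=
  (coord E γ).comp (PointwiseConvergenceCLM.evalCLM (RingHom.id ℂ) (HilbertTensor E (Fock n))
    (hTmul x (fockBasis β)))

theorem entrySOT_apply (γ β : FreeMonoid (Fin n)) (x : E)
    (f : HilbertTensor E (Fock n) →L[ℂ] HilbertTensor E (Fock n)) :
    entrySOT γ β x (toSOT _ f) = entry γ β f x := rfl

/-- The multi-Toeplitz operators on `E ⊗ F²(H_n)`. -/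
structure IsMultiToeplitz (f : HilbertTensor E (Fock n) →L[ℂ] HilbertTensor E (Fock n)) : Prop where
  lower : ∀ α β : FreeMonoid (Fin n), entry (α * β) β f = entry α 1 f
  upper : ∀ α γ : FreeMonoid (Fin n), entry γ (α * γ) f = entry 1 α f
  off : ∀ γ β : FreeMonoid (Fin n), (∀ α, γ ≠ α * β) → (∀ α, β ≠ α * γ) → entry γ β f = 0

/-- Each relation is linear in entries, which are strongly continuous once applied to a vector. On
`a ⊗ S_α` it reduces to cancellation of words, since the entry at `(γ, β)` is `a` or `0` according
to whether `γ = αβ`. -/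
theorem isMultiToeplitz_of_mem_boundarySpace
    {f : HilbertTensor E (Fock n) →L[ℂ] HilbertTensor E (Fock n)} (hf : f ∈ boundarySpace n E) :
    IsMultiToeplitz f := by
  classical
  have hcancel : ∀ α₀ α β : FreeMonoid (Fin n), β = α₀ * (α * β) ↔ 1 = α₀ * α := by
    intro α₀ α β
    rw [← mul_assoc]
    constructor
    · intro h; exact mul_right_cancel ((one_mul β).trans h)
    · intro h; rw [← h, one_mul]
  refine ⟨fun α β => ?_, fun α γ => ?_, fun γ β h1 h2 => ?_⟩
  · ext x
    refine sub_eq_zero.1 (boundarySpace_induction (entrySOT (α * β) β x - entrySOT α 1 x)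
      (fun a α₀ => ?_) (fun a α₀ => ?_) hf) <;>
    simp only [sub_apply, entrySOT_apply, entry_star, entry_opTensor_lift, mul_right_cancel_iff,
      mul_one, hcancel, sub_self]
  · ext x
    refine sub_eq_zero.1 (boundarySpace_induction (entrySOT γ (α * γ) x - entrySOT 1 α x)
      (fun a α₀ => ?_) (fun a α₀ => ?_) hf) <;>
    simp only [sub_apply, entrySOT_apply, entry_star, entry_opTensor_lift, mul_right_cancel_iff,
      mul_one, hcancel, sub_self]
  · ext x
    refine boundarySpace_induction (entrySOT γ β x) (fun a α₀ => ?_) (fun a α₀ => ?_) hf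
    · rw [entrySOT_apply, entry_opTensor_lift, if_neg (h1 _), zero_apply]
    · rw [entrySOT_apply, entry_star, entry_opTensor_lift, if_neg (h2 _), star_zero, zero_apply]

theorem IsMultiToeplitz.star {f : HilbertTensor E (Fock n) →L[ℂ] HilbertTensor E (Fock n)}
    (hf : IsMultiToeplitz f) : IsMultiToeplitz (star f) where
  lower α β := by rw [entry_star, entry_star, hf.upper]
  upper α β := by rw [entry_star, entry_star, hf.lower]
  off γ β h1 h2 := by rw [entry_star, hf.off β γ h2 h1, star_zero]

theorem IsMultiToeplitz.add {f g : HilbertTensor E (Fock n) →L[ℂ] HilbertTensor E (Fock n)}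
    (hf : IsMultiToeplitz f) (hg : IsMultiToeplitz g) : IsMultiToeplitz (f + g) where
  lower α β := by rw [map_add, map_add, hf.lower, hg.lower]
  upper α β := by rw [map_add, map_add, hf.upper, hg.upper]
  off γ β h1 h2 := by rw [map_add, hf.off γ β h1 h2, hg.off γ β h1 h2, add_zero]

theorem IsMultiToeplitz.smul (c : ℂ) {f : HilbertTensor E (Fock n) →L[ℂ] HilbertTensor E (Fock n)}
    (hf : IsMultiToeplitz f) : IsMultiToeplitz (c • f) where
  lower α β := by rw [map_smul, map_smul, hf.lower]
  upper α β := by rw [map_smul, map_smul, hf.upper]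
  off γ β h1 h2 := by rw [map_smul, hf.off γ β h1 h2, smul_zero]

theorem IsMultiToeplitz.rePart {f : HilbertTensor E (Fock n) →L[ℂ] HilbertTensor E (Fock n)}
    (hf : IsMultiToeplitz f) : IsMultiToeplitz (rePart f) := (hf.add hf.star).smul _

open scoped Classical in
/-- The coefficients `A` with `f = Re ∑ A_α ⊗ S_α`, for a selfadjoint multi-Toeplitz operator. -/
def toeplitzCoeff (f : HilbertTensor E (Fock n) →L[ℂ] HilbertTensor E (Fock n))
    (α : FreeMonoid (Fin n)) : E →L[ℂ] E :=
  (if α = 1 then 1 else 2 : ℂ) • entry α 1 f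

/-- Selfadjointness reduces the entries with `β = αγ` to those with `γ = αβ`; the remaining entries
vanish on both sides. -/
theorem entry_rePart_homPart_toeplitzCoeff
    {f : HilbertTensor E (Fock n) →L[ℂ] HilbertTensor E (Fock n)} (hf : IsMultiToeplitz f)
    (hs : star f = f) (γ β : FreeMonoid (Fin n)) :
    entry γ β (rePart (homPart (toeplitzCoeff f) leftCreation (gap γ β))) = entry γ β f := by
  have hlow : ∀ α β : FreeMonoid (Fin n),
      entry (α * β) β (rePart (homPart (toeplitzCoeff f) leftCreation (gap (α * β) β))) =
        entry (α * β) β f := by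
    intro α β
    rw [entry_rePart, gap_mul_left, entry_homPart_mul, hf.lower]
    -- On the diagonal, the homogeneous part and its adjoint both contribute half of the
    -- coefficient; off the diagonal only one of them does. This accounts for the factors `1` and
    -- `2` in the coefficients.
    by_cases hα : α = 1
    · subst hα
      have h1 : entry β (1 * β) (homPart (toeplitzCoeff f) leftCreation
          (1 : FreeMonoid (Fin n)).length) = toeplitzCoeff f 1 := by
        have := entry_homPart_mul (toeplitzCoeff f) 1 β
        rwa [one_mul] at this ⊢
      have h2 : star (entry 1 1 f) = entry 1 1 f := by rw [← entry_star, hs]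
      rw [h1, toeplitzCoeff, if_pos rfl, one_smul, h2, ← two_smul ℂ, smul_smul]
      norm_num
    · rw [entry_homPart_eq_zero, star_zero, add_zero, toeplitzCoeff, if_neg hα, smul_smul]
      · norm_num
      · intro α' hα' he
        have h3 := congrArg FreeMonoid.length he
        simp only [FreeMonoid.length_mul] at h3
        exact hα (FreeMonoid.length_eq_zero.1 (by omega))
  by_cases h1 : ∃ α, γ = α * β
  · obtain ⟨α, rfl⟩ := h1
    exact hlow α β
  by_cases h2 : ∃ α, β = α * γ
  · obtain ⟨α, rfl⟩ := h2
    have h3 : star (rePart (homPart (toeplitzCoeff f) leftCreation (gap γ (α * γ)))) =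
        rePart (homPart (toeplitzCoeff f) leftCreation (gap (α * γ) γ)) := by
      rw [gap_comm, rePart, star_smul, star_add, star_star, add_comm]
      simp
    rw [← star_star (entry γ (α * γ) (rePart _)), ← entry_star, h3, hlow, ← entry_star, hs]
  · rw [not_exists] at h1 h2
    rw [hf.off γ β h1 h2, entry_rePart, entry_homPart_eq_zero _ fun α _ => h1 α,
      entry_homPart_eq_zero _ fun α _ => h2 α]
    simp

theorem eq_rePart_add (f : HilbertTensor E (Fock n) →L[ℂ] HilbertTensor E (Fock n)) :
    f = rePart f + Complex.I • rePart (-Complex.I • f) := by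
  simp only [rePart, star_smul, smul_add, smul_smul, star_neg, RCLike.star_def, Complex.conj_I,
    neg_neg]
  have h1 : Complex.I * (1 / 2 * -Complex.I) = 1 / 2 := by
    linear_combination (-1 / 2) * Complex.I_mul_I
  have h2 : Complex.I * (1 / 2 * Complex.I) = -1 / 2 := by
    linear_combination (1 / 2) * Complex.I_mul_I
  rw [h1, h2]
  module

theorem star_rePart (f : HilbertTensor E (Fock n) →L[ℂ] HilbertTensor E (Fock n)) :
    star (rePart f) = rePart f := by
  rw [rePart, star_smul, star_add, star_star, add_comm]
  simp

theorem entry_pluriTerm_toeplitzCoeff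
    {f : HilbertTensor E (Fock n) →L[ℂ] HilbertTensor E (Fock n)} (hf : IsMultiToeplitz f)
    (γ β : FreeMonoid (Fin n)) :
    entry γ β (pluriTerm (toeplitzCoeff (rePart f)) (toeplitzCoeff (rePart (-Complex.I • f)))
      leftCreation (gap γ β)) = entry γ β f := by
  conv_rhs => rw [eq_rePart_add f]
  rw [pluriTerm, map_add, map_smul, map_add, map_smul,
    entry_rePart_homPart_toeplitzCoeff hf.rePart (star_rePart f),
    entry_rePart_homPart_toeplitzCoeff (hf.smul _).rePart (star_rePart _)]

/-- The coefficients sit in the vacuum column, and `∑_α ‖f_{α,1} x‖² ≤ ‖f‖² ‖x‖²`. With the factor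
at most `2` in each coefficient, every degree is bounded by `4 ‖f‖²`, a constant that `k`-th roots
do not see. -/
theorem one_le_convergenceRadius_toeplitzCoeff
    (f : HilbertTensor E (Fock n) →L[ℂ] HilbertTensor E (Fock n)) :
    1 ≤ convergenceRadius (toeplitzCoeff f) := by
  classical
  have key : ∀ k, ‖∑ i : Fin k → Fin n, star (toeplitzCoeff f (word i)) * toeplitzCoeff f (word i)‖ ≤
      4 * ‖f‖ ^ 2 := by
    intro k
    refine norm_sum_star_mul_self_le _ _ (fun x => ?_) (by positivity)
    have h1 := sum_le_hasSum (Finset.univ.map ⟨word, word_injective (n := n) (k := k)⟩)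
      (fun γ _ => sq_nonneg _) (hasSum_norm_coord_sq (f (hTmul x (fockBasis (1 : FreeMonoid (Fin n))))))
    rw [Finset.sum_map] at h1
    have h2 : ‖f (hTmul x (fockBasis (1 : FreeMonoid (Fin n))))‖ ≤ ‖f‖ * ‖x‖ := by
      refine (f.le_opNorm _).trans_eq ?_
      rw [norm_hTmul, (fockBasis_orthonormal n).1, mul_one]
    calc _ ≤ ∑ i : Fin k → Fin n, 4 * ‖entry (word i) 1 f x‖ ^ 2 := by
          refine Finset.sum_le_sum fun i _ => ?_
          rw [toeplitzCoeff, smul_apply, norm_smul, mul_pow]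
          gcongr
          split_ifs <;> norm_num
      _ = 4 * ∑ i : Fin k → Fin n, ‖entry (word i) 1 f x‖ ^ 2 := (Finset.mul_sum _ _ _).symm
      _ ≤ 4 * (‖f‖ * ‖x‖) ^ 2 := by
          gcongr
          exact h1.trans (pow_le_pow_left₀ (norm_nonneg _) h2 2)
      _ = _ := by ring
  rw [one_le_convergenceRadius_iff]
  intro d hd
  have hlim : Tendsto (fun k : ℕ => d ^ k) atTop (𝓝 ⊤) := ENNReal.tendsto_pow_atTop_nhds_top_iff.2 hd
  filter_upwards [hlim.eventually (lt_mem_nhds (ENNReal.ofReal_lt_top (r := 4 * ‖f‖ ^ 2)))] with k hk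
  rw [coeffNorm, ← ofReal_norm]
  refine (ENNReal.ofReal_le_ofReal (key k)).trans (hk.le.trans ?_)
  rw [← ENNReal.rpow_natCast]
  exact ENNReal.rpow_le_rpow_of_exponent_le hd.le (by have : (0 : ℝ) ≤ k := Nat.cast_nonneg k; linarith)

end Boundary

/-! ### The Poisson transform at `rS` -/

section RadialPoisson

variable {n : ℕ} {E : Type u} [NormedAddCommGroup E] [InnerProductSpace ℂ E] [CompleteSpace E]

/-- On a vector of the algebraic tensor product, `f ⊗ I` involves finitely many values of `f`, so it
is strongly continuous in `f` without any norm bound. -/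
theorem exists_opTensor_one_incl {K L : Type*} [NormedAddCommGroup K] [InnerProductSpace ℂ K]
    [NormedAddCommGroup L] [InnerProductSpace ℂ L] (t : K ⊗[ℂ] L) :
    ∃ ψ : (K →Lₚₜ[ℂ] K) →L[ℂ] HilbertTensor K L,
      ∀ f : K →L[ℂ] K, ψ (toSOT K f) = opTensor f 1 (tensorIncl t) := by
  induction t with
  | zero => exact ⟨0, fun f => by rw [map_zero, map_zero]; rfl⟩
  | add s t hs ht =>
    obtain ⟨φ, hφ⟩ := hs
    obtain ⟨ψ, hψ⟩ := ht
    exact ⟨φ + ψ, fun f => by rw [map_add, map_add, ← hφ, ← hψ]; rfl⟩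
  | tmul x y =>
    refine ⟨(tensorIncl.toContinuousLinearMap.comp ((TensorProduct.mkL ℂ K L).flip y)).comp
      (PointwiseConvergenceCLM.evalCLM (RingHom.id ℂ) K x), fun f => ?_⟩
    exact (opTensor_hTmul f 1 x y).symm

/-- Each application of `∑ R_i ⊗ r S_i^*` removes a letter of `β`, so the Neumann series stops; the
induction peels off one letter at a time. -/
theorem resolvent_radialShift_mem_range (r : Set.Ico (0 : ℝ) 1) (β : FreeMonoid (Fin n))
    (x : Fock n) :
    ∃ t : Fock n ⊗[ℂ] Fock n, resolvent (radialShift n r).1 (hTmul x (fockBasis β)) =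
      tensorIncl t := by
  induction β using FreeMonoid.inductionOn' generalizing x with
  | one =>
    refine ⟨x ⊗ₜ fockBasis 1, (eq_resolvent_apply (radialShift n r).2 ?_).symm⟩
    change hTmul x (fockBasis 1) = hTmul x (fockBasis 1) + _
    rw [← hTmul, reconstruction, sum_apply, Finset.sum_eq_zero, add_zero]
    intro i _
    rw [opTensor_hTmul, radialShift, star_smul, smul_apply, star_leftCreation_vacuum, smul_zero,
      hTmul_zero_right]
  | of_mul j β ih =>
    obtain ⟨t, ht⟩ := ih ((r : ℂ) • rightCreation j x)
    have h : reconstruction (radialShift n r).1 (hTmul x (fockBasis (FreeMonoid.of j * β))) =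
        hTmul ((r : ℂ) • rightCreation j x) (fockBasis β) := by
      rw [reconstruction, sum_apply, Finset.sum_eq_single j]
      · rw [opTensor_hTmul, radialShift, star_smul, smul_apply, star_leftCreation_of_mul, if_pos rfl,
          hTmul_smul_right, hTmul_smul_left]
        simp
      · intro i _ hi
        rw [opTensor_hTmul, radialShift, star_smul, smul_apply, star_leftCreation_of_mul, if_neg hi,
          smul_zero, hTmul_zero_right]
      · simp
    refine ⟨x ⊗ₜ fockBasis (FreeMonoid.of j * β) + t, ?_⟩
    rw [resolvent_apply_eq_add_resolvent (radialShift n r).2, h, ht, map_add, hTmul]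

/-- The ampliated kernel at `rS` maps `x ⊗ e_β` to an algebraic tensor, so this column of the
transform is strongly continuous in `f`. -/
theorem exists_poissonTransform_radialShift (r : Set.Ico (0 : ℝ) 1) (β : FreeMonoid (Fin n))
    (x : E) :
    ∃ ψ : (HilbertTensor E (Fock n) →Lₚₜ[ℂ] HilbertTensor E (Fock n)) →L[ℂ]
        HilbertTensor E (Fock n),
      ∀ f, ψ (toSOT _ f) = poissonTransform (radialShift n r).1 f (hTmul x (fockBasis β)) := by
  obtain ⟨t, ht⟩ := resolvent_radialShift_mem_range r β (fockBasis 1)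
  have h1 : ∀ s : Fock n ⊗[ℂ] Fock n, ∃ q : HilbertTensor E (Fock n) ⊗[ℂ] Fock n,
      hilbertAssoc E (Fock n) (Fock n) (hTmul x (tensorIncl s)) = tensorIncl q := by
    intro s
    induction s with
    | zero => exact ⟨0, by simp⟩
    | add s t hs ht =>
      obtain ⟨p, hp⟩ := hs
      obtain ⟨q, hq⟩ := ht
      exact ⟨p + q, by rw [map_add, hTmul_add_right, map_add, hp, hq, map_add]⟩
    | tmul y z => exact ⟨hTmul x y ⊗ₜ z, hilbertAssoc_hTmul x y z⟩
  obtain ⟨q, hq⟩ := h1 (TensorProduct.mapL 1 (ncDefect (radialShift n r).1) t)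
  obtain ⟨ψ, hψ⟩ := exists_opTensor_one_incl q
  refine ⟨(ContinuousLinearMap.adjoint (ampliatedKernel E (radialShift n r).1)).comp ψ, fun f => ?_⟩
  rw [ContinuousLinearMap.comp_apply, hψ, ← hq, ← opTensor_incl, ← ht]
  simp only [poissonTransform, ContinuousLinearMap.comp_apply, ampliatedKernel, opTensor_hTmul]
  rfl

/-- By strong continuity of both sides it is enough to treat monomials and their adjoints. At `rS`
the transform multiplies `a ⊗ S_α` by `r ^ |α|`, which is the length difference at its nonzero
entries. -/
theorem entry_poissonTransform_radialShift
    {f : HilbertTensor E (Fock n) →L[ℂ] HilbertTensor E (Fock n)} (hf : f ∈ boundarySpace n E)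
    (r : Set.Ico (0 : ℝ) 1) (γ β : FreeMonoid (Fin n)) :
    entry γ β (poissonTransform (radialShift n r).1 f) =
      (((r : ℝ) ^ gap γ β : ℝ) : ℂ) • entry γ β f := by
  classical
  ext x
  obtain ⟨ψ, hψ⟩ := exists_poissonTransform_radialShift (E := E) r β x
  have hgen : ∀ (a : E →L[ℂ] E) (α γ β : FreeMonoid (Fin n)),
      entry γ β (poissonTransform (radialShift n r).1 (opTensor a (FreeMonoid.lift leftCreation α))) =
        (((r : ℝ) ^ gap γ β : ℝ) : ℂ) • entry γ β (opTensor a (FreeMonoid.lift leftCreation α)) := by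
    intro a α γ β
    rw [poissonTransform_opTensor_lift (radialShift n r).2, radialShift, lift_smul,
      opTensor_smul_right, map_smul, entry_opTensor_lift]
    split_ifs with h
    · rw [h, gap_mul_left, Complex.ofReal_pow]
    · simp
  have h := boundarySpace_induction ((coord E γ).comp ψ -
    (((r : ℝ) ^ gap γ β : ℝ) : ℂ) • entrySOT γ β x) (fun a α => ?_) (fun a α => ?_) hf
  · rw [sub_apply, sub_eq_zero, ContinuousLinearMap.comp_apply, hψ, smul_apply, entrySOT_apply,
      ← entry_apply] at h
    exact h
  · rw [sub_apply, sub_eq_zero, ContinuousLinearMap.comp_apply, hψ, smul_apply, entrySOT_apply,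
      ← entry_apply, hgen]
    rfl
  · rw [sub_apply, sub_eq_zero, ContinuousLinearMap.comp_apply, hψ, smul_apply, entrySOT_apply,
      ← entry_apply, poissonTransform_star, entry_star, hgen, entry_star, star_smul, gap_comm]
    simp

end RadialPoisson

/-! ### Radial limits and the Poisson transform -/

section RadialLimitPoisson

theorem mem_sotClosure_of_tendsto {ι K : Type*} [NormedAddCommGroup K] [InnerProductSpace ℂ K]
    {M : Submodule ℂ (K →L[ℂ] K)} {l : Filter ι} [l.NeBot] {g : ι → K →L[ℂ] K} {f : K →L[ℂ] K}
    (hg : ∀ r, g r ∈ M) (h : ∀ x, Tendsto (fun r => g r x) l (𝓝 (f x))) : f ∈ sotClosure M := by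
  have ht : Tendsto (fun r => toSOT K (g r)) l (𝓝 (toSOT K f)) := by
    rw [PointwiseConvergenceCLM.tendsto_nhds]
    intro x ε hε
    filter_upwards [(Metric.tendsto_nhds.1 (h x)) ε hε] with r hr
    rw [dist_eq_norm] at hr
    exact hr
  have hm : toSOT K f ∈ closure ((M.map (toSOT K : (K →L[ℂ] K) →ₗ[ℂ] (K →Lₚₜ[ℂ] K)) :
      Submodule ℂ (K →Lₚₜ[ℂ] K)) : Set (K →Lₚₜ[ℂ] K)) :=
    mem_closure_of_tendsto ht (Eventually.of_forall fun r => ⟨g r, hg r, rfl⟩)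
  exact hm

theorem tendsto_of_dense {ι K L : Type*} [NormedAddCommGroup K] [NormedSpace ℂ K] [CompleteSpace K]
    [NormedAddCommGroup L] [NormedSpace ℂ L] [CompleteSpace L] {l : Filter ι} [l.NeBot]
    [l.IsCountablyGenerated]
    {g : ι → K →L[ℂ] L} {M : ℝ} (hM : ∀ r, ‖g r‖ ≤ M) {s : Set K}
    (hs : Dense (Submodule.span ℂ s : Set K)) {T : K →L[ℂ] L}
    (h : ∀ x ∈ s, Tendsto (fun r => g r x) l (𝓝 (T x))) (x : K) :
    Tendsto (fun r => g r x) l (𝓝 (T x)) := by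
  choose f hf using exists_tendsto_of_dense hM hs fun x hx => ⟨_, h x hx⟩
  have hT : continuousLinearMapOfTendsto g (tendsto_pi_nhds.2 hf) = T :=
    ContinuousLinearMap.ext_on hs fun x hx => tendsto_nhds_unique (hf x) (h x hx)
  rw [← hT]
  exact hf x

variable {n : ℕ} {E : Type u} {H : Type v}
  [NormedAddCommGroup E] [InnerProductSpace ℂ E] [CompleteSpace E]
  [NormedAddCommGroup H] [InnerProductSpace ℂ H] [CompleteSpace H]

theorem rePart_mem_adjointSpace_sup {K : Type*} [NormedAddCommGroup K] [InnerProductSpace ℂ K]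
    [CompleteSpace K] {M : Submodule ℂ (K →L[ℂ] K)} {T : K →L[ℂ] K} (hT : T ∈ M) :
    rePart T ∈ adjointSpace M ⊔ M := by
  refine Submodule.smul_mem _ _ (Submodule.add_mem _ (Submodule.mem_sup_right hT)
    (Submodule.mem_sup_left ?_))
  rwa [mem_adjointSpace, star_star]

theorem leftCreation_mem_discAlgebra (i : Fin n) : leftCreation i ∈ discAlgebra n :=
  Subalgebra.le_topologicalClosure _ (Algebra.subset_adjoin ⟨i, rfl⟩)

theorem homPart_radialShift_mem (A : FreeMonoid (Fin n) → (E →L[ℂ] E)) (r : Set.Ico (0 : ℝ) 1)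
    (k : ℕ) : homPart A (radialShift n r).1 k ∈ discAlgebraTensor n E := by
  refine Submodule.sum_mem _ fun i _ => Submodule.le_topologicalClosure _
    (Submodule.subset_span ⟨_, trivial, _, ?_, rfl⟩)
  generalize word i = α
  change FreeMonoid.lift (radialShift n r).1 α ∈ discAlgebra n
  induction α using FreeMonoid.inductionOn' with
  | one => rw [map_one]; exact one_mem _
  | of_mul i α ih =>
    rw [map_mul, FreeMonoid.lift_eval_of]
    exact mul_mem ((discAlgebra n).smul_mem (leftCreation_mem_discAlgebra i) _) ih

theorem pluriRep_radialShift_mem {A B : FreeMonoid (Fin n) → (E →L[ℂ] E)}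
    (hA : 1 ≤ convergenceRadius A) (hB : 1 ≤ convergenceRadius B) (r : Set.Ico (0 : ℝ) 1) :
    pluriRep A B (radialShift n r).1 ∈
      adjointSpace (discAlgebraTensor n E) ⊔ discAlgebraTensor n E := by
  have hmem : ∀ {C : FreeMonoid (Fin n) → (E →L[ℂ] E)}, 1 ≤ convergenceRadius C →
      ∑' k, homPart C (radialShift n r).1 k ∈ discAlgebraTensor n E := fun {C} hC =>
    (Submodule.isClosed_topologicalClosure _).mem_of_tendsto
      (summable_norm_homPart hC (radialShift n r)).of_norm.hasSum
      (Eventually.of_forall fun s => Submodule.sum_mem _ fun k _ => homPart_radialShift_mem C r k)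
  have h : pluriRep A B (radialShift n r).1 = rePart (∑' k, homPart A (radialShift n r).1 k) +
      Complex.I • rePart (∑' k, homPart B (radialShift n r).1 k) :=
    (hasSum_pluriTerm hA hB (radialShift n r)).unique
      ((hasSum_rePart (summable_norm_homPart hA (radialShift n r)).of_norm.hasSum).add
        ((hasSum_rePart
          (summable_norm_homPart hB (radialShift n r)).of_norm.hasSum).const_smul Complex.I))
  rw [h]
  exact Submodule.add_mem _ (rePart_mem_adjointSpace_sup (hmem hA))
    (Submodule.smul_mem _ _ (rePart_mem_adjointSpace_sup (hmem hB)))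

theorem mem_boundarySpace_of_isRadialLimit {A B : FreeMonoid (Fin n) → (E →L[ℂ] E)}
    (hA : 1 ≤ convergenceRadius A) (hB : 1 ≤ convergenceRadius B)
    {f : HilbertTensor E (Fock n) →L[ℂ] HilbertTensor E (Fock n)}
    (hf : IsRadialLimit (fun X : ncBall n (Fock n) => pluriRep A B X.1) f) :
    f ∈ boundarySpace n E :=
  mem_sotClosure_of_tendsto (l := radialFilter) (fun r => pluriRep_radialShift_mem hA hB r) hf

/-- The bound `M` is what lets `T ↦ T ⊗ I` pass to the strong limit. The transforms of `u(rS)` then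
converge strongly to that of `f`, and in norm to `u(X)`. -/
theorem poissonTransform_of_isRadialLimit {A B : FreeMonoid (Fin n) → (E →L[ℂ] E)}
    (hA : 1 ≤ convergenceRadius A) (hB : 1 ≤ convergenceRadius B) {M : ℝ}
    (hM : ∀ r, ‖pluriRep A B (radialShift n r).1‖ ≤ M)
    {f : HilbertTensor E (Fock n) →L[ℂ] HilbertTensor E (Fock n)}
    (hf : IsRadialLimit (fun X : ncBall n (Fock n) => pluriRep A B X.1) f) (X : ncBall n H) :
    poissonTransform X.1 f = pluriRep A B X.1 := by
  have h1 : ∀ z, Tendsto (fun r => opTensor (pluriRep A B (radialShift n r).1) (1 : H →L[ℂ] H) z)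
      radialFilter (𝓝 (opTensor f 1 z)) := by
    refine tendsto_of_dense (M := M) (fun r => ?_) (s := {z | ∃ x y, z = hTmul x y}) ?_ ?_
    · exact ((norm_opTensor_le _ _).trans (mul_le_of_le_one_right (norm_nonneg _)
        ContinuousLinearMap.norm_id_le)).trans (hM r)
    · exact (Submodule.dense_iff_topologicalClosure_eq_top).2 dense_span_hTmul
    · rintro _ ⟨x, y, rfl⟩
      simp only [opTensor_hTmul, one_apply_eq_self]
      have hc : Continuous fun x : HilbertTensor E (Fock n) => hTmul x y :=
        (tensorIncl.toContinuousLinearMap.comp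
          ((TensorProduct.mkL ℂ (HilbertTensor E (Fock n)) H).flip y)).continuous
      exact (hc.tendsto _).comp (hf x)
  refine ContinuousLinearMap.ext fun z => ?_
  have h2 : Tendsto (fun r => poissonTransform X.1 (pluriRep A B (radialShift n r).1) z)
      radialFilter (𝓝 (poissonTransform X.1 f z)) :=
    ((ContinuousLinearMap.adjoint (ampliatedKernel E X.1)).continuous.tendsto _).comp
      (h1 (ampliatedKernel E X.1 z))
  have h3 := ((ContinuousLinearMap.apply ℂ (HilbertTensor E H) z).continuous.tendsto _).comp
    (tendsto_poissonTransform_radialShift hA hB X)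
  exact tendsto_nhds_unique h2 h3

/-- An element `f` of the boundary space is the radial limit of the free pluriharmonic function
with coefficients read off from `f`. -/
theorem exists_coeff_of_mem_boundarySpace
    {f : HilbertTensor E (Fock n) →L[ℂ] HilbertTensor E (Fock n)} (hf : f ∈ boundarySpace n E) :
    ∃ A B : FreeMonoid (Fin n) → (E →L[ℂ] E), 1 ≤ convergenceRadius A ∧ 1 ≤ convergenceRadius B ∧
      (∀ r, ‖pluriRep A B (radialShift n r).1‖ ≤ ‖f‖) ∧
      IsRadialLimit (fun X : ncBall n (Fock n) => pluriRep A B X.1) f := by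
  set A := toeplitzCoeff (rePart f)
  set B := toeplitzCoeff (rePart (-Complex.I • f))
  have hA : 1 ≤ convergenceRadius A := one_le_convergenceRadius_toeplitzCoeff _
  have hB : 1 ≤ convergenceRadius B := one_le_convergenceRadius_toeplitzCoeff _
  have hent := entry_pluriTerm_toeplitzCoeff (isMultiToeplitz_of_mem_boundarySpace hf)
  -- Both operators have the entries of `f` multiplied by `r ^ gap γ β`.
  have hr : ∀ r, pluriRep A B (radialShift n r).1 = poissonTransform (radialShift n r).1 f :=
    fun r => ext_entry fun γ β => by
      rw [entry_pluriRep_radialShift hA hB, hent, entry_poissonTransform_radialShift hf]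
  have hM : ∀ r, ‖pluriRep A B (radialShift n r).1‖ ≤ ‖f‖ := fun r => by
    rw [hr]; exact norm_poissonTransform_le (radialShift n r).2 f
  obtain ⟨g, hg⟩ := exists_isRadialLimit hA hB hM
  have hgf : g = f := ext_entry fun γ β => by rw [entry_of_isRadialLimit hA hB hg, hent]
  exact ⟨A, B, hA, hB, hM, hgf ▸ hg⟩

theorem isRadialLimit_poissonTransform
    {f : HilbertTensor E (Fock n) →L[ℂ] HilbertTensor E (Fock n)} (hf : f ∈ boundarySpace n E) :
    IsRadialLimit (fun X : ncBall n (Fock n) => poissonTransform X.1 f) f := by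
  obtain ⟨A, B, hA, hB, hM, hr⟩ := exists_coeff_of_mem_boundarySpace hf
  simpa only [poissonTransform_of_isRadialLimit hA hB hM hr] using hr

theorem isFreePluriharmonicWith_poissonTransform {A B : FreeMonoid (Fin n) → (E →L[ℂ] E)}
    (hA : 1 ≤ convergenceRadius A) (hB : 1 ≤ convergenceRadius B) {M : ℝ}
    (hM : ∀ r, ‖pluriRep A B (radialShift n r).1‖ ≤ M)
    {f : HilbertTensor E (Fock n) →L[ℂ] HilbertTensor E (Fock n)}
    (hf : IsRadialLimit (fun X : ncBall n (Fock n) => pluriRep A B X.1) f) :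
    IsFreePluriharmonicWith A B (fun X : ncBall n H => poissonTransform X.1 f) :=
  isFreePluriharmonicWith_iff.2 ⟨hA, hB, poissonTransform_of_isRadialLimit hA hB hM hf⟩

theorem isBoundedOnBall_poissonTransform
    (f : HilbertTensor E (Fock n) →L[ℂ] HilbertTensor E (Fock n)) :
    IsBoundedOnBall (fun X : ncBall n H => poissonTransform X.1 f) := by
  refine ⟨‖f‖, ?_⟩
  rintro _ ⟨X, rfl⟩
  exact norm_poissonTransform_le X.2 f

theorem star_mem_minTensor {T : HilbertTensor E H →L[ℂ] HilbertTensor E H} (hT : T ∈ MinTensor E H) :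
    star T ∈ MinTensor E H := by
  have h : MinTensor E H ≤ adjointSpace (MinTensor E H) := by
    refine Submodule.topologicalClosure_minimal _ (Submodule.span_le.2 ?_)
      (isClosed_adjointSpace (Submodule.isClosed_topologicalClosure _))
    rintro _ ⟨a, -, b, -, rfl⟩
    change star (opTensor a b) ∈ MinTensor E H
    rw [star_opTensor]
    exact Submodule.le_topologicalClosure _ (Submodule.subset_span ⟨_, trivial, _, trivial, rfl⟩)
  exact h hT

theorem pluriRep_mem_minTensor {A B : FreeMonoid (Fin n) → (E →L[ℂ] E)}
    (hA : 1 ≤ convergenceRadius A) (hB : 1 ≤ convergenceRadius B) (X : ncBall n H) :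
    pluriRep A B X.1 ∈ MinTensor E H := by
  have h1 : ∀ (C : FreeMonoid (Fin n) → (E →L[ℂ] E)) k,
      rePart (homPart C X.1 k) ∈ MinTensor E H := by
    intro C k
    have h2 : homPart C X.1 k ∈ MinTensor E H := Submodule.sum_mem _ fun i _ =>
      Submodule.le_topologicalClosure _ (Submodule.subset_span ⟨_, trivial, _, trivial, rfl⟩)
    exact Submodule.smul_mem _ _ (Submodule.add_mem _ h2 (star_mem_minTensor h2))
  exact (Submodule.isClosed_topologicalClosure _).mem_of_tendsto (hasSum_pluriTerm hA hB X)
    (Eventually.of_forall fun s => Submodule.sum_mem _ fun k _ =>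
      Submodule.add_mem _ (h1 A k) (Submodule.smul_mem _ _ (h1 B k)))

theorem poissonTransform_mem_minTensor
    {f : HilbertTensor E (Fock n) →L[ℂ] HilbertTensor E (Fock n)} (hf : f ∈ boundarySpace n E)
    (X : ncBall n H) : poissonTransform X.1 f ∈ MinTensor E H := by
  obtain ⟨A, B, hA, hB, hM, hr⟩ := exists_coeff_of_mem_boundarySpace hf
  rw [poissonTransform_of_isRadialLimit hA hB hM hr]
  exact pluriRep_mem_minTensor hA hB X

end RadialLimitPoisson

/-! ### Compression of the representation on a large space to the Fock space -/

section Compression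

variable {n : ℕ} {E : Type u} {H : Type v}
  [NormedAddCommGroup E] [InnerProductSpace ℂ E] [CompleteSpace E]
  [NormedAddCommGroup H] [InnerProductSpace ℂ H] [CompleteSpace H]

/-- The tuple `(V Y_1 V^*, …, V Y_n V^*)`. -/
def conjTuple (V : Fock n →ₗᵢ[ℂ] H) (Y : Fin n → (Fock n →L[ℂ] Fock n)) (i : Fin n) : H →L[ℂ] H :=
  V.toContinuousLinearMap.comp ((Y i).comp (ContinuousLinearMap.adjoint V.toContinuousLinearMap))

theorem adjoint_comp_linearIsometry (V : Fock n →ₗᵢ[ℂ] H) (x : Fock n) :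
    ContinuousLinearMap.adjoint V.toContinuousLinearMap (V x) = x := by
  have h := (ContinuousLinearMap.norm_map_iff_adjoint_comp_self V.toContinuousLinearMap).1 V.norm_map
  exact DFunLike.congr_fun h x

theorem norm_linearIsometry_le (V : Fock n →ₗᵢ[ℂ] H) : ‖V.toContinuousLinearMap‖ ≤ 1 :=
  V.norm_toContinuousLinearMap_le

/-- Since `V^* V = I`, conjugation by `V` turns `∑ Y_i Y_i^*` into `V (∑ Y_i Y_i^*) V^*`. -/
theorem conjTuple_mem_ncBall (V : Fock n →ₗᵢ[ℂ] H) {Y : Fin n → (Fock n →L[ℂ] Fock n)}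
    (hY : Y ∈ ncBall n (Fock n)) : conjTuple V Y ∈ ncBall n H := by
  have h : ∑ i, conjTuple V Y i * star (conjTuple V Y i) = V.toContinuousLinearMap.comp
      ((∑ i, Y i * star (Y i)).comp (ContinuousLinearMap.adjoint V.toContinuousLinearMap)) := by
    ext x
    simp only [sum_apply, ContinuousLinearMap.comp_apply, map_sum]
    refine Finset.sum_congr rfl fun i _ => ?_
    change conjTuple V Y i (star (conjTuple V Y i) x) = _
    rw [ContinuousLinearMap.star_eq_adjoint, conjTuple, ContinuousLinearMap.adjoint_comp,
      ContinuousLinearMap.adjoint_comp, ContinuousLinearMap.adjoint_adjoint]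
    simp only [ContinuousLinearMap.comp_apply, LinearIsometry.coe_toContinuousLinearMap,
      adjoint_comp_linearIsometry]
    rfl
  have hle : ‖∑ i, conjTuple V Y i * star (conjTuple V Y i)‖ ≤ ‖∑ i, Y i * star (Y i)‖ := by
    rw [h]
    have h1 := norm_linearIsometry_le V
    have h2 : ‖ContinuousLinearMap.adjoint V.toContinuousLinearMap‖ ≤ 1 := by
      rwa [LinearIsometryEquiv.norm_map]
    calc _ ≤ ‖V.toContinuousLinearMap‖ * (‖∑ i, Y i * star (Y i)‖ *
          ‖ContinuousLinearMap.adjoint V.toContinuousLinearMap‖) :=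
          (ContinuousLinearMap.opNorm_comp_le _ _).trans
            (mul_le_mul_of_nonneg_left (ContinuousLinearMap.opNorm_comp_le _ _) (norm_nonneg _))
      _ ≤ 1 * (‖∑ i, Y i * star (Y i)‖ * 1) := by gcongr
      _ = _ := by ring
  exact (Real.sqrt_le_sqrt hle).trans_lt hY

/-- The empty word gives `I` and not `V V^*`, so the comparison is made on the range of `V`, which
`V Y_i V^*` leaves invariant. -/
theorem adjoint_lift_conjTuple (V : Fock n →ₗᵢ[ℂ] H) (Y : Fin n → (Fock n →L[ℂ] Fock n))
    (α : FreeMonoid (Fin n)) :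
    (ContinuousLinearMap.adjoint V.toContinuousLinearMap).comp
      ((FreeMonoid.lift (conjTuple V Y) α).comp V.toContinuousLinearMap) = FreeMonoid.lift Y α := by
  have h : ∀ x, FreeMonoid.lift (conjTuple V Y) α (V x) = V (FreeMonoid.lift Y α x) := by
    induction α using FreeMonoid.inductionOn' with
    | one => intro x; simp
    | of_mul i α ih =>
      intro x
      rw [map_mul, map_mul, FreeMonoid.lift_eval_of, FreeMonoid.lift_eval_of]
      change conjTuple V Y i (FreeMonoid.lift (conjTuple V Y) α (V x)) = _
      rw [ih, conjTuple]
      simp only [ContinuousLinearMap.comp_apply, LinearIsometry.coe_toContinuousLinearMap,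
        adjoint_comp_linearIsometry]
      rfl
  ext1 x
  simp only [ContinuousLinearMap.comp_apply, LinearIsometry.coe_toContinuousLinearMap, h,
    adjoint_comp_linearIsometry]

/-- The compression `T ↦ (I ⊗ V^*) T (I ⊗ V)`. -/
def compress (E : Type u) [NormedAddCommGroup E] [InnerProductSpace ℂ E] [CompleteSpace E]
    (V : Fock n →ₗᵢ[ℂ] H) : (HilbertTensor E H →L[ℂ] HilbertTensor E H) →L[ℂ]
      (HilbertTensor E (Fock n) →L[ℂ] HilbertTensor E (Fock n)) :=
  (ContinuousLinearMap.compL ℂ _ _ _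
      (ContinuousLinearMap.adjoint (opTensor (1 : E →L[ℂ] E) V.toContinuousLinearMap))).comp
    ((ContinuousLinearMap.compL ℂ _ _ _).flip (opTensor (1 : E →L[ℂ] E) V.toContinuousLinearMap))

theorem compress_apply (V : Fock n →ₗᵢ[ℂ] H) (T : HilbertTensor E H →L[ℂ] HilbertTensor E H) :
    compress E V T =
      (ContinuousLinearMap.adjoint (opTensor (1 : E →L[ℂ] E) V.toContinuousLinearMap)).comp
        (T.comp (opTensor (1 : E →L[ℂ] E) V.toContinuousLinearMap)) := rfl

theorem compress_star (V : Fock n →ₗᵢ[ℂ] H) (T : HilbertTensor E H →L[ℂ] HilbertTensor E H) :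
    compress E V (star T) = star (compress E V T) := by
  rw [compress_apply, compress_apply, ContinuousLinearMap.star_eq_adjoint (_ ∘L _),
    ContinuousLinearMap.adjoint_comp, ContinuousLinearMap.adjoint_comp,
    ContinuousLinearMap.adjoint_adjoint, ContinuousLinearMap.star_eq_adjoint,
    ContinuousLinearMap.comp_assoc]

theorem compress_homPart (V : Fock n →ₗᵢ[ℂ] H) (A : FreeMonoid (Fin n) → (E →L[ℂ] E))
    (Y : Fin n → (Fock n →L[ℂ] Fock n)) (k : ℕ) :
    compress E V (homPart A (conjTuple V Y) k) = homPart A Y k := by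
  rw [homPart, map_sum, homPart]
  refine Finset.sum_congr rfl fun i _ => ?_
  rw [compress_apply, adjoint_opTensor, opTensor_comp, opTensor_comp, adjoint_lift_conjTuple,
    ← ContinuousLinearMap.star_eq_adjoint, star_one]
  rfl

/-- Compression is linear, bounded and compatible with adjoints, so it acts on the series term by
term. This transfers information from the ball of `H` to that of the Fock space. -/
theorem compress_pluriRep (V : Fock n →ₗᵢ[ℂ] H) {A B : FreeMonoid (Fin n) → (E →L[ℂ] E)}
    (hA : 1 ≤ convergenceRadius A) (hB : 1 ≤ convergenceRadius B) (Y : ncBall n (Fock n)) :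
    compress E V (pluriRep A B (conjTuple V Y.1)) = pluriRep A B Y.1 := by
  have h := (hasSum_pluriTerm hA hB ⟨_, conjTuple_mem_ncBall V Y.2⟩).mapL (compress E V)
  simp only [pluriTerm, rePart, map_add, map_smul, compress_star, compress_homPart] at h
  exact h.unique (hasSum_pluriTerm hA hB Y)

theorem norm_opTensor_one_linearIsometry_le (V : Fock n →ₗᵢ[ℂ] H) :
    ‖opTensor (1 : E →L[ℂ] E) V.toContinuousLinearMap‖ ≤ 1 :=
  (norm_opTensor_le _ _).trans (mul_le_one₀ ContinuousLinearMap.norm_id_le (norm_nonneg _)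
    (norm_linearIsometry_le V))

theorem norm_matrixOp_compress_le {m : ℕ} (V : Fock n →ₗᵢ[ℂ] H)
    (T : Fin m → Fin m → (HilbertTensor E H →L[ℂ] HilbertTensor E H)) :
    ‖matrixOp fun i j => compress E V (T i j)‖ ≤ ‖matrixOp T‖ := by
  have h := norm_opTensor_one_linearIsometry_le (E := E) V
  refine (norm_matrixOp_comp_le T _ _).trans ?_
  calc _ ≤ 1 * ‖matrixOp T‖ * 1 := by
        gcongr
        rwa [LinearIsometryEquiv.norm_map]
    _ = _ := by ring

theorem norm_compress_le (V : Fock n →ₗᵢ[ℂ] H)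
    (T : HilbertTensor E H →L[ℂ] HilbertTensor E H) : ‖compress E V T‖ ≤ ‖T‖ := by
  have h := norm_opTensor_one_linearIsometry_le (E := E) V
  rw [compress_apply]
  calc _ ≤ _ * (‖T‖ * _) := (ContinuousLinearMap.opNorm_comp_le _ _).trans
        (mul_le_mul_of_nonneg_left (ContinuousLinearMap.opNorm_comp_le _ _) (norm_nonneg _))
    _ ≤ 1 * (‖T‖ * 1) := by
        gcongr
        rwa [LinearIsometryEquiv.norm_map]
    _ = _ := by ring

theorem compress_poissonTransform (V : Fock n →ₗᵢ[ℂ] H)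
    {f : HilbertTensor E (Fock n) →L[ℂ] HilbertTensor E (Fock n)} (hf : f ∈ boundarySpace n E)
    (Y : ncBall n (Fock n)) :
    compress E V (poissonTransform (conjTuple V Y.1) f) = poissonTransform Y.1 f := by
  obtain ⟨A, B, hA, hB, hM, hr⟩ := exists_coeff_of_mem_boundarySpace hf
  rw [poissonTransform_of_isRadialLimit hA hB hM hr,
    poissonTransform_of_isRadialLimit hA hB hM hr ⟨_, conjTuple_mem_ncBall V Y.2⟩,
    compress_pluriRep V hA hB]

/-- A bounded free pluriharmonic function is a Poisson transform. -/
theorem exists_isRadialLimit_of_isBoundedOnBall (V : Fock n →ₗᵢ[ℂ] H)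
    {A B : FreeMonoid (Fin n) → (E →L[ℂ] E)}
    {u : ncBall n H → (HilbertTensor E H →L[ℂ] HilbertTensor E H)}
    (hu : IsFreePluriharmonicWith A B u) (hb : IsBoundedOnBall u) :
    1 ≤ convergenceRadius A ∧ 1 ≤ convergenceRadius B ∧
    ∃ M, (∀ r, ‖pluriRep A B (radialShift n r).1‖ ≤ M) ∧
      ∃ f, IsRadialLimit (fun X : ncBall n (Fock n) => pluriRep A B X.1) f := by
  obtain ⟨hA, hB, hu⟩ := isFreePluriharmonicWith_iff.1 hu
  obtain ⟨M, hM⟩ := hb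
  have hM' : ∀ r, ‖pluriRep A B (radialShift n r).1‖ ≤ M := by
    intro r
    rw [← compress_pluriRep V hA hB]
    refine (norm_compress_le V _).trans ?_
    have := hM ⟨⟨_, conjTuple_mem_ncBall V (radialShift n r).2⟩, rfl⟩
    simpa only [hu] using this
  exact ⟨hA, hB, M, hM', exists_isRadialLimit hA hB hM'⟩

theorem eq_zero_of_poissonTransform_eq_zero (V : Fock n →ₗᵢ[ℂ] H)
    {f : HilbertTensor E (Fock n) →L[ℂ] HilbertTensor E (Fock n)} (hf : f ∈ boundarySpace n E)
    (h : ∀ X : ncBall n H, poissonTransform X.1 f = 0) : f = 0 := by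
  have hz : ∀ r, poissonTransform (radialShift n r).1 f = 0 := fun r => by
    rw [← compress_poissonTransform V hf, h ⟨_, conjTuple_mem_ncBall V (radialShift n r).2⟩, map_zero]
  refine ContinuousLinearMap.ext fun x => ?_
  have h1 := isRadialLimit_poissonTransform hf x
  simp only [hz, zero_apply] at h1
  exact tendsto_nhds_unique (l := radialFilter) h1 tendsto_const_nhds

/-- The transforms at `rS` are compressions of values on the ball of `H`, hence bounded by `b` as
matrices; they converge strongly to `f`, and norm bounds pass to strong limits. -/
theorem norm_matrixOp_le_of_poissonTransform (V : Fock n →ₗᵢ[ℂ] H) {m : ℕ}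
    {f : Fin m → Fin m → (HilbertTensor E (Fock n) →L[ℂ] HilbertTensor E (Fock n))}
    (hf : ∀ i j, f i j ∈ boundarySpace n E) {b : ℝ}
    (hb : ∀ X : ncBall n H, ‖matrixOp fun i j => poissonTransform X.1 (f i j)‖ ≤ b) :
    ‖matrixOp f‖ ≤ b := by
  have hb' : ∀ r, ‖matrixOp fun i j => poissonTransform (radialShift n r).1 (f i j)‖ ≤ b := by
    intro r
    have h1 := norm_matrixOp_compress_le (E := E) V fun i j =>
      poissonTransform (conjTuple V (radialShift n r).1) (f i j)
    simp only [compress_poissonTransform V (hf _ _)] at h1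
    exact h1.trans (hb ⟨_, conjTuple_mem_ncBall V (radialShift n r).2⟩)
  have hb0 : 0 ≤ b := (norm_nonneg _).trans (hb' ⟨0, by simp⟩)
  refine ContinuousLinearMap.opNorm_le_bound _ hb0 fun ξ => ?_
  have ht : Tendsto (fun r => (matrixOp fun i j => poissonTransform (radialShift n r).1 (f i j)) ξ)
      radialFilter (𝓝 (matrixOp f ξ)) := by
    have hp : Tendsto (fun r => WithLp.toLp 2 fun i => ∑ j,
        poissonTransform (radialShift n r).1 (f i j) (ξ j)) radialFilter
        (𝓝 (WithLp.toLp 2 fun i => ∑ j, f i j (ξ j))) :=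
      ((PiLp.continuous_toLp 2 _).tendsto _).comp (tendsto_pi_nhds.2 fun i =>
        tendsto_finsetSum _ fun j _ => isRadialLimit_poissonTransform (hf i j) (ξ j))
    have he : ∀ T : Fin m → Fin m → (HilbertTensor E (Fock n) →L[ℂ] HilbertTensor E (Fock n)),
        matrixOp T ξ = WithLp.toLp 2 fun i => ∑ j, T i j (ξ j) := fun T =>
      PiLp.ext fun i => matrixOp_apply T ξ i
    simpa only [he] using hp
  exact le_of_tendsto ht.norm (Eventually.of_forall fun r =>
    ContinuousLinearMap.le_of_opNorm_le _ (hb' r) ξ)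

/-- An orthonormal family indexed by words gives an embedding of the Fock space. -/
def fockEmbedding {v : FreeMonoid (Fin n) → H} (hv : Orthonormal ℂ v) : Fock n →ₗᵢ[ℂ] H :=
  hv.orthogonalFamily.linearIsometry

/-- There are countably many words, and a Hilbert basis of `H` is infinite. -/
theorem exists_fockEmbedding (hH : ¬ FiniteDimensional ℂ H) : Nonempty (Fock n →ₗᵢ[ℂ] H) := by
  obtain ⟨w, b, -⟩ := exists_hilbertBasis ℂ H
  have hw : Infinite w := by
    rw [← not_finite_iff_infinite]
    intro hfin
    have := Fintype.ofFinite w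
    exact hH b.toOrthonormalBasis.toBasis.finiteDimensional_of_finite
  obtain ⟨e⟩ : Nonempty (FreeMonoid (Fin n) ↪ w) := by
    have : Countable (FreeMonoid (Fin n)) := inferInstanceAs (Countable (List (Fin n)))
    obtain ⟨e, he⟩ := exists_injective_nat (FreeMonoid (Fin n))
    exact ⟨(⟨e, he⟩ : FreeMonoid (Fin n) ↪ ℕ).trans (Infinite.natEmbedding w)⟩
  exact ⟨fockEmbedding (b.orthonormal.comp e e.injective)⟩

/-- Boundedness of all representations concerns Hilbert spaces in the universe `w`, so a copy of the
Fock space is needed there. -/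
theorem exists_fockEmbedding_lp (n : ℕ) : Nonempty (Fock n →ₗᵢ[ℂ]
    lp (fun _ : ULift.{w} (FreeMonoid (Fin n)) => ℂ) 2) := by
  classical
  have hv : Orthonormal ℂ (fun α : FreeMonoid (Fin n) =>
      (lp.single 2 (ULift.up.{w} α) (1 : ℂ) : lp (fun _ : ULift.{w} (FreeMonoid (Fin n)) => ℂ) 2)) := by
    rw [orthonormal_iff_ite]
    intro α β
    simp only [lp.inner_single_left]
    by_cases h : α = β
    · subst h; simp
    · simp [h]
  exact ⟨fockEmbedding hv⟩

end Compression

/-! ### The correspondence between bounded functions and boundary operators -/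

section Main

variable {n : ℕ} {E : Type u} {H : Type v}
  [NormedAddCommGroup E] [InnerProductSpace ℂ E] [CompleteSpace E]
  [NormedAddCommGroup H] [InnerProductSpace ℂ H] [CompleteSpace H]

/-- If the representation on one space that contains a copy of the Fock space is bounded, then
every representation is the Poisson transform of the radial limit. -/
theorem exists_forall_eq_poissonTransform {K : Type w} [NormedAddCommGroup K]
    [InnerProductSpace ℂ K] [CompleteSpace K] (V : Fock n →ₗᵢ[ℂ] K)
    {A B : FreeMonoid (Fin n) → (E →L[ℂ] E)}
    {v : ncBall n K → (HilbertTensor E K →L[ℂ] HilbertTensor E K)}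
    (hv : IsFreePluriharmonicWith A B v) (hb : IsBoundedOnBall v)
    {u : ncBall n H → (HilbertTensor E H →L[ℂ] HilbertTensor E H)}
    (hu : IsFreePluriharmonicWith A B u) :
    ∃ f ∈ boundarySpace n E, (∀ X : ncBall n H, u X = poissonTransform X.1 f) ∧
      ∀ Y : ncBall n (Fock n), pluriRep A B Y.1 = poissonTransform Y.1 f := by
  obtain ⟨hA, hB, M, hM, f, hf⟩ := exists_isRadialLimit_of_isBoundedOnBall V hv hb
  refine ⟨f, mem_boundarySpace_of_isRadialLimit hA hB hf, fun X => ?_, fun Y => ?_⟩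
  · rw [(isFreePluriharmonicWith_iff.1 hu).2.2, poissonTransform_of_isRadialLimit hA hB hM hf]
  · rw [poissonTransform_of_isRadialLimit hA hB hM hf]

theorem hasBoundedRepresentations_poissonTransform
    {f : HilbertTensor E (Fock n) →L[ℂ] HilbertTensor E (Fock n)} (hf : f ∈ boundarySpace n E) :
    HasBoundedRepresentations.{u, v, w} (fun X : ncBall n H => poissonTransform X.1 f) := by
  obtain ⟨A, B, hA, hB, hM, hr⟩ := exists_coeff_of_mem_boundarySpace hf
  exact ⟨A, B, isFreePluriharmonicWith_poissonTransform hA hB hM hr, fun K _ _ _ =>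
    ⟨fun X => poissonTransform X.1 f, isFreePluriharmonicWith_poissonTransform hA hB hM hr,
      isBoundedOnBall_poissonTransform f⟩⟩

theorem eq_of_poissonTransform_eq (V : Fock n →ₗᵢ[ℂ] H)
    {f g : HilbertTensor E (Fock n) →L[ℂ] HilbertTensor E (Fock n)} (hf : f ∈ boundarySpace n E)
    (hg : g ∈ boundarySpace n E)
    (h : ∀ X : ncBall n H, poissonTransform X.1 f = poissonTransform X.1 g) : f = g := by
  refine sub_eq_zero.1 (eq_zero_of_poissonTransform_eq_zero V (sub_mem hf hg) fun X => ?_)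
  rw [← poissonTransformL_apply, map_sub, poissonTransformL_apply, poissonTransformL_apply, h,
    sub_self]

/-- The Poisson transform as a linear map from the boundary space to the bounded free
pluriharmonic functions. -/
def poissonExtension (n : ℕ) (E : Type u) (H : Type v)
    [NormedAddCommGroup E] [InnerProductSpace ℂ E] [CompleteSpace E]
    [NormedAddCommGroup H] [InnerProductSpace ℂ H] [CompleteSpace H] :
    boundarySpace n E →ₗ[ℂ] boundedHarmonic n E H where
  toFun f := ⟨fun X => ⟨poissonTransform X.1 f.1, poissonTransform_mem_minTensor f.2 X⟩, by
    obtain ⟨A, B, hA, hB, hM, hr⟩ := exists_coeff_of_mem_boundarySpace f.2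
    exact ⟨⟨A, B, isFreePluriharmonicWith_poissonTransform hA hB hM hr⟩,
      isBoundedOnBall_poissonTransform f.1⟩⟩
  map_add' f g := Subtype.ext (funext fun X => Subtype.ext (poissonTransform_add X.1 f.1 g.1))
  map_smul' c f := Subtype.ext (funext fun X => Subtype.ext (poissonTransform_smul X.1 c f.1))

theorem poissonExtension_apply (f : boundarySpace n E) (X : ncBall n H) :
    ((poissonExtension n E H f).1 X).1 = poissonTransform X.1 f.1 := rfl

/-- Compression to the Fock space and the radial limit recover `f`; conversely the radial limit of
`u` is a preimage of `u`. -/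
theorem bijective_poissonExtension (V : Fock n →ₗᵢ[ℂ] H) :
    Function.Bijective (poissonExtension n E H) := by
  refine ⟨fun f g h => Subtype.ext (eq_of_poissonTransform_eq V f.2 g.2 fun X => ?_), fun u => ?_⟩
  · rw [← poissonExtension_apply, h, poissonExtension_apply]
  · obtain ⟨⟨A, B, hu⟩, hb⟩ := u.2
    obtain ⟨f, hf, hfu, -⟩ := exists_forall_eq_poissonTransform V hu hb hu
    exact ⟨⟨f, hf⟩, Subtype.ext (funext fun X => Subtype.ext (hfu X).symm)⟩

end Main

end

end FreeHarmonic

theorem theorem3p1 (n : ℕ) (hn : 1 ≤ n)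
    (E : Type u) [NormedAddCommGroup E] [InnerProductSpace ℂ E] [CompleteSpace E]
    (H : Type v) [NormedAddCommGroup H] [InnerProductSpace ℂ H] [CompleteSpace H]
    (hH : ¬ FiniteDimensional ℂ H) :
    -- the equivalence, with boundedness on `H` and with boundedness of every representation
    (∀ u : ncBall n H → MinTensor E H,
      List.TFAE [
        IsFreePluriharmonic (fun X => (u X).1) ∧ IsBoundedOnBall (fun X => (u X).1),
        HasBoundedRepresentations.{u, v, w} (fun X => (u X).1),
        ∃ f ∈ boundarySpace n E, ∀ X : ncBall n H, (u X).1 = poissonTransform X.1 f]) ∧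
    -- in this case `f` is the radial limit of `u`
    (∀ (u : ncBall n H → MinTensor E H), ∀ f ∈ boundarySpace n E,
      (∀ X : ncBall n H, (u X).1 = poissonTransform X.1 f) →
        ∃ v : ncBall n (Fock n) → (HilbertTensor E (Fock n) →L[ℂ] HilbertTensor E (Fock n)),
          (∀ v', IsRepresentationOf (fun X => (u X).1) v' ↔ v' = v) ∧ IsRadialLimit v f) ∧
    -- the map `u ↦ f` is a completely isometric linear isomorphism
    (∃ Φ : boundedHarmonic n E H ≃ₗ[ℂ] boundarySpace n E,
      (∀ (u : boundedHarmonic n E H) (X : ncBall n H),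
        (u.1 X).1 = poissonTransform X.1 (Φ u).1) ∧
      (∀ (m : ℕ) (U : Fin m → Fin m → boundedHarmonic n E H),
        IsLUB (Set.range fun X : ncBall n H => ‖matrixOp fun i j => ((U i j).1 X).1‖)
          ‖matrixOp fun i j => (Φ (U i j)).1‖)) := by
  obtain ⟨V⟩ := exists_fockEmbedding (n := n) hH
  refine ⟨fun u => ?_, fun u f hf hu => ?_, ?_⟩
  · tfae_have 1 → 3 := by
      rintro ⟨⟨A, B, hu⟩, hb⟩
      obtain ⟨f, hf, hfu, -⟩ := exists_forall_eq_poissonTransform V hu hb hu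
      exact ⟨f, hf, hfu⟩
    tfae_have 3 → 2 := by
      rintro ⟨f, hf, hu⟩
      rw [funext hu]
      exact hasBoundedRepresentations_poissonTransform hf
    tfae_have 2 → 1 := by
      rintro ⟨A, B, hu, hK⟩
      -- Boundedness on this one space already yields the boundary operator `f`, whose Poisson
      -- transform is bounded on the ball of `H`.
      obtain ⟨W⟩ := exists_fockEmbedding_lp.{w} n
      obtain ⟨v, hv, hb⟩ := hK (lp (fun _ : ULift.{w} (FreeMonoid (Fin n)) => ℂ) 2)
      obtain ⟨f, hf, hfu, -⟩ := exists_forall_eq_poissonTransform W hv hb hu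
      exact ⟨⟨A, B, hu⟩, by rw [funext hfu]; exact isBoundedOnBall_poissonTransform f⟩
    tfae_finish
  · refine ⟨fun Y => poissonTransform Y.1 f, fun v' => ⟨?_, ?_⟩, isRadialLimit_poissonTransform hf⟩
    · rintro ⟨A, B, huAB, hv'⟩
      have hb : IsBoundedOnBall (fun X => (u X).1) := by
        rw [funext hu]; exact isBoundedOnBall_poissonTransform f
      -- Any coefficients representing `u` have a radial limit `g` whose Poisson transform on `H` is
      -- `u`. Injectivity forces `g = f`, so the representation on the Fock space does not depend on
      -- the coefficients.
      obtain ⟨g, hg, hgu, hgv⟩ := exists_forall_eq_poissonTransform V huAB hb huAB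
      have hgf : g = f := eq_of_poissonTransform_eq V hg hf fun X => by rw [← hgu, hu]
      funext Y
      rw [(isFreePluriharmonicWith_iff.1 hv').2.2, hgv, hgf]
    · rintro rfl
      obtain ⟨A, B, hA, hB, hM, hr⟩ := exists_coeff_of_mem_boundarySpace hf
      refine ⟨A, B, ?_, isFreePluriharmonicWith_poissonTransform hA hB hM hr⟩
      rw [funext hu]
      exact isFreePluriharmonicWith_poissonTransform hA hB hM hr
  · set Ψ := LinearEquiv.ofBijective (poissonExtension n E H) (bijective_poissonExtension V)
    have hΨ : ∀ (u : boundedHarmonic n E H) (X : ncBall n H),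
        (u.1 X).1 = poissonTransform X.1 (Ψ.symm u).1 := by
      intro u X
      rw [← poissonExtension_apply]
      exact congrArg (fun v : boundedHarmonic n E H => (v.1 X).1) (Ψ.apply_symm_apply u).symm
    -- The upper bound is complete contractivity of the Poisson transform; that it is the least one
    -- comes from compression to the Fock space and the radial limit.
    refine ⟨Ψ.symm, hΨ, fun m U => ⟨?_, fun b hb => ?_⟩⟩
    · rintro _ ⟨X, rfl⟩
      simp only [hΨ]
      exact norm_matrixOp_poissonTransform_le X.2 _
    · refine norm_matrixOp_le_of_poissonTransform V (fun i j => (Ψ.symm (U i j)).2) fun X => ?_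
      have h := hb ⟨X, rfl⟩
      simpa only [hΨ] using h
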